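/- Let $0<\nu\le 1$ and $\lambda>0$, and let $p_k^\nu(t)$ ($k\ge 1$, $t\ge 0$) be the state probabilities of the fractional Yule process with one progenitor, i.e. the solution of $$\frac{d^\nu}{dt^\nu}p_k^\nu(t)=-\lambda k\,p_k^\nu(t)+\lambda(k-1)\,p_{k-1}^\nu(t)\quad(t>0),\qquad p_k^\nu(0)=\delta_{k,1},$$ where $\frac{d^\alpha}{dt^\alpha}f(t)=\frac1{\Gamma(n-\alpha)}\int_0^t f^{(n)}(s)(t-s)^{n-\alpha-1}ds$ (with $n=\lceil\alpha\rceil$; $=f^{(n)}(t)$ if $\alpha=n$) is the Caputo derivative, and where solutions are continuous on $[0,\infty)$ and continuously differentiable on $(0,\infty)$ with derivative integrable near $0$. Let $W_{-\nu,1-\nu}(-\xi)=\sum_{r\ge0}\frac{(-\xi)^r}{r!\,\Gamma(1-\nu(r+1))}$; the Wright distribution has density $W_{-\nu,1-\nu}(-\xi)$ on $(0,\infty)$ if $\nu<1$, and is the unit mass at $1$ if $\nu=1$. Then for all $t>0$ and $k\ge1$ the following holds. (1) If $\nu<1$, then $$\begin{aligned}p_k^\nu(t)&=\int_0^\infty\!\!\int_0^\infty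 e^{-\omega e^{\lambda\xi t^\nu}}\omega^{k-1}\frac{[e^{\lambda\xi t^\nu}-1]^{k-1}}{(k-1)!}W_{-\nu,1-\nu}(-\xi)\,d\omega\,d\xi\\&=\int_0^\infty\!\!\int_0^\infty\frac{e^{-\omega[e^{\lambda\xi t^\nu}-1]}\omega^{k-1}[e^{\lambda\xi t^\nu}-1]^{k-1}}{(k-1)!}e^{-\omega}W_{-\nu,1-\nu}(-\xi)\,d\omega\,d\xi\\&=\int_0^\infty\!\!\int_0^\infty\frac{e^{-\Lambda}\Lambda^{k-1}}{(k-1)!}e^{-\omega}W_{-\nu,1-\nu}(-\xi)\,d\omega\,d\xi,\qquad \Lambda=\int_0^{t^\nu}\omega\lambda\xi e^{\lambda\xi s}ds,\\&=\int_0^\infty\!\!\int_0^\infty\frac{e^{-\omega[e^{\lambda s}-1]}\omega^{k-1}[e^{\lambda s}-1]^{k-1}}{(k-1)!}e^{-\omega}\,\frac1{t^\nu}W_{-\nu,1-\nu}\!\left(-\frac s{t^\nu}\right)ds\,d\omega,\end{aligned}$$ and the integrand in the third line (equal to those in the first two) is absolutely integrable on $(0,\infty)^2$. (2) Let $\Omega$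 be exponential with mean $1$, let $\Xi$ be Wright-distributed and independent of $\Omega$, and let $M$ be a mixed non-homogeneous Poisson process with random intensity function $u\mapsto\Omega\lambda\Xi e^{\lambda\Xi u}$ (conditionally on $(\Omega,\Xi)$, a non-homogeneous Poisson process with that intensity). Then $p_k^\nu(t)=\Pr\{M(t^\nu)=k-1\}$. (3) Let $T_{2\nu}(s)$, $s\ge0$, be random times in $[0,\infty)$ whose laws $g(\cdot,s)$ solve, in the weak sense, $$\frac{\partial^{2\nu}}{\partial s^{2\nu}}g=\frac{\partial^2}{\partial x^2}g\ \ (x>0),\qquad \partial_xg|_{x=0}=0,\qquad g(x,0)=\delta(x),\qquad g_s(x,0)=0\ \text{ if }\nu>1/2,$$ that is: for every $\varphi\in C_c^\infty(\mathbb R)$ with $\varphi'(0)=0$ the function $u_\varphi(s)=\mathbf E\,\varphi(T_{2\nu}(s))$ is continuous on $[0,\infty)$, is $C^n$ on $(0,\infty)$ with $u_\varphi^{(n)}$ integrable near $0$ ($n=\lceil2\nu\rceil$), satisfies $\frac{d^{2\nu}}{ds^{2\nu}}u_\varphi(s)=u_{\varphi''}(s)$ for $s>0$ and, if $\nu>1/2$,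 $u_\varphi'(0+)=0$; and $T_{2\nu}(0)=0$. For $\omega>0$ let $N_\omega$ be a non-homogeneous Poisson process with intensity function $u\mapsto\omega\lambda e^{\lambda u}$. Then $$p_k^\nu(t)=\int_0^\infty e^{-\omega}\int_0^\infty\Pr\{N_\omega(s)=k-1\}\,\Pr\{T_{2\nu}(t)\in ds\}\,d\omega .$$ (4) Let $\Omega$ be exponential with mean $1$, let $N$ be a mixed non-homogeneous Poisson process with random intensity function $u\mapsto\Omega\lambda e^{\lambda u}$, and let $T_{2\nu}(t)$ be as in (3) and independent of $(\Omega,N)$. Then $p_k^\nu(t)=\Pr\{N(T_{2\nu}(t))=k-1\}$. -/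

import Mathlib

open Set Filter Topology MeasureTheory ProbabilityTheory
open scoped NNReal ENNReal

/-- The Caputo derivative of order `α > 0` (base point `0`) of `f` at `t`: with `n = ⌈α⌉`, it is
`f⁽ⁿ⁾(t)` if `α = n`, and `1 / Γ(n - α) ∫₀ᵗ f⁽ⁿ⁾(s) (t - s) ^ (n - α - 1) ds` otherwise. -/
noncomputable def caputoDeriv (α : ℝ) (f : ℝ → ℝ) (t : ℝ) : ℝ :=
  if α = (⌈α⌉₊ : ℝ) then iteratedDeriv ⌈α⌉₊ f t
  else (Real.Gamma ((⌈α⌉₊ : ℝ) - α))⁻¹ *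
    ∫ s in (0 : ℝ)..t, iteratedDeriv ⌈α⌉₊ f s * (t - s) ^ ((⌈α⌉₊ : ℝ) - α - 1)

/-- The functions on `[0, ∞)` whose Caputo derivative of order `α` exists classically: `f` is
continuous on `[0, ∞)`, of class `Cⁿ` on `(0, ∞)` with `n = ⌈α⌉`, and `f⁽ⁿ⁾` is integrable near `0`.
(The integrand in `caputoDeriv` is then integrable for every `t > 0`.) -/
structure CaputoRegular (α : ℝ) (f : ℝ → ℝ) : Prop where
  continuousOn : ContinuousOn f (Ici 0)
  contDiffOn : ContDiffOn ℝ ⌈α⌉₊ f (Ioi 0)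
  integrable : ∀ t : ℝ, 0 < t → IntervalIntegrable (iteratedDeriv ⌈α⌉₊ f) volume 0 t

/-- `p k t`, for `k ≥ 1` and `t ≥ 0`, are the state probabilities of the fractional Yule process of
order `ν` with birth rate `lam` and one progenitor: they solve the Cauchy problem
`dᵛ/dtᵛ p_k = - lam k p_k + lam (k - 1) p_{k-1}`, `p_k(0) = δ_{k,1}`, with the Caputo derivative.
The value `p 0` is irrelevant. -/
structure IsFractionalYule (ν lam : ℝ) (p : ℕ → ℝ → ℝ) : Prop where
  regular : ∀ k : ℕ, 1 ≤ k → CaputoRegular ν (p k)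
  equation : ∀ k : ℕ, 1 ≤ k → ∀ t : ℝ, 0 < t →
    caputoDeriv ν (p k) t = - lam * k * p k t + lam * ((k : ℝ) - 1) * p (k - 1) t
  initial : ∀ k : ℕ, 1 ≤ k → p k 0 = if k = 1 then 1 else 0

/-- The Wright function `W_{-ν, 1-ν}(x) = ∑ xʳ / (r! Γ(1 - ν (r + 1)))`. Mathlib's `Real.Gamma`
vanishes at the poles, so that `1 / Γ = 0` there, as it should. -/
noncomputable def wrightW (ν x : ℝ) : ℝ :=
  ∑' r : ℕ, x ^ r / ((r.factorial : ℝ) * Real.Gamma (1 - ν * ((r : ℝ) + 1)))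

/-- The Wright distribution: density `ξ ↦ W_{-ν, 1-ν}(-ξ)` on `(0, ∞)` for `0 < ν < 1`, and the unit
mass at `1` (its weak limit) for `ν = 1`, where the series vanishes identically. -/
noncomputable def wrightLaw (ν : ℝ) : Measure ℝ :=
  if ν = 1 then Measure.dirac 1
  else (volume.restrict (Ioi 0)).withDensity fun ξ => ENNReal.ofReal (wrightW ν (-ξ))

/-- The test functions `φ ∈ C_c^∞(ℝ)` with `φ'(0) = 0`; restricted to `[0, ∞)` they are the test
functions for the second derivative on `[0, ∞)` with Neumann condition at `0`. -/
structure IsNeumannTest (φ : ℝ → ℝ) : Prop where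
  contDiff : ContDiff ℝ (⊤ : ℕ∞) φ
  hasCompactSupport : HasCompactSupport φ
  deriv_zero : deriv φ 0 = 0

/-- The pairing `s ↦ ∫ φ(x) μ_s(dx)` of a family of measures on `[0, ∞)` with `φ`. -/
noncomputable def pairing (μ : ℝ≥0 → Measure ℝ≥0) (φ : ℝ → ℝ) (s : ℝ) : ℝ :=
  ∫ x : ℝ≥0, φ x ∂(μ s.toNNReal)

/-- The laws `μ t`, `t ≥ 0`, of the random times `T_{2ν}(t)`: probability measures on `[0, ∞)` that
solve, in the weak sense, the fractional diffusion problem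
`∂^{2ν} g / ∂t^{2ν} = ∂² g / ∂x²` for `x > 0`, `∂g/∂x = 0` at `x = 0`, `g(x, 0) = δ(x)`, and
`g_t(x, 0) = 0` if `1/2 < ν`, with the Caputo derivative in time. The Neumann condition is encoded
in the choice of the test functions, as usual. -/
structure IsFractionalDiffusionLaw (ν : ℝ) (μ : ℝ≥0 → Measure ℝ≥0) : Prop where
  isProbabilityMeasure : ∀ t, IsProbabilityMeasure (μ t)
  initial : μ 0 = Measure.dirac 0
  regular : ∀ φ : ℝ → ℝ, IsNeumannTest φ → CaputoRegular (2 * ν) (pairing μ φ)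
  equation : ∀ φ : ℝ → ℝ, IsNeumannTest φ → ∀ t : ℝ, 0 < t →
    caputoDeriv (2 * ν) (pairing μ φ) t = pairing μ (iteratedDeriv 2 φ) t
  initial_deriv : 1 / 2 < ν → ∀ φ : ℝ → ℝ, IsNeumannTest φ →
    Tendsto (deriv (pairing μ φ)) (𝓝[>] 0) (𝓝 0)

/-- `N` is a mixed non-homogeneous Poisson process with random intensity function `r (Θ ·)`: a
counting process started at `0` whose increments over consecutive time intervals are, conditionally
on `Θ = θ`, independent and Poisson with means the integrals of the intensity function `r θ`. -/
structure IsMixedPoissonProcess {S E : Type*} [MeasurableSpace S] [MeasurableSpace E]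
    (P : Measure S) (Θ : S → E) (r : E → ℝ → ℝ) (N : ℝ≥0 → S → ℕ) : Prop where
  measurable_param : Measurable Θ
  measurable : ∀ t, Measurable (N t)
  start : ∀ᵐ w ∂P, N 0 w = 0
  path : ∀ᵐ w ∂P, Monotone (fun t => N t w) ∧
    ∀ t, ContinuousWithinAt (fun s => N s w) (Ici t) t
  increments : ∀ (n : ℕ) (t : Fin (n + 1) → ℝ≥0), Monotone t → ∀ (j : Fin n → ℕ) (B : Set E),
    MeasurableSet B →
      P (Θ ⁻¹' B ∩ {w | ∀ i : Fin n, N (t i.succ) w = N (t i.castSucc) w + j i}) =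
        ∫⁻ θ in B, ∏ i : Fin n,
          poissonMeasure (∫ u in (t i.castSucc : ℝ)..(t i.succ : ℝ), r θ u).toNNReal {j i}
          ∂(P.map Θ)

/-- `N` is a non-homogeneous Poisson process with the deterministic intensity function `r`
(the case of a trivial mixing variable): independent Poisson increments with means `∫ r`. -/
def IsPoissonProcess {S : Type*} [MeasurableSpace S]
    (P : Measure S) (r : ℝ → ℝ) (N : ℝ≥0 → S → ℕ) : Prop :=
  IsMixedPoissonProcess P (fun _ => ()) (fun _ : Unit => r) N

/-! ### Hankel's formula for the reciprocal Gamma function, in logarithmic coordinates -/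

/-! Everything reduces to one formula: `p (k + 1) t` is the mean of the classical Yule weight
`e^{-x} (1 - e^{-x})^k` at `x = lam t^ν ξ`, with `ξ` distributed according to the Wright density. It
is `IsFractionalYule.eq_wrightMean`.

To prove it, the Caputo equations are turned into Volterra equations by
`CaputoRegular.eq_add_integral`. The alternating binomial sums `∑ (-1)^i C(j,i) p (i + 1)`
diagonalise the Yule system: each solves the scalar equation `v = 1 - lam (j + 1) I^ν v`. Picard
iteration (`abs_sub_mittagLefflerSum_le`) identifies a bounded solution with the Mittag-Leffler
function `E_ν(-lam (j + 1) t^ν)`. The same binomial sums of the Yule weights are `exp (-(j + 1) x)`,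
whose Wright mean is the same function by `hasSum_wrightMean_exp`; the binomial system is
triangular, so the two families agree.

The Laplace transform of the Wright density comes from Hankel's contour integral for `1 / Γ`.
Summing the series under the integral represents `W` on a contour along which `exp (-ξ e^{νw})`
decays in `ξ`; integrating in `ξ` and expanding a geometric series then produces `E_ν`.

For the random time, testing the diffusion law against cut-off cosines gives `u = 1 - η² I^{2ν} u`
for its cosine transform. Hence `u = E_{2ν}(-η² t^{2ν})`, which is the Wright mean of `cos (η t^ν
ξ)` (`IsFractionalDiffusionLaw.pairing_cos`). A finite measure on the half-line is determined by its
cosine transform, so `T_{2ν}(t)` is distributed as `t^ν Ξ`.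

The probabilistic statements follow because an exponential mixture of Poisson laws is geometric
(`integral_exp_mul_poissonWeight`), together with a discretisation of the random time
(`measureReal_time_change`).

Nonnegativity of the Wright function is never proved directly: `wrightMean` integrates against the
signed density, and the negative part is shown to vanish only where `wrightLaw ν` is known to be a
probability measure. -/

theorem integrable_exp_neg_abs : Integrable (fun s : ℝ => Real.exp (-|s|)) := by
  have h1 : IntegrableOn (fun s : ℝ => Real.exp (-|s|)) (Ioi 0) :=
    (exp_neg_integrableOn_Ioi 0 one_pos).congr_fun
      (fun x hx => by simp [abs_of_pos (show (0 : ℝ) < x from hx)]) measurableSet_Ioi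
  have h2 : IntegrableOn (fun s : ℝ => Real.exp (-|s|)) (Iic 0) :=
    (integrableOn_exp_Iic 0).congr_fun
      (fun x hx => by simp [abs_of_nonpos (show x ≤ 0 from hx)]) measurableSet_Iic
  simpa [Iic_union_Ioi] using h2.union h1

theorem tendsto_neg_exp_add_atBot {κ ν : ℝ} (hκ : 0 < κ) (hν : ν < 1) (A B : ℝ) :
    Tendsto (fun x => -κ * Real.exp x + A * x + B * Real.exp (ν * x)) atTop atBot := by
  have h1 : Tendsto (fun x : ℝ => x * Real.exp (-x)) atTop (𝓝 0) := by
    simpa using Real.tendsto_pow_mul_exp_neg_atTop_nhds_zero 1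
  have h2 : Tendsto (fun x : ℝ => Real.exp ((ν - 1) * x)) atTop (𝓝 0) :=
    Real.tendsto_exp_atBot.comp
      ((tendsto_const_mul_atBot_of_neg (by linarith)).2 tendsto_id)
  have h3 : Tendsto (fun x : ℝ => -κ + A * (x * Real.exp (-x)) + B * Real.exp ((ν - 1) * x))
      atTop (𝓝 (-κ)) := by
    simpa using (tendsto_const_nhds.add (h1.const_mul A)).add (h2.const_mul B)
  -- Factor out `exp x`: since `ν < 1`, the remaining factor tends to `-κ < 0`.
  refine (Real.tendsto_exp_atTop.atTop_mul_neg (by linarith : -κ < 0) h3).congr fun x => ?_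
  have e1 : Real.exp x * Real.exp (-x) = 1 := by rw [← Real.exp_add]; simp
  have e2 : Real.exp x * Real.exp ((ν - 1) * x) = Real.exp (ν * x) := by
    rw [← Real.exp_add]; ring_nf
  linear_combination (A * x) * e1 + B * e2

theorem exists_exp_bound {κ ν : ℝ} (hκ : 0 < κ) (hν : ν < 1) (A B L : ℝ) :
    ∃ C, 0 ≤ C ∧ ∀ x, L ≤ x →
      Real.exp (-κ * Real.exp x + A * |x| + B * Real.exp (ν * x)) ≤ C * Real.exp (-x) := by
  -- The extra `1` pays for the factor `exp (-x)` in the bound.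
  have h := tendsto_neg_exp_add_atBot hκ hν (A + 1) B
  obtain ⟨X, hX⟩ := (h.eventually (eventually_le_atBot 0)).exists_forall_of_atTop
  have hc : Continuous fun x : ℝ => -κ * Real.exp x + A * |x| + B * Real.exp (ν * x) + x := by
    fun_prop
  obtain ⟨M, hM⟩ := (isCompact_Icc (a := L) (b := max X 0)).bddAbove_image hc.continuousOn
  refine ⟨Real.exp (max M 0), by positivity, fun x hx => ?_⟩
  rw [← Real.exp_add]
  refine Real.exp_le_exp.2 ?_
  suffices -κ * Real.exp x + A * |x| + B * Real.exp (ν * x) + x ≤ max M 0 by linarith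
  by_cases hxX : x ≤ max X 0
  · exact (hM ⟨x, ⟨hx, hxX⟩, rfl⟩).trans (le_max_left _ _)
  · have h0 : max X 0 ≤ x := (not_le.1 hxX).le
    have := hX x ((le_max_left _ _).trans h0)
    rw [abs_of_nonneg ((le_max_right _ _).trans h0)]
    exact le_trans (by linarith) (le_max_right _ _)

/-- The Hankel contour `u = exp w` in the coordinate `w`: it comes from `∞ - iθ`, runs to `L - iθ`,
up to `L + iθ`, and then to `∞ + iθ`. -/
noncomputable def hankelPath (L θ s : ℝ) : ℂ :=
  ((L + max (|s| - θ) 0 : ℝ) : ℂ) + ((max (-θ) (min s θ) : ℝ) : ℂ) * Complex.I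

/-- The velocity of `hankelPath`. -/
noncomputable def hankelVel (θ s : ℝ) : ℂ :=
  if s ≤ -θ then -1 else if s ≤ θ then Complex.I else 1

theorem hankelPath_re (L θ s : ℝ) : (hankelPath L θ s).re = L + max (|s| - θ) 0 := by
  simp [hankelPath]

theorem hankelPath_im (L θ s : ℝ) : (hankelPath L θ s).im = max (-θ) (min s θ) := by
  simp [hankelPath]

theorem continuous_hankelPath (L θ : ℝ) : Continuous (hankelPath L θ) := by
  unfold hankelPath; fun_prop

theorem measurable_hankelVel (θ : ℝ) : Measurable (hankelVel θ) :=
  Measurable.ite measurableSet_Iic measurable_const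
    (Measurable.ite measurableSet_Iic measurable_const measurable_const)

theorem norm_hankelVel (θ s : ℝ) : ‖hankelVel θ s‖ = 1 := by
  unfold hankelVel; split_ifs <;> simp

theorem le_hankelPath_re (L θ s : ℝ) : L ≤ (hankelPath L θ s).re := by
  rw [hankelPath_re]; linarith [le_max_right (|s| - θ) 0]

theorem abs_le_hankelPath_re (L θ s : ℝ) : |s| ≤ (hankelPath L θ s).re - L + θ := by
  rw [hankelPath_re]; linarith [le_max_left (|s| - θ) 0]

theorem abs_hankelPath_im_le {θ : ℝ} (hθ : 0 ≤ θ) (L s : ℝ) : |(hankelPath L θ s).im| ≤ θ := by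
  rw [hankelPath_im, abs_le]
  exact ⟨le_max_left _ _, max_le (by linarith) (min_le_right _ _)⟩

/-- On the two rays the imaginary part is `±θ`, so `Re e^w` is exactly `cos θ · e^{Re w}`. On the
vertical segment only `Re e^w ≤ e^L` is available, and the additive constant is what that costs. -/
theorem re_exp_hankelPath_le {θ : ℝ} (hθ : Real.pi / 2 < θ) (hθ' : θ ≤ Real.pi) (L s : ℝ) :
    (Complex.exp (hankelPath L θ s)).re ≤
      Real.cos θ * Real.exp (hankelPath L θ s).re + Real.exp L * (1 - Real.cos θ) := by
  have hc : Real.cos θ ≤ 1 := Real.cos_le_one _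
  rw [Complex.exp_re]
  by_cases h : |s| ≤ θ
  · have hx : (hankelPath L θ s).re = L := by
      rw [hankelPath_re, max_eq_right (by linarith), add_zero]
    rw [hx]
    nlinarith [Real.exp_pos L, Real.cos_le_one (hankelPath L θ s).im]
  · have hy : Real.cos (hankelPath L θ s).im = Real.cos θ := by
      have hpi := Real.pi_pos
      rw [hankelPath_im]
      rcases lt_abs.1 (not_le.1 h) with h | h
      · rw [min_eq_right h.le, max_eq_right (by linarith)]
      · rw [min_eq_left (by linarith), max_eq_left (by linarith), Real.cos_neg]
    rw [hy]
    nlinarith [Real.exp_pos L]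

/-- Since `cos θ < 0`, the factor `e^{e^w}` decays doubly exponentially on the rays and absorbs any
linear term and any `e^{ν Re w}` with `ν < 1`. The `B` term is needed to dominate the Wright series.
-/
theorem exists_hankel_bound {θ ν : ℝ} (hθ : Real.pi / 2 < θ) (hθ' : θ ≤ Real.pi) (hν : ν < 1)
    (A B L : ℝ) : ∃ C, 0 ≤ C ∧ ∀ s,
      Real.exp ((Complex.exp (hankelPath L θ s)).re + A * |(hankelPath L θ s).re| +
        B * Real.exp (ν * (hankelPath L θ s).re)) ≤ C * Real.exp (-|s|) := by
  have hcos : Real.cos θ < 0 := Real.cos_neg_of_pi_div_two_lt_of_lt hθ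
    (by linarith [Real.pi_pos])
  obtain ⟨C, hC0, hC⟩ := exists_exp_bound (κ := -Real.cos θ) (by linarith) hν A B L
  refine ⟨Real.exp (Real.exp L * (1 - Real.cos θ)) * C * Real.exp (θ - L), by positivity,
    fun s => ?_⟩
  set x := (hankelPath L θ s).re
  have h1 := hC x (le_hankelPath_re L θ s)
  have h2 := re_exp_hankelPath_le hθ hθ' L s
  calc _ ≤ Real.exp (Real.exp L * (1 - Real.cos θ) +
        (-(-Real.cos θ) * Real.exp x + A * |x| + B * Real.exp (ν * x))) := by
        refine Real.exp_le_exp.2 ?_; linarith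
    _ ≤ Real.exp (Real.exp L * (1 - Real.cos θ)) * (C * Real.exp (-x)) := by
        rw [Real.exp_add]; gcongr
    _ ≤ Real.exp (Real.exp L * (1 - Real.cos θ)) * (C * (Real.exp (θ - L) * Real.exp (-|s|))) := by
        rw [← Real.exp_add (θ - L)]
        have := abs_le_hankelPath_re L θ s
        gcongr
        linarith
    _ = _ := by ring

/-- The contour integral `(2πi)⁻¹ ∫ g(w) dw` over `hankelPath`. -/
noncomputable def hankelIntegral (L θ : ℝ) (g : ℂ → ℂ) : ℂ :=
  (2 * Real.pi * Complex.I)⁻¹ * ∫ s, g (hankelPath L θ s) * hankelVel θ s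

theorem integrable_hankel {θ ν : ℝ} (hθ : Real.pi / 2 < θ) (hθ' : θ ≤ Real.pi) (hν : ν < 1)
    (A B L : ℝ) {g : ℂ → ℂ} (hg : Continuous g) (hb : ∀ w, L ≤ w.re → ‖g w‖ ≤
      Real.exp ((Complex.exp w).re + A * |w.re| + B * Real.exp (ν * w.re))) :
    Integrable (fun s => g (hankelPath L θ s) * hankelVel θ s) := by
  obtain ⟨C, hC0, hC⟩ := exists_hankel_bound hθ hθ' hν A B L
  refine (integrable_exp_neg_abs.const_mul C).mono'
    (((hg.comp (continuous_hankelPath L θ)).aestronglyMeasurable).mul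
      (measurable_hankelVel θ).aestronglyMeasurable) (ae_of_all _ fun s => ?_)
  rw [norm_mul, norm_hankelVel, mul_one]
  exact (hb _ (le_hankelPath_re L θ s)).trans (hC s)

theorem integral_Ioi_comp_add_right {E : Type*} [NormedAddCommGroup E] [NormedSpace ℝ E]
    (f : ℝ → E) (a c : ℝ) : ∫ x in Ioi a, f (x + c) = ∫ x in Ioi (a + c), f x := by
  have h := (measurePreserving_add_right (volume : Measure ℝ) c).setIntegral_preimage_emb
    (measurableEmbedding_addRight c) f (Ioi (a + c))
  simpa using h

/-- The lower ray is traversed inwards, with velocity `-1`, hence its minus sign. -/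
theorem integral_hankel_eq {L θ : ℝ} (hθ : 0 < θ) {g : ℂ → ℂ}
    (hi : Integrable (fun s => g (hankelPath L θ s) * hankelVel θ s)) :
    ∫ s, g (hankelPath L θ s) * hankelVel θ s =
      (∫ x in Ioi L, g (x + θ * Complex.I)) - (∫ x in Ioi L, g (x + (-θ : ℝ) * Complex.I)) +
        Complex.I * ∫ y in (-θ)..θ, g (L + y * Complex.I) := by
  have e1 : ∫ s in Iic (-θ), g (hankelPath L θ s) * hankelVel θ s =
      -∫ x in Ioi L, g (x + (-θ : ℝ) * Complex.I) := by
    have h := integral_comp_neg_Iic (-θ) (fun x : ℝ =>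
      -g ((x + (L - θ) : ℝ) + (-θ : ℝ) * Complex.I))
    rw [neg_neg, integral_Ioi_comp_add_right (fun x : ℝ => -g (x + (-θ : ℝ) * Complex.I)),
      show θ + (L - θ) = L by ring] at h
    rw [← integral_neg, ← h]
    refine setIntegral_congr_fun measurableSet_Iic fun s hs => ?_
    have hs : s ≤ -θ := hs
    simp only [hankelPath, hankelVel, if_pos hs]
    rw [abs_of_nonpos (by linarith), min_eq_left (by linarith), max_eq_left hs,
      max_eq_left (by linarith), show L + (-s - θ) = -s + (L - θ) by ring]
    ring
  have e3 : ∫ s in Ioi θ, g (hankelPath L θ s) * hankelVel θ s =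
      ∫ x in Ioi L, g (x + θ * Complex.I) := by
    have h := integral_Ioi_comp_add_right (fun x : ℝ => g (x + θ * Complex.I)) θ (L - θ)
    rw [show θ + (L - θ) = L by ring] at h
    rw [← h]
    refine setIntegral_congr_fun measurableSet_Ioi fun s hs => ?_
    have hs : θ < s := hs
    simp only [hankelPath, hankelVel, if_neg (show ¬ s ≤ -θ by linarith), if_neg hs.not_ge]
    rw [abs_of_nonneg (by linarith), min_eq_right hs.le,
      max_eq_right (show -θ ≤ θ by linarith), max_eq_left (show 0 ≤ s - θ by linarith),
      show L + (s - θ) = s + (L - θ) by ring]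
    ring
  have e2 : ∫ s in Ioc (-θ) θ, g (hankelPath L θ s) * hankelVel θ s =
      Complex.I * ∫ y in (-θ)..θ, g (L + y * Complex.I) := by
    rw [intervalIntegral.integral_of_le (by linarith), ← integral_const_mul]
    refine setIntegral_congr_fun measurableSet_Ioc fun s hs => ?_
    simp only [hankelPath, hankelVel, if_neg hs.1.not_ge, if_pos hs.2]
    rw [min_eq_left hs.2, max_eq_right hs.1.le, max_eq_right (by
      rw [sub_nonpos, abs_le]; exact ⟨hs.1.le, hs.2⟩)]
    simp [mul_comm]
  rw [← setIntegral_univ, ← Iic_union_Ioi (a := θ), setIntegral_union (Iic_disjoint_Ioi le_rfl)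
    measurableSet_Ioi hi.integrableOn hi.integrableOn, e3, show Iic θ = Iic (-θ) ∪ Ioc (-θ) θ from
      (Iic_union_Ioc_eq_Iic (by linarith)).symm, setIntegral_union (show Disjoint (Iic (-θ)) (Ioc (-θ) θ) from
      Set.disjoint_left.2 fun x h1 h2 => h2.1.not_ge h1) measurableSet_Ioc hi.integrableOn hi.integrableOn, e1, e2]
  ring

/-- The kernel `u ^ (a - 1) e ^ u du` in logarithmic coordinates. -/
noncomputable def gammaKernel (a : ℝ) (w : ℂ) : ℂ := Complex.exp (Complex.exp w + a * w)

theorem norm_gammaKernel (a : ℝ) (w : ℂ) :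
    ‖gammaKernel a w‖ = Real.exp ((Complex.exp w).re + a * w.re) := by
  simp [gammaKernel, Complex.norm_exp]

theorem differentiable_gammaKernel (a : ℝ) : Differentiable ℂ (gammaKernel a) := by
  unfold gammaKernel; fun_prop

theorem norm_gammaKernel_le {a θ y : ℝ} (x : ℝ) (hy : Real.cos y ≤ Real.cos θ) :
    ‖gammaKernel a (x + y * Complex.I)‖ ≤ Real.exp (Real.cos θ * Real.exp x + a * x) := by
  rw [norm_gammaKernel]
  refine Real.exp_le_exp.2 ?_
  simp [Complex.exp_re]
  nlinarith [Real.exp_pos x]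

theorem integrable_gammaKernel_hankel {θ : ℝ} (hθ : Real.pi / 2 < θ) (hθ' : θ ≤ Real.pi)
    (a L : ℝ) : Integrable (fun s => gammaKernel a (hankelPath L θ s) * hankelVel θ s) := by
  refine integrable_hankel hθ hθ' zero_lt_one |a| 0 L (differentiable_gammaKernel a).continuous
    fun w _ => ?_
  rw [norm_gammaKernel, zero_mul, add_zero]
  refine Real.exp_le_exp.2 ?_
  rw [← abs_mul]
  linarith [le_abs_self (a * w.re)]

theorem integrable_exp_neg_exp {κ a : ℝ} (hκ : 0 < κ) (ha : 0 < a) :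
    Integrable (fun x : ℝ => Real.exp (-κ * Real.exp x + a * x)) := by
  have hc : Continuous fun x : ℝ => Real.exp (-κ * Real.exp x + a * x) := by fun_prop
  obtain ⟨C, -, hC⟩ := exists_exp_bound hκ zero_lt_one a 0 0
  have h1 : IntegrableOn (fun x : ℝ => Real.exp (-κ * Real.exp x + a * x)) (Ioi 0) := by
    refine ((exp_neg_integrableOn_Ioi 0 one_pos).const_mul C).mono'
      hc.aestronglyMeasurable ((ae_restrict_iff' measurableSet_Ioi).2 (ae_of_all _ fun x hx => ?_))
    have hx : 0 < x := hx
    have := hC x hx.le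
    rw [abs_of_pos hx] at this
    simpa using this
  have h2 : IntegrableOn (fun x : ℝ => Real.exp (-κ * Real.exp x + a * x)) (Iic 0) := by
    refine (integrableOn_exp_mul_Iic ha 0).mono'
      hc.aestronglyMeasurable (ae_of_all _ fun x => ?_)
    rw [Real.norm_of_nonneg (Real.exp_pos _).le]
    exact Real.exp_le_exp.2 (by nlinarith [Real.exp_pos x])
  simpa [Iic_union_Ioi] using h2.union h1

theorem integrable_gammaKernel {a α : ℝ} (ha : 0 < a) (hα : Real.cos α < 0) :
    Integrable (fun x : ℝ => gammaKernel a (x + α * Complex.I)) := by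
  refine (integrable_exp_neg_exp (κ := -Real.cos α) (by linarith) ha).mono' ?_
    (ae_of_all _ fun x => ?_)
  · exact ((differentiable_gammaKernel a).continuous.comp (by fun_prop)).aestronglyMeasurable
  · simpa using norm_gammaKernel_le (a := a) x le_rfl

/-- Serves both ends: `κ < 0` as the real part tends to `+∞`, and `κ = 1` with `a > 0` as it tends
to `-∞`. -/
theorem tendsto_integral_gammaKernel_vertical {α β κ a : ℝ} (hαβ : α ≤ β) {l : Filter ℝ}
    (hcos : ∀ y ∈ Icc α β, Real.cos y ≤ κ)
    (hl : Tendsto (fun x => κ * Real.exp x + a * x) l atBot) :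
    Tendsto (fun x : ℝ => ∫ y in α..β, gammaKernel a (x + y * Complex.I)) l (𝓝 0) := by
  refine squeeze_zero_norm (a := fun x => Real.exp (κ * Real.exp x + a * x) * |β - α|)
    (fun x => ?_) (by simpa using (Real.tendsto_exp_atBot.comp hl).mul_const |β - α|)
  refine intervalIntegral.norm_integral_le_of_norm_le_const fun y hy => ?_
  rw [uIoc_of_le hαβ] at hy
  rw [norm_gammaKernel]
  refine Real.exp_le_exp.2 ?_
  have := hcos y ⟨hy.1.le, hy.2⟩
  simp [Complex.exp_re]
  nlinarith [Real.exp_pos x]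

theorem gammaKernel_rectangle (a α β x₁ x₂ : ℝ) :
    (∫ x in x₁..x₂, gammaKernel a (x + α * Complex.I)) -
      (∫ x in x₁..x₂, gammaKernel a (x + β * Complex.I)) +
      Complex.I * (∫ y in α..β, gammaKernel a (x₂ + y * Complex.I)) -
      Complex.I * (∫ y in α..β, gammaKernel a (x₁ + y * Complex.I)) = 0 := by
  simpa using Complex.integral_boundary_rect_eq_zero_of_differentiableOn (gammaKernel a)
    (x₁ + α * Complex.I) (x₂ + β * Complex.I) (differentiable_gammaKernel a).differentiableOn

theorem tendsto_exp_add_atBot {a : ℝ} (ha : 0 < a) (κ : ℝ) :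
    Tendsto (fun x => κ * Real.exp x + a * x) atBot atBot := by
  have h1 : Tendsto (fun x => κ * Real.exp x) atBot (𝓝 0) := by
    simpa using Real.tendsto_exp_atBot.const_mul κ
  exact h1.add_atBot ((tendsto_const_mul_atBot_of_pos ha).2 tendsto_id)

/-- Cauchy's theorem on the rectangle `[-R, R] × [α, β]`; both vertical sides vanish as `R → ∞`, the
left one because `a > 0`. -/
theorem integral_gammaKernel_shift {a α β : ℝ} (ha : 0 < a) (hαβ : α ≤ β) {κ : ℝ} (hκ : 0 < κ)
    (hcos : ∀ y ∈ Icc α β, Real.cos y ≤ -κ) :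
    ∫ x : ℝ, gammaKernel a (x + α * Complex.I) = ∫ x : ℝ, gammaKernel a (x + β * Complex.I) := by
  have hα : Real.cos α < 0 := by linarith [hcos α (left_mem_Icc.2 hαβ)]
  have hβ : Real.cos β < 0 := by linarith [hcos β (right_mem_Icc.2 hαβ)]
  have t1 := intervalIntegral_tendsto_integral (integrable_gammaKernel ha hα)
    tendsto_neg_atTop_atBot tendsto_id
  have t2 := intervalIntegral_tendsto_integral (integrable_gammaKernel ha hβ)
    tendsto_neg_atTop_atBot tendsto_id
  have t3 := tendsto_integral_gammaKernel_vertical (a := a) hαβ hcos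
    (by simpa using tendsto_neg_exp_add_atBot hκ zero_lt_one a 0)
  have t4 := (tendsto_integral_gammaKernel_vertical hαβ hcos
    (tendsto_exp_add_atBot ha (-κ))).comp tendsto_neg_atTop_atBot
  have := ((t1.sub t2).add (t3.const_mul Complex.I)).sub (t4.const_mul Complex.I)
  have h0 := tendsto_nhds_unique this (tendsto_const_nhds.congr fun R =>
    (gammaKernel_rectangle a α β (-R) R).symm)
  simpa [sub_eq_zero] using h0

/-- Cauchy's theorem on a half-strip to the left of `L`. It trades the vertical segment of the
Hankel contour for two left half-lines, which complete the rays to full lines. -/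
theorem integral_gammaKernel_left {a α β : ℝ} (ha : 0 < a) (hαβ : α ≤ β) (L : ℝ)
    (hα : Real.cos α < 0) (hβ : Real.cos β < 0) :
    (∫ x in Iic L, gammaKernel a (x + β * Complex.I)) -
      (∫ x in Iic L, gammaKernel a (x + α * Complex.I)) =
      Complex.I * ∫ y in α..β, gammaKernel a (L + y * Complex.I) := by
  have t1 := intervalIntegral_tendsto_integral_Iic L
    (integrable_gammaKernel ha hα).integrableOn tendsto_id
  have t2 := intervalIntegral_tendsto_integral_Iic L
    (integrable_gammaKernel ha hβ).integrableOn tendsto_id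
  have t4 := tendsto_integral_gammaKernel_vertical (κ := 1) hαβ (fun y _ => Real.cos_le_one y)
    (tendsto_exp_add_atBot ha 1)
  have := ((t1.sub t2).add_const
    (Complex.I * ∫ y in α..β, gammaKernel a (L + y * Complex.I))).sub (t4.const_mul Complex.I)
  have h0 := tendsto_nhds_unique this (tendsto_const_nhds.congr fun R =>
    (gammaKernel_rectangle a α β R L).symm)
  linear_combination -h0

theorem integral_exp_neg_exp_add {a : ℝ} (ha : 0 < a) :
    ∫ x : ℝ, Real.exp (-Real.exp x + a * x) = Real.Gamma a := by
  have himg : Real.exp '' univ = Ioi 0 := by rw [image_univ, Real.range_exp]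
  have h := integral_image_eq_integral_abs_deriv_smul (s := univ) MeasurableSet.univ
    (fun x _ => (Real.hasDerivAt_exp x).hasDerivWithinAt) Real.exp_injective.injOn
    (fun v => Real.exp (-v) * v ^ (a - 1))
  rw [himg, ← Real.Gamma_eq_integral ha, setIntegral_univ] at h
  rw [h]
  refine integral_congr_ae (ae_of_all _ fun x => ?_)
  simp only [abs_of_pos (Real.exp_pos x), smul_eq_mul]
  rw [← Real.exp_mul, ← Real.exp_add, ← Real.exp_add]
  ring_nf

/-- At height `σ = ±π` one has `e^w = -e^x`, and Euler's integral for `Γ` appears up to a phase. -/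
theorem integral_gammaKernel_pi {a : ℝ} (ha : 0 < a) {σ : ℝ} (hcos : Real.cos σ = -1) :
    ∫ x : ℝ, gammaKernel a (x + σ * Complex.I) =
      Complex.exp (a * σ * Complex.I) * Real.Gamma a := by
  rw [← integral_exp_neg_exp_add ha, ← integral_complex_ofReal, ← integral_const_mul]
  refine integral_congr_ae (ae_of_all _ fun x => ?_)
  have hsin : Real.sin σ = 0 := by nlinarith [Real.sin_sq_add_cos_sq σ]
  have he : Complex.exp (σ * Complex.I) = -1 := by
    rw [Complex.exp_mul_I, ← Complex.ofReal_cos, ← Complex.ofReal_sin, hcos, hsin]; simp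
  simp only [gammaKernel, Complex.ofReal_exp]
  rw [← Complex.exp_add, Complex.exp_add (x : ℂ), he]
  push_cast
  ring_nf

/-- The contour is straightened to two full lines at heights `±θ`, which are pushed to `±π`. The
difference of the two phases is `2i sin (πa)`, and the reflection formula concludes. -/
theorem hankelIntegral_gammaKernel_of_pos {θ : ℝ} (hθ : Real.pi / 2 < θ) (hθ' : θ ≤ Real.pi)
    (L : ℝ) {a : ℝ} (ha : 0 < a) :
    hankelIntegral L θ (gammaKernel a) = ((Real.Gamma (1 - a))⁻¹ : ℝ) := by
  have hpi := Real.pi_pos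
  have hcosy : ∀ y ∈ Icc θ Real.pi, Real.cos y ≤ -(-Real.cos θ) := fun y hy => by
    rw [neg_neg]
    exact Real.cos_le_cos_of_nonneg_of_le_pi (by linarith) hy.2 hy.1
  have hcos : Real.cos θ < 0 := Real.cos_neg_of_pi_div_two_lt_of_lt hθ (by linarith)
  have i1 := integrable_gammaKernel ha hcos
  have i2 := integrable_gammaKernel (α := -θ) ha (by rwa [Real.cos_neg])
  have s1 := integral_gammaKernel_shift ha hθ' (neg_pos.2 hcos) hcosy
  have s2 := integral_gammaKernel_shift (α := -Real.pi) (β := -θ) ha (by linarith) (neg_pos.2 hcos)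
    fun y hy => by
      rw [← Real.cos_neg]; exact hcosy (-y) ⟨by linarith [hy.2], by linarith [hy.1]⟩
  rw [integral_gammaKernel_pi (σ := Real.pi) ha (by simp)] at s1
  rw [integral_gammaKernel_pi (σ := -Real.pi) ha (by simp)] at s2
  have l := integral_gammaKernel_left (α := -θ) (β := θ) ha (by linarith) L
    (by rwa [Real.cos_neg]) hcos
  have d1 := intervalIntegral.integral_Iic_add_Ioi (b := L) i1.integrableOn i1.integrableOn
  have d2 := intervalIntegral.integral_Iic_add_Ioi (b := L) i2.integrableOn i2.integrableOn
  have key : ∫ s, gammaKernel a (hankelPath L θ s) * hankelVel θ s =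
      (Complex.exp (a * Real.pi * Complex.I) - Complex.exp (a * (-Real.pi : ℝ) * Complex.I)) *
        Real.Gamma a := by
    rw [integral_hankel_eq (by linarith) (integrable_gammaKernel_hankel hθ hθ' a L)]
    linear_combination d1 - d2 + s1 + s2 - l
  have hsin : Complex.exp (a * Real.pi * Complex.I) - Complex.exp (a * (-Real.pi : ℝ) * Complex.I) =
      2 * Complex.I * (Real.sin (Real.pi * a) : ℝ) := by
    rw [Complex.ofReal_sin, Complex.sin]
    push_cast
    rw [show -((Real.pi : ℂ) * a) * Complex.I = a * -Real.pi * Complex.I by ring,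
      show (Real.pi : ℂ) * a * Complex.I = a * Real.pi * Complex.I by ring]
    linear_combination (Complex.exp (a * Real.pi * Complex.I) -
      Complex.exp (a * -Real.pi * Complex.I)) * Complex.I_sq
  have hG : Real.Gamma a * Real.sin (Real.pi * a) = Real.pi * (Real.Gamma (1 - a))⁻¹ := by
    have h := Real.Gamma_mul_Gamma_one_sub a
    have hGa := (Real.Gamma_pos_of_pos ha).ne'
    -- Here division by zero in the reflection formula yields `Γ(1 - a) = 0`, which agrees with `1 /
    -- Γ = 0` at the poles.
    by_cases h0 : Real.sin (Real.pi * a) = 0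
    · rw [h0, div_zero] at h
      rw [h0, (mul_eq_zero.1 h).resolve_left hGa]; simp
    · have : Real.Gamma (1 - a) ≠ 0 := fun h1 => by
        rw [h1, mul_zero, eq_comm, div_eq_zero_iff] at h
        exact h.elim hpi.ne' h0
      rw [eq_div_iff h0] at h
      rw [← div_eq_mul_inv, eq_div_iff this]
      linear_combination h
  have hGc : (Real.Gamma a : ℂ) * (Real.sin (Real.pi * a) : ℝ) =
      Real.pi * ((Real.Gamma (1 - a))⁻¹ : ℝ) := by exact_mod_cast hG
  have hp : (Real.pi : ℂ) ≠ 0 := by exact_mod_cast hpi.ne'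
  rw [hankelIntegral, key, hsin]
  have hI := Complex.I_ne_zero
  rw [inv_mul_eq_iff_eq_mul₀ (by simp [hp])]
  linear_combination 2 * Complex.I * hGc

theorem integrableOn_gammaKernel_Ioi {α : ℝ} (hα : Real.cos α < 0) (a L : ℝ) :
    IntegrableOn (fun x : ℝ => gammaKernel a (x + α * Complex.I)) (Ioi L) := by
  obtain ⟨C, -, hC⟩ := exists_exp_bound (neg_pos.2 hα) zero_lt_one |a| 0 L
  refine ((exp_neg_integrableOn_Ioi L one_pos).const_mul C).mono'
    ((differentiable_gammaKernel a).continuous.comp (by fun_prop)).aestronglyMeasurable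
    ((ae_restrict_iff' measurableSet_Ioi).2 (ae_of_all _ fun x hx => ?_))
  refine (norm_gammaKernel_le (a := a) x le_rfl).trans
    (le_trans (Real.exp_le_exp.2 ?_) ((hC x (le_of_lt hx)).trans (by simp)))
  rw [← abs_mul]
  linarith [le_abs_self (a * x)]

theorem tendsto_gammaKernel_atTop {α : ℝ} (hα : Real.cos α < 0) (a : ℝ) :
    Tendsto (fun x : ℝ => gammaKernel a (x + α * Complex.I)) atTop (𝓝 0) := by
  refine squeeze_zero_norm (fun x => norm_gammaKernel_le (a := a) x le_rfl)
    (Real.tendsto_exp_atBot.comp ?_)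
  simpa using tendsto_neg_exp_add_atBot (neg_pos.2 hα) zero_lt_one a 0

theorem hasDerivAt_gammaKernel (a : ℝ) (w : ℂ) :
    HasDerivAt (gammaKernel a) (gammaKernel (a + 1) w + a * gammaKernel a w) w := by
  have h := ((Complex.hasDerivAt_exp w).add ((hasDerivAt_id w).const_mul (a : ℂ))).cexp
  refine HasDerivAt.congr_deriv (f := gammaKernel a) h ?_
  simp only [gammaKernel, Complex.ofReal_add, Complex.ofReal_one, add_mul, one_mul,
    ← add_assoc, Complex.exp_add, Pi.add_apply, id]
  ring

/-- `gammaKernel (a + 1) + a * gammaKernel a` is the derivative of `gammaKernel a`, which vanishes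
at both ends of the contour, so its contour integral is zero. -/
theorem hankelIntegral_gammaKernel_add_one {θ : ℝ} (hθ : Real.pi / 2 < θ) (hθ' : θ ≤ Real.pi)
    (L a : ℝ) :
    hankelIntegral L θ (gammaKernel (a + 1)) = -a * hankelIntegral L θ (gammaKernel a) := by
  have hpi := Real.pi_pos
  have hcos : Real.cos θ < 0 := Real.cos_neg_of_pi_div_two_lt_of_lt hθ (by linarith)
  have i1 := integrable_gammaKernel_hankel hθ hθ' (a + 1) L
  have i2 := integrable_gammaKernel_hankel hθ hθ' a L
  have i3 : Integrable fun s => (gammaKernel (a + 1) (hankelPath L θ s) +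
      a * gammaKernel a (hankelPath L θ s)) * hankelVel θ s := by
    refine (i1.add (i2.const_mul (a : ℂ))).congr (ae_of_all _ fun s => ?_)
    simp only [Pi.add_apply]; ring
  have hz : ∫ s, (gammaKernel (a + 1) (hankelPath L θ s) +
      a * gammaKernel a (hankelPath L θ s)) * hankelVel θ s = 0 := by
    rw [integral_hankel_eq (g := fun w => gammaKernel (a + 1) w + a * gammaKernel a w)
      (by linarith) i3]
    have ray : ∀ α : ℝ, Real.cos α < 0 → ∫ x in Ioi L, (gammaKernel (a + 1) (x + α * Complex.I) +
        a * gammaKernel a (x + α * Complex.I)) = -gammaKernel a (L + α * Complex.I) := by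
      intro α hα
      rw [← zero_sub]
      refine integral_Ioi_of_hasDerivAt_of_tendsto' (fun x _ => ?_)
        ((integrableOn_gammaKernel_Ioi hα _ L).add
          ((integrableOn_gammaKernel_Ioi hα a L).const_mul _)) (tendsto_gammaKernel_atTop hα a)
      have h1 : HasDerivAt (fun x : ℝ => (x : ℂ) + α * Complex.I) 1 x :=
        (Complex.ofRealCLM.hasDerivAt).add_const _
      have h2 := (hasDerivAt_gammaKernel a (x + α * Complex.I)).comp x h1
      rw [mul_one] at h2
      exact h2
    rw [ray θ hcos, ray (-θ) (by rwa [Real.cos_neg])]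
    have seg : ∫ y in (-θ)..θ, Complex.I * (gammaKernel (a + 1) (L + y * Complex.I) +
        a * gammaKernel a (L + y * Complex.I)) =
        gammaKernel a (L + θ * Complex.I) - gammaKernel a (L + (-θ : ℝ) * Complex.I) := by
      refine intervalIntegral.integral_eq_sub_of_hasDerivAt
        (f := fun y : ℝ => gammaKernel a (L + y * Complex.I)) (fun y _ => ?_) ?_
      · have h1 : HasDerivAt (fun y : ℝ => (L : ℂ) + y * Complex.I) Complex.I y := by
          simpa using ((Complex.ofRealCLM.hasDerivAt (x := y)).mul_const Complex.I).const_add (L : ℂ)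
        have h2 := (hasDerivAt_gammaKernel a (L + y * Complex.I)).comp y h1
        rw [mul_comm] at h2
        exact h2
      · refine Continuous.intervalIntegrable ?_ _ _
        have c1 := (differentiable_gammaKernel (a + 1)).continuous
        have c2 := (differentiable_gammaKernel a).continuous
        fun_prop
    rw [intervalIntegral.integral_const_mul] at seg
    rw [seg]
    ring
  have hs : (∫ s, gammaKernel (a + 1) (hankelPath L θ s) * hankelVel θ s) +
      a * ∫ s, gammaKernel a (hankelPath L θ s) * hankelVel θ s = 0 := by
    rw [← hz, ← integral_const_mul, ← integral_add i1 (i2.const_mul _)]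
    refine integral_congr_ae (ae_of_all _ fun s => ?_)
    simp only; ring
  simp only [hankelIntegral]
  linear_combination (2 * (Real.pi : ℂ) * Complex.I)⁻¹ * hs

/-- The recurrence `a ↦ a + 1` degenerates at `a = 0`, so this value is obtained by continuity from
`a > 0`. -/
theorem hankelIntegral_gammaKernel_zero {θ : ℝ} (hθ : Real.pi / 2 < θ) (hθ' : θ ≤ Real.pi)
    (L : ℝ) : hankelIntegral L θ (gammaKernel 0) = 1 := by
  obtain ⟨C, -, hC⟩ := exists_hankel_bound hθ hθ' zero_lt_one 1 0 L
  have t1 : Tendsto (fun a => hankelIntegral L θ (gammaKernel a)) (𝓝[>] 0)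
      (𝓝 (hankelIntegral L θ (gammaKernel 0))) := by
    refine Tendsto.const_mul _ (tendsto_integral_filter_of_dominated_convergence
      (fun s => C * Real.exp (-|s|)) (Eventually.of_forall fun a =>
        (integrable_gammaKernel_hankel hθ hθ' a L).aestronglyMeasurable) ?_
      (integrable_exp_neg_abs.const_mul C) (ae_of_all _ fun s => ?_))
    · filter_upwards [Ioo_mem_nhdsGT (zero_lt_one (α := ℝ))] with a ha
      refine ae_of_all _ fun s => ?_
      rw [norm_mul, norm_hankelVel, mul_one, norm_gammaKernel]
      refine le_trans (Real.exp_le_exp.2 ?_) (hC s)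
      have : a * (hankelPath L θ s).re ≤ 1 * |(hankelPath L θ s).re| :=
        (mul_le_mul_of_nonneg_left (le_abs_self _) ha.1.le).trans
          (mul_le_mul_of_nonneg_right ha.2.le (abs_nonneg _))
      linarith
    · refine Tendsto.mul_const _ ?_
      have : Continuous fun a : ℝ => gammaKernel a (hankelPath L θ s) := by
        unfold gammaKernel; fun_prop
      exact this.continuousAt.tendsto.mono_left nhdsWithin_le_nhds
  have t2 : Tendsto (fun a : ℝ => (((Real.Gamma (1 - a))⁻¹ : ℝ) : ℂ)) (𝓝[>] 0) (𝓝 1) := by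
    have hc : ContinuousAt (fun a : ℝ => (((Real.Gamma (1 - a))⁻¹ : ℝ) : ℂ)) 0 := by
      have hG : ContinuousAt Real.Gamma (1 - 0) := by
        refine (Real.differentiableAt_Gamma fun m => ?_).continuousAt
        have : (0 : ℝ) ≤ m := m.cast_nonneg
        linarith
      have h1 : ContinuousAt (fun a : ℝ => Real.Gamma (1 - a)) 0 :=
        ContinuousAt.comp (f := fun a : ℝ => 1 - a) hG (by fun_prop)
      exact Complex.continuous_ofReal.continuousAt.comp (h1.inv₀ (by simp))
    simpa using hc.tendsto.mono_left (nhdsWithin_le_nhds (s := Ioi 0))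
  refine tendsto_nhds_unique t1 (t2.congr' ?_)
  filter_upwards [self_mem_nhdsWithin] with a ha
  exact (hankelIntegral_gammaKernel_of_pos hθ hθ' L ha).symm

/-- **Hankel's formula** `1 / Γ(1 - a) = (2πi)⁻¹ ∫ u ^ (a - 1) e ^ u du`. -/
theorem hankelIntegral_gammaKernel {θ : ℝ} (hθ : Real.pi / 2 < θ) (hθ' : θ ≤ Real.pi)
    (L a : ℝ) : hankelIntegral L θ (gammaKernel a) = ((Real.Gamma (1 - a))⁻¹ : ℝ) := by
  -- Extend leftwards one unit at a time; for `a < 0` the recurrence can be divided by `-a`.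
  suffices ∀ n : ℕ, ∀ a : ℝ, -(n : ℝ) ≤ a →
      hankelIntegral L θ (gammaKernel a) = ((Real.Gamma (1 - a))⁻¹ : ℝ) by
    obtain ⟨n, hn⟩ := exists_nat_ge (-a)
    exact this n a (by linarith)
  intro n
  induction n with
  | zero =>
    intro a ha
    rcases eq_or_lt_of_le ha with h | h
    · obtain rfl : a = 0 := by simpa using h.symm
      simpa using hankelIntegral_gammaKernel_zero hθ hθ' L
    · exact hankelIntegral_gammaKernel_of_pos hθ hθ' L (by simpa using h)
  | succ n ih =>
    intro a ha
    by_cases h : -(n : ℝ) ≤ a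
    · exact ih a h
    have han : a < 0 := (not_le.1 h).trans_le (by simp)
    have h1 := ih (a + 1) (by push_cast at ha; linarith)
    rw [hankelIntegral_gammaKernel_add_one hθ hθ' L a, show 1 - (a + 1) = -a by ring] at h1
    have h2 : Real.Gamma (1 - a) = -a * Real.Gamma (-a) := by
      rw [← Real.Gamma_add_one (by linarith : -a ≠ 0)]; ring_nf
    rw [h2]
    have h3 : (-(a : ℂ)) ≠ 0 := by simpa using han.ne
    refine mul_left_cancel₀ h3 (h1.trans ?_)
    push_cast
    rw [mul_inv, mul_inv_cancel_left₀ h3]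

/-! ### The Wright function as a contour integral -/

/-- The integrand of the contour integral for the Wright function. -/
noncomputable def wrightKernel (ν ξ : ℝ) (w : ℂ) : ℂ :=
  Complex.exp (Complex.exp w + ν * w - ξ * Complex.exp (ν * w))

/-- The opening angle of the contour used for the Wright function of order `ν`. -/
noncomputable def wrightAngle (ν : ℝ) : ℝ := Real.pi / (1 + ν)

section
variable {ν : ℝ}

/-- The angle `θ = π / (1 + ν)` satisfies `θ + νθ = π`. So `θ > π / 2`, which makes `e^{e^w}` decay
on the rays, while `νθ < π / 2`, which keeps `Re e^{νw}` positive on the contour. -/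
theorem pi_div_two_lt_wrightAngle (h0 : 0 < ν) (h1 : ν < 1) : Real.pi / 2 < wrightAngle ν :=
  div_lt_div_of_pos_left Real.pi_pos (by linarith) (by linarith)

theorem wrightAngle_le_pi (h0 : 0 < ν) : wrightAngle ν ≤ Real.pi :=
  div_le_self Real.pi_pos.le (by linarith)

theorem mul_wrightAngle_lt (h0 : 0 < ν) (h1 : ν < 1) : ν * wrightAngle ν < Real.pi / 2 := by
  have := Real.pi_pos
  rw [wrightAngle, mul_div_assoc', div_lt_div_iff₀ (by linarith) two_pos]
  nlinarith

theorem cos_mul_wrightAngle_pos (h0 : 0 < ν) (h1 : ν < 1) : 0 < Real.cos (ν * wrightAngle ν) := by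
  have hθ := pi_div_two_lt_wrightAngle h0 h1
  have := Real.pi_pos
  have : 0 < ν * wrightAngle ν := mul_pos h0 (by linarith)
  exact Real.cos_pos_of_mem_Ioo ⟨by linarith, mul_wrightAngle_lt h0 h1⟩

theorem cos_mul_hankelPath_im_le (h0 : 0 < ν) (h1 : ν < 1) (L s : ℝ) :
    Real.cos (ν * wrightAngle ν) ≤ Real.cos (ν * (hankelPath L (wrightAngle ν) s).im) := by
  have hθ := pi_div_two_lt_wrightAngle h0 h1
  have hpi := Real.pi_pos
  have h := abs_hankelPath_im_le (θ := wrightAngle ν) (by linarith) L s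
  rw [← Real.cos_abs (ν * (hankelPath L (wrightAngle ν) s).im), abs_mul, abs_of_pos h0]
  refine Real.cos_le_cos_of_nonneg_of_le_pi (by positivity) ?_ (by gcongr)
  linarith [mul_wrightAngle_lt h0 h1]

theorem integrable_norm_gammaKernel_hankel (h0 : 0 < ν) (h1 : ν < 1) (a L : ℝ) :
    Integrable (fun s => ‖gammaKernel a (hankelPath L (wrightAngle ν) s)‖) := by
  refine (integrable_gammaKernel_hankel (pi_div_two_lt_wrightAngle h0 h1) (wrightAngle_le_pi h0)
    a L).norm.congr (ae_of_all _ fun s => ?_)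
  simp [norm_hankelVel]

theorem hasSum_wrightKernel (ν ξ : ℝ) (w : ℂ) :
    HasSum (fun n : ℕ => ((((-ξ) ^ n / n.factorial : ℝ)) : ℂ) * gammaKernel (ν * (n + 1)) w)
      (wrightKernel ν ξ w) := by
  have h := (NormedSpace.expSeries_div_hasSum_exp (-ξ * Complex.exp (ν * w))).mul_right
    (gammaKernel ν w)
  rw [← Complex.exp_eq_exp_ℂ, gammaKernel, ← Complex.exp_add,
    show -ξ * Complex.exp (ν * w) + (Complex.exp w + ν * w) =
      Complex.exp w + ν * w - ξ * Complex.exp (ν * w) by ring] at h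
  refine h.congr_fun fun n => ?_
  simp only [gammaKernel]
  rw [mul_pow, ← Complex.exp_nat_mul, div_mul_eq_mul_div, mul_assoc, ← Complex.exp_add]
  push_cast
  rw [div_mul_eq_mul_div]
  ring_nf

/-- Expand `exp (-ξ e^{νw})` and integrate termwise; Hankel's formula turns the `n`-th term into `1
/ Γ(1 - ν(n + 1))`. The sum of the absolute values contains `exp (|ξ| e^{ν Re w})`, which is
integrable on the contour because `ν < 1`. -/
theorem wrightW_eq_hankelIntegral (h0 : 0 < ν) (h1 : ν < 1) (L ξ : ℝ) :
    (wrightW ν (-ξ) : ℂ) = hankelIntegral L (wrightAngle ν) (wrightKernel ν ξ) := by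
  have hθ := pi_div_two_lt_wrightAngle h0 h1
  have hθ' := wrightAngle_le_pi h0
  set θ := wrightAngle ν
  have hreal : ∀ w : ℂ, HasSum (fun n : ℕ => |ξ| ^ n / n.factorial *
      ‖gammaKernel (ν * (n + 1)) w‖)
      (Real.exp ((Complex.exp w).re + ν * w.re + |ξ| * Real.exp (ν * w.re))) := by
    intro w
    have h := (NormedSpace.expSeries_div_hasSum_exp (|ξ| * Real.exp (ν * w.re))).mul_right
      ‖gammaKernel ν w‖
    rw [← Real.exp_eq_exp_ℝ, norm_gammaKernel, ← Real.exp_add,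
      add_comm (|ξ| * Real.exp (ν * w.re))] at h
    refine h.congr_fun fun n => ?_
    rw [norm_gammaKernel, mul_pow, ← Real.exp_nat_mul, div_mul_eq_mul_div, div_mul_eq_mul_div,
      mul_assoc (|ξ| ^ n), ← Real.exp_add]
    ring_nf
  have key : HasSum (fun n : ℕ => ∫ s, ((((-ξ) ^ n / n.factorial : ℝ)) : ℂ) *
        gammaKernel (ν * (n + 1)) (hankelPath L θ s) * hankelVel θ s)
      (∫ s, wrightKernel ν ξ (hankelPath L θ s) * hankelVel θ s) := by
    refine hasSum_integral_of_dominated_convergence (fun n s => |ξ| ^ n / n.factorial *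
      ‖gammaKernel (ν * (n + 1)) (hankelPath L θ s)‖) (fun n => ?_) (fun n => ?_) ?_ ?_ ?_
    · simp_rw [mul_assoc]
      exact ((integrable_gammaKernel_hankel hθ hθ' _ L).const_mul _).aestronglyMeasurable
    · refine ae_of_all _ fun s => ?_
      rw [norm_mul, norm_mul, norm_hankelVel, mul_one, Complex.norm_real]
      simp
    · exact ae_of_all _ fun s => (hreal _).summable
    · simp_rw [(hreal _).tsum_eq]
      obtain ⟨C, -, hC⟩ := exists_hankel_bound hθ hθ' h1 ν |ξ| L
      have hc := continuous_hankelPath L θ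
      refine (integrable_exp_neg_abs.const_mul C).mono' ?_ (ae_of_all _ fun s => ?_)
      · refine Continuous.aestronglyMeasurable ?_
        have hre := Complex.continuous_re
        fun_prop
      · rw [Real.norm_of_nonneg (Real.exp_pos _).le]
        refine le_trans (Real.exp_le_exp.2 ?_) (hC s)
        have := mul_le_mul_of_nonneg_left (le_abs_self (hankelPath L θ s).re) h0.le
        linarith
    · exact ae_of_all _ fun s => (hasSum_wrightKernel ν ξ _).mul_right _
  have key2 := key.mul_left (2 * Real.pi * Complex.I)⁻¹
  have hterm : ∀ n : ℕ, (2 * Real.pi * Complex.I)⁻¹ * (∫ s, ((((-ξ) ^ n / n.factorial : ℝ)) : ℂ) *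
        gammaKernel (ν * (n + 1)) (hankelPath L θ s) * hankelVel θ s) =
      (((-ξ) ^ n / (n.factorial * Real.Gamma (1 - ν * (n + 1))) : ℝ) : ℂ) := by
    intro n
    have := hankelIntegral_gammaKernel hθ hθ' L (ν * (n + 1))
    rw [hankelIntegral] at this
    simp_rw [mul_assoc]
    rw [integral_const_mul, mul_left_comm, ← mul_assoc 2, this, ← Complex.ofReal_mul, ← div_eq_mul_inv, div_div]
  simp_rw [hterm] at key2
  rw [wrightW, Complex.ofReal_tsum]
  exact key2.tsum_eq

theorem norm_wrightKernel (ν ξ : ℝ) (w : ℂ) : ‖wrightKernel ν ξ w‖ =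
    ‖gammaKernel ν w‖ * Real.exp (-ξ * (Real.exp (ν * w.re) * Real.cos (ν * w.im))) := by
  rw [norm_gammaKernel, ← Real.exp_add, wrightKernel, Complex.norm_exp]
  simp [Complex.exp_re, sub_eq_add_neg]

/-- On the contour `|Im (νw)| ≤ νθ < π / 2`, so `Re e^{νw}` is bounded below by a positive constant,
which gives exponential decay in `ξ` uniformly in `s`. -/
theorem norm_wrightKernel_hankelPath_le (h0 : 0 < ν) (h1 : ν < 1) (L s : ℝ) {ξ : ℝ} (hξ : 0 ≤ ξ) :
    ‖wrightKernel ν ξ (hankelPath L (wrightAngle ν) s)‖ ≤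
      ‖gammaKernel ν (hankelPath L (wrightAngle ν) s)‖ *
        Real.exp (-(Real.exp (ν * L) * Real.cos (ν * wrightAngle ν)) * ξ) := by
  rw [norm_wrightKernel]
  refine mul_le_mul_of_nonneg_left (Real.exp_le_exp.2 ?_) (norm_nonneg _)
  have hc := cos_mul_wrightAngle_pos h0 h1
  have : Real.exp (ν * L) * Real.cos (ν * wrightAngle ν) ≤
      Real.exp (ν * (hankelPath L (wrightAngle ν) s).re) *
        Real.cos (ν * (hankelPath L (wrightAngle ν) s).im) := by
    have := le_hankelPath_re L (wrightAngle ν) s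
    have := cos_mul_hankelPath_im_le h0 h1 L s
    gcongr
  nlinarith

/-- The value of the contour integral does not depend on `L`, so moving the contour to the right
provides any prescribed decay rate in `ξ`. -/
theorem exists_level (h0 : 0 < ν) (h1 : ν < 1) {b : ℝ} (hb : 0 < b) :
    ∃ L, Real.exp (ν * L) * Real.cos (ν * wrightAngle ν) = b := by
  have hc := cos_mul_wrightAngle_pos h0 h1
  refine ⟨Real.log (b / Real.cos (ν * wrightAngle ν)) / ν, ?_⟩
  rw [mul_div_cancel₀ _ h0.ne', Real.exp_log (by positivity)]
  field_simp

theorem exists_wrightW_bound (h0 : 0 < ν) (h1 : ν < 1) {b : ℝ} (hb : 0 < b) :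
    ∃ C, 0 ≤ C ∧ ∀ ξ, 0 ≤ ξ → |wrightW ν (-ξ)| ≤ C * Real.exp (-b * ξ) := by
  obtain ⟨L, hL⟩ := exists_level h0 h1 hb
  refine ⟨‖(2 * Real.pi * Complex.I)⁻¹‖ *
    ∫ s, ‖gammaKernel ν (hankelPath L (wrightAngle ν) s)‖, by positivity, fun ξ hξ => ?_⟩
  rw [← Real.norm_eq_abs, ← Complex.norm_real, wrightW_eq_hankelIntegral h0 h1 L, hankelIntegral,
    norm_mul, mul_assoc ‖_‖, ← integral_mul_const]
  refine mul_le_mul_of_nonneg_left ?_ (norm_nonneg _)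
  refine norm_integral_le_of_norm_le
    ((integrable_norm_gammaKernel_hankel h0 h1 ν L).mul_const _) (ae_of_all _ fun s => ?_)
  rw [norm_mul, norm_hankelVel, mul_one, ← hL]
  exact norm_wrightKernel_hankelPath_le h0 h1 L s hξ

theorem stronglyMeasurable_wrightKernel_prod (ν L : ℝ) : StronglyMeasurable (fun p : ℝ × ℝ =>
    wrightKernel ν p.1 (hankelPath L (wrightAngle ν) p.2) * hankelVel (wrightAngle ν) p.2) := by
  refine StronglyMeasurable.mul (Continuous.stronglyMeasurable ?_)
    ((measurable_hankelVel _).comp measurable_snd).stronglyMeasurable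
  have hc := (continuous_hankelPath L (wrightAngle ν)).comp (continuous_snd (X := ℝ))
  simp only [Function.comp_def] at hc
  unfold wrightKernel
  fun_prop

theorem measurable_wrightW_neg (h0 : 0 < ν) (h1 : ν < 1) : Measurable fun ξ => wrightW ν (-ξ) := by
  have h : (fun ξ => wrightW ν (-ξ)) =
      fun ξ => (hankelIntegral 0 (wrightAngle ν) (wrightKernel ν ξ)).re := by
    ext ξ
    rw [← wrightW_eq_hankelIntegral h0 h1 0 ξ, Complex.ofReal_re]
  rw [h]
  refine Complex.measurable_re.comp (Measurable.const_mul ?_ _)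
  exact ((stronglyMeasurable_wrightKernel_prod ν 0).integral_prod_right').measurable

theorem integrableOn_exp_mul_wrightW (h0 : 0 < ν) (h1 : ν < 1) (b : ℝ) :
    IntegrableOn (fun ξ => Real.exp (b * ξ) * wrightW ν (-ξ)) (Ioi 0) := by
  obtain ⟨C, hC0, hC⟩ := exists_wrightW_bound h0 h1 (b := |b| + 1) (by positivity)
  refine ((exp_neg_integrableOn_Ioi 0 one_pos).const_mul C).mono'
    ((by fun_prop : Measurable fun ξ => Real.exp (b * ξ)).mul
      (measurable_wrightW_neg h0 h1)).aestronglyMeasurable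
    ((ae_restrict_iff' measurableSet_Ioi).2 (ae_of_all _ fun ξ hξ => ?_))
  have hξ : 0 < ξ := hξ
  rw [norm_mul, Real.norm_of_nonneg (Real.exp_pos _).le]
  calc _ ≤ Real.exp (b * ξ) * (C * Real.exp (-(|b| + 1) * ξ)) := by
        have := hC ξ hξ.le
        gcongr; exact this
    _ = C * Real.exp ((b - |b| - 1) * ξ) := by
        rw [mul_left_comm, ← Real.exp_add]; ring_nf
    _ ≤ _ := by
        gcongr
        linarith [le_abs_self b]

/-- After Fubini, the `ξ`-integral equals `(e^{νw} - z)⁻¹` times elementary factors. Its geometric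
expansion in `z e^{-νw}` produces the kernels `gammaKernel (-(ν * n))`, and Hankel's formula
evaluates them to `1 / Γ(1 + νn)`. -/
theorem hasSum_integral_exp_mul_wrightW (h0 : 0 < ν) (h1 : ν < 1) (z : ℂ) :
    HasSum (fun n : ℕ => z ^ n / (Real.Gamma (1 + ν * n) : ℂ))
      (∫ ξ in Ioi (0 : ℝ), Complex.exp (z * ξ) * (wrightW ν (-ξ) : ℂ)) := by
  have hθ := pi_div_two_lt_wrightAngle h0 h1
  have hθ' := wrightAngle_le_pi h0
  -- The level `‖z‖ + 1` makes the `ξ`-integral converge and the geometric ratio smaller than `1` on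
  -- the whole contour.
  obtain ⟨L, hL⟩ := exists_level h0 h1 (b := ‖z‖ + 1) (by positivity)
  set θ := wrightAngle ν
  have hLz : ‖z‖ + 1 ≤ Real.exp (ν * L) := by
    rw [← hL]
    exact mul_le_of_le_one_right (Real.exp_pos _).le (Real.cos_le_one _)
  have hprod : Integrable (fun p : ℝ × ℝ => Complex.exp (z * p.1) *
      (wrightKernel ν p.1 (hankelPath L θ p.2) * hankelVel θ p.2))
      ((volume.restrict (Ioi 0)).prod volume) := by
    refine Integrable.mono' ((exp_neg_integrableOn_Ioi 0 one_pos).mul_prod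
      (integrable_norm_gammaKernel_hankel h0 h1 ν L)) ?_ ?_
    · refine AEStronglyMeasurable.mul (Continuous.aestronglyMeasurable (by fun_prop))
        (stronglyMeasurable_wrightKernel_prod ν L).aestronglyMeasurable
    · have : ∀ᵐ p : ℝ × ℝ ∂((volume.restrict (Ioi (0 : ℝ))).prod volume), p.1 ∈ Ioi (0 : ℝ) :=
        Measure.quasiMeasurePreserving_fst.ae (ae_restrict_mem measurableSet_Ioi)
      filter_upwards [this] with p hp
      have hp : 0 < p.1 := hp
      rw [norm_mul, norm_mul, norm_hankelVel, mul_one, Complex.norm_exp]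
      have e1 : (z * p.1).re ≤ ‖z‖ * p.1 := by
        rw [Complex.re_mul_ofReal]
        exact mul_le_mul_of_nonneg_right (Complex.re_le_norm z) hp.le
      have e2 := norm_wrightKernel_hankelPath_le h0 h1 L p.2 hp.le
      rw [hL] at e2
      calc _ ≤ Real.exp (‖z‖ * p.1) * (‖gammaKernel ν (hankelPath L θ p.2)‖ *
            Real.exp (-(‖z‖ + 1) * p.1)) := by gcongr
        _ = _ := by
          rw [mul_left_comm, ← Real.exp_add, mul_comm]
          congr 2
          ring
  have hE : ∀ s, ‖z‖ + 1 ≤ ‖Complex.exp (ν * hankelPath L θ s)‖ := fun s => by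
    rw [Complex.norm_exp, Complex.re_ofReal_mul]
    refine hLz.trans (Real.exp_le_exp.2 ?_)
    exact mul_le_mul_of_nonneg_left (le_hankelPath_re L θ s) h0.le
  have inner : ∀ s, ∫ ξ in Ioi (0 : ℝ), Complex.exp (z * ξ) *
      (wrightKernel ν ξ (hankelPath L θ s) * hankelVel θ s) =
      gammaKernel ν (hankelPath L θ s) * (Complex.exp (ν * hankelPath L θ s) - z)⁻¹ *
        hankelVel θ s := by
    intro s
    have hre : (z - Complex.exp (ν * hankelPath L θ s)).re < 0 := by
      have e1 := le_hankelPath_re L θ s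
      have e2 : Real.cos (ν * θ) ≤ _ := cos_mul_hankelPath_im_le h0 h1 L s
      have hc : 0 < Real.cos (ν * θ) := cos_mul_wrightAngle_pos h0 h1
      have : ‖z‖ + 1 ≤ (Complex.exp (ν * hankelPath L θ s)).re := by
        rw [Complex.exp_re, Complex.re_ofReal_mul, Complex.im_ofReal_mul, ← hL]
        exact mul_le_mul (Real.exp_le_exp.2 (mul_le_mul_of_nonneg_left e1 h0.le)) e2 hc.le
          (Real.exp_pos _).le
      rw [Complex.sub_re]
      linarith [Complex.re_le_norm z]
    have h := integral_exp_mul_complex_Ioi hre 0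
    have hne : z - Complex.exp (ν * hankelPath L θ s) ≠ 0 := fun h => by simp [h] at hre
    calc _ = ∫ ξ in Ioi (0 : ℝ), gammaKernel ν (hankelPath L θ s) * hankelVel θ s *
          Complex.exp ((z - Complex.exp (ν * hankelPath L θ s)) * ξ) := by
          refine setIntegral_congr_fun measurableSet_Ioi fun ξ _ => ?_
          simp only [wrightKernel, gammaKernel]
          rw [mul_right_comm (Complex.exp (Complex.exp _ + _)), ← Complex.exp_add,
            ← mul_assoc, ← Complex.exp_add]
          ring_nf
      _ = _ := by
          rw [integral_const_mul, h, ← neg_sub z, inv_neg]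
          simp only [Complex.ofReal_zero, mul_zero, Complex.exp_zero]
          ring
  have hterm : ∀ s, HasSum (fun n : ℕ => z ^ n * gammaKernel (-(ν * n)) (hankelPath L θ s))
      (gammaKernel ν (hankelPath L θ s) * (Complex.exp (ν * hankelPath L θ s) - z)⁻¹) := by
    intro s
    set w := hankelPath L θ s
    have hE0 : Complex.exp (ν * w) ≠ 0 := Complex.exp_ne_zero _
    have hlt : ‖z / Complex.exp (ν * w)‖ < 1 := by
      rw [norm_div, div_lt_one (norm_pos_iff.2 hE0)]
      linarith [hE s]
    have hne : Complex.exp (ν * w) - z ≠ 0 := fun h => by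
      have := hE s
      rw [show Complex.exp (ν * w) = z from sub_eq_zero.1 h] at this
      linarith
    have h := (hasSum_geometric_of_norm_lt_one hlt).mul_left
      (gammaKernel ν w * (Complex.exp (ν * w))⁻¹)
    have e : gammaKernel ν w * (Complex.exp (ν * w))⁻¹ * (1 - z / Complex.exp (ν * w))⁻¹ =
        gammaKernel ν w * (Complex.exp (ν * w) - z)⁻¹ := by
      rw [mul_assoc, ← mul_inv, mul_sub, mul_one, mul_div_cancel₀ _ hE0]
    rw [e] at h
    refine h.congr_fun fun n => ?_
    rw [div_pow, ← Complex.exp_nat_mul, div_eq_mul_inv, ← Complex.exp_neg, ← Complex.exp_neg,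
      mul_left_comm, gammaKernel, gammaKernel, ← Complex.exp_add, ← Complex.exp_add]
    push_cast
    ring_nf
  have key : HasSum (fun n : ℕ => ∫ s, z ^ n * gammaKernel (-(ν * n)) (hankelPath L θ s) *
        hankelVel θ s)
      (∫ s, gammaKernel ν (hankelPath L θ s) * (Complex.exp (ν * hankelPath L θ s) - z)⁻¹ *
        hankelVel θ s) := by
    have hq : ‖z‖ * Real.exp (-(ν * L)) < 1 := by
      rw [Real.exp_neg, ← div_eq_mul_inv, div_lt_one (Real.exp_pos _)]
      linarith
    have hq0 : 0 ≤ ‖z‖ * Real.exp (-(ν * L)) := by positivity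
    have hi := integrable_norm_gammaKernel_hankel h0 h1 0 L
    refine hasSum_integral_of_dominated_convergence
      (fun n s => (‖z‖ * Real.exp (-(ν * L))) ^ n * ‖gammaKernel 0 (hankelPath L θ s)‖)
      (fun n => ?_) (fun n => ?_) ?_ ?_ ?_
    · simp_rw [mul_assoc]
      exact ((integrable_gammaKernel_hankel hθ hθ' _ L).const_mul _).aestronglyMeasurable
    · refine ae_of_all _ fun s => ?_
      rw [norm_mul, norm_mul, norm_hankelVel, mul_one, norm_pow, mul_pow, ← Real.exp_nat_mul,
        mul_assoc, norm_gammaKernel, norm_gammaKernel, ← Real.exp_add]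
      refine mul_le_mul_of_nonneg_left (Real.exp_le_exp.2 ?_) (by positivity)
      have := mul_le_mul_of_nonneg_left (le_hankelPath_re L θ s)
        (mul_nonneg h0.le n.cast_nonneg : 0 ≤ ν * (n : ℝ))
      linarith
    · exact ae_of_all _ fun s => (summable_geometric_of_lt_one hq0 hq).mul_right _
    · simp_rw [tsum_mul_right]
      exact hi.const_mul _
    · exact ae_of_all _ fun s => (hterm s).mul_right _
  have swap := integral_integral_swap (f := fun ξ s => Complex.exp (z * (ξ : ℝ)) *
      (wrightKernel ν ξ (hankelPath L θ s) * hankelVel θ s)) hprod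
  simp_rw [inner] at swap
  rw [← swap] at key
  have key2 := key.mul_left (2 * Real.pi * Complex.I)⁻¹
  rw [← integral_const_mul] at key2
  have e : ∫ ξ in Ioi (0 : ℝ), Complex.exp (z * ξ) * (wrightW ν (-ξ) : ℂ) =
      ∫ ξ in Ioi (0 : ℝ), (2 * Real.pi * Complex.I)⁻¹ * ∫ s, Complex.exp (z * ξ) *
        (wrightKernel ν ξ (hankelPath L θ s) * hankelVel θ s) := by
    refine setIntegral_congr_fun measurableSet_Ioi fun ξ _ => ?_
    rw [integral_const_mul, wrightW_eq_hankelIntegral h0 h1 L, hankelIntegral]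
    ring
  rw [e]
  refine key2.congr_fun fun n => ?_
  have := hankelIntegral_gammaKernel hθ hθ' L (-(ν * n))
  rw [hankelIntegral] at this
  simp_rw [mul_assoc (z ^ n)]
  rw [integral_const_mul, mul_left_comm, this, sub_neg_eq_add, Complex.ofReal_inv, div_eq_mul_inv]

end

/-! ### Fractional integrals -/

theorem integral_rpow_mul_rpow_sub {a b t : ℝ} (ha : 0 < a) (hb : 0 < b) (ht : 0 < t) :
    ∫ x in (0 : ℝ)..t, x ^ (b - 1) * (t - x) ^ (a - 1) =
      Real.Gamma a * Real.Gamma b / Real.Gamma (a + b) * t ^ (a + b - 1) := by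
  have h := Complex.betaIntegral_scaled b a ht
  rw [Complex.betaIntegral_eq_Gamma_mul_div _ _ (by simpa) (by simpa)] at h
  have e : ∫ x in (0 : ℝ)..t, (x : ℂ) ^ ((b : ℂ) - 1) * ((t : ℂ) - x) ^ ((a : ℂ) - 1) =
      ((∫ x in (0 : ℝ)..t, x ^ (b - 1) * (t - x) ^ (a - 1) : ℝ) : ℂ) := by
    rw [← intervalIntegral.integral_ofReal]
    refine intervalIntegral.integral_congr fun x hx => ?_
    rw [uIcc_of_le ht.le] at hx
    rw [Complex.ofReal_mul, Complex.ofReal_cpow hx.1, Complex.ofReal_cpow (by linarith [hx.2])]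
    push_cast; rfl
  rw [e, ← Complex.ofReal_add, Complex.Gamma_ofReal, Complex.Gamma_ofReal, Complex.Gamma_ofReal,
    show ((b + a : ℝ) : ℂ) - 1 = ((b + a - 1 : ℝ) : ℂ) by push_cast; ring,
    ← Complex.ofReal_cpow ht.le] at h
  have h2 : ∫ x in (0 : ℝ)..t, x ^ (b - 1) * (t - x) ^ (a - 1) = t ^ (b + a - 1) *
    (Real.Gamma b * Real.Gamma a / Real.Gamma (b + a)) := by exact_mod_cast h
  rw [h2, add_comm b a]; ring

theorem intervalIntegrable_rpow_mul_rpow_sub {a b t : ℝ} (ha : 0 < a) (hb : 0 < b) (ht : 0 < t) :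
    IntervalIntegrable (fun x => x ^ (b - 1) * (t - x) ^ (a - 1)) volume 0 t := by
  -- A non-integrable function would have integral `0`, but the Beta value is positive.
  by_contra h
  have h1 := integral_rpow_mul_rpow_sub ha hb ht
  rw [intervalIntegral.integral_undef h] at h1
  have := Real.Gamma_pos_of_pos ha
  have := Real.Gamma_pos_of_pos hb
  have := Real.Gamma_pos_of_pos (add_pos ha hb)
  have : 0 < Real.Gamma a * Real.Gamma b / Real.Gamma (a + b) * t ^ (a + b - 1) := by positivity
  exact this.ne h1

theorem integral_sub_rpow_mul_sub_rpow {a b s t : ℝ} (ha : 0 < a) (hb : 0 < b) (hst : s < t) :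
    ∫ x in s..t, (x - s) ^ (b - 1) * (t - x) ^ (a - 1) =
      Real.Gamma a * Real.Gamma b / Real.Gamma (a + b) * (t - s) ^ (a + b - 1) := by
  have h := integral_rpow_mul_rpow_sub ha hb (sub_pos.2 hst)
  have h2 := intervalIntegral.integral_comp_sub_right (a := s) (b := t)
    (fun x => x ^ (b - 1) * (t - s - x) ^ (a - 1)) s
  rw [sub_self] at h2
  rw [← h, ← h2]
  simp

theorem intervalIntegrable_sub_rpow_mul_sub_rpow {a b s t : ℝ} (ha : 0 < a) (hb : 0 < b)
    (hst : s < t) :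
    IntervalIntegrable (fun x => (x - s) ^ (b - 1) * (t - x) ^ (a - 1)) volume s t := by
  have h := (intervalIntegrable_rpow_mul_rpow_sub ha hb (sub_pos.2 hst)).comp_sub_right s
  simpa using h

theorem intervalIntegrable_sub_rpow {a : ℝ} (ha : 0 < a) (t : ℝ) :
    IntervalIntegrable (fun s => (t - s) ^ (a - 1)) volume 0 t := by
  have h := (intervalIntegral.intervalIntegrable_rpow' (a := 0) (b := t)
    (by linarith : -1 < a - 1)).comp_sub_left t
  simpa using h.symm

/-- Composition of fractional integrals. -/
theorem integral_fracIntegral {a b t : ℝ} (ha : 0 < a) (hb : 0 < b) (hab : 1 ≤ a + b) (ht : 0 < t)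
    {f : ℝ → ℝ} (hf : IntervalIntegrable f volume 0 t) :
    ∫ τ in (0 : ℝ)..t, (∫ s in (0 : ℝ)..τ, f s * (τ - s) ^ (b - 1)) * (t - τ) ^ (a - 1) =
      Real.Gamma a * Real.Gamma b / Real.Gamma (a + b) *
        ∫ s in (0 : ℝ)..t, f s * (t - s) ^ (a + b - 1) := by
  set m := (volume : Measure ℝ).restrict (Ioc 0 t) with hm
  set K := Real.Gamma a * Real.Gamma b / Real.Gamma (a + b) with hK
  have hfm : Integrable f m := (intervalIntegrable_iff_integrableOn_Ioc_of_le ht.le).1 hf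
  -- Cutting the kernel off to `s < τ ≤ t` turns the triangle into the square `(0, t]²`, where
  -- Fubini applies; the inner `τ`-integral is a Beta integral.
  set k : ℝ → ℝ → ℝ := fun s => (Ioc s t).indicator fun τ => (τ - s) ^ (b - 1) * (t - τ) ^ (a - 1)
    with hk
  have hkm : Measurable (Function.uncurry k) := by
    have : Function.uncurry k = {p : ℝ × ℝ | p.1 < p.2 ∧ p.2 ≤ t}.indicator fun p =>
        (p.2 - p.1) ^ (b - 1) * (t - p.2) ^ (a - 1) := by
      ext ⟨s, τ⟩; simp [hk, indicator, Function.uncurry]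
    rw [this]
    exact (by fun_prop : Measurable fun p : ℝ × ℝ => (p.2 - p.1) ^ (b - 1) *
      (t - p.2) ^ (a - 1)).indicator ((measurableSet_lt measurable_fst measurable_snd).inter
        (measurableSet_le measurable_snd measurable_const))
  have hk0 : ∀ s τ, 0 ≤ k s τ := fun s τ => indicator_nonneg (fun x hx =>
    mul_nonneg (Real.rpow_nonneg (by linarith [hx.1]) _) (Real.rpow_nonneg (by linarith [hx.2]) _)) _
  have hki : ∀ s, 0 < s → s < t → Integrable (k s) m ∧ ∫ τ, k s τ ∂m = K * (t - s) ^ (a + b - 1) := by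
    intro s hs hst
    have hsub : Ioc s t ∩ Ioc 0 t = Ioc s t := inter_eq_left.2 (Ioc_subset_Ioc_left hs.le)
    constructor
    · rw [hk, integrable_indicator_iff measurableSet_Ioc, hm, IntegrableOn,
        Measure.restrict_restrict measurableSet_Ioc, hsub]
      exact (intervalIntegrable_iff_integrableOn_Ioc_of_le hst.le).1
        (intervalIntegrable_sub_rpow_mul_sub_rpow ha hb hst)
    · rw [hk, integral_indicator measurableSet_Ioc, hm, Measure.restrict_restrict measurableSet_Ioc,
        hsub, ← intervalIntegral.integral_of_le hst.le, integral_sub_rpow_mul_sub_rpow ha hb hst]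
  have hae : ∀ᵐ s ∂m, 0 < s ∧ s < t := by
    have h1 : ∀ᵐ s ∂m, s ∈ Ioc 0 t := ae_restrict_mem measurableSet_Ioc
    have h2 : ∀ᵐ s ∂m, s ≠ t := ae_restrict_of_ae (by simp [ae_iff, measure_singleton])
    filter_upwards [h1, h2] with s hs hst using ⟨hs.1, lt_of_le_of_ne hs.2 hst⟩
  have hint : Integrable (fun p : ℝ × ℝ => f p.1 * k p.1 p.2) (m.prod m) := by
    have hmeas : AEStronglyMeasurable (fun p : ℝ × ℝ => f p.1 * k p.1 p.2) (m.prod m) :=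
      hfm.aestronglyMeasurable.comp_fst.mul hkm.aestronglyMeasurable
    rw [integrable_prod_iff hmeas]
    refine ⟨hae.mono fun s hs => (hki s hs.1 hs.2).1.const_mul (f s), ?_⟩
    have : Integrable (fun s => ‖f s‖ * (K * (t - s) ^ (a + b - 1))) m := by
      -- The exponent `a + b - 1` is nonnegative, so the power is bounded and mere integrability of
      -- `f` suffices.
      refine hfm.norm.mul_bdd (c := |K| * t ^ (a + b - 1))
        (Measurable.aestronglyMeasurable (by fun_prop)) ?_
      filter_upwards [hae] with s hs
      rw [norm_mul, Real.norm_eq_abs, Real.norm_of_nonneg (Real.rpow_nonneg (by linarith [hs.2]) _)]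
      gcongr
      · linarith [hs.2]
      · linarith
    refine this.congr (hae.mono fun s hs => ?_)
    simp only [norm_mul, Real.norm_of_nonneg (hk0 _ _)]
    rw [integral_const_mul, (hki s hs.1 hs.2).2]
  have swap := integral_integral_swap (f := fun s τ => f s * k s τ) hint
  rw [intervalIntegral.integral_of_le ht.le, intervalIntegral.integral_of_le ht.le,
    ← integral_const_mul]
  calc _ = ∫ τ, ∫ s, f s * k s τ ∂m ∂m := by
        refine setIntegral_congr_fun measurableSet_Ioc fun τ hτ => ?_
        rw [intervalIntegral.integral_of_le hτ.1.le, ← integral_mul_const]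
        have h1 : ∫ s, f s * k s τ ∂m = ∫ s in Ioo 0 τ, f s * k s τ := by
          rw [hm, ← integral_indicator measurableSet_Ioc, ← integral_indicator measurableSet_Ioo]
          congr 1; ext s
          by_cases h : s < τ
          · simp [indicator, h, h.le.trans hτ.2]
          · simp [indicator, hk, h]
        rw [h1, integral_Ioc_eq_integral_Ioo]
        refine setIntegral_congr_fun measurableSet_Ioo fun s hs => ?_
        simp only [hk]
        rw [indicator_of_mem (show τ ∈ Ioc s t from ⟨hs.2, hτ.2⟩)]
        ring
    _ = ∫ s, ∫ τ, f s * k s τ ∂m ∂m := swap.symm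
    _ = _ := by
        refine integral_congr_ae (hae.mono fun s hs => ?_)
        simp only
        rw [integral_const_mul, (hki s hs.1 hs.2).2]
        ring

/-! ### The Caputo derivative -/

theorem integral_deriv_of_contDiffOn {f : ℝ → ℝ} {t : ℝ} (ht : 0 < t)
    (hc : ContinuousOn f (Ici 0)) (hd : ContDiffOn ℝ 1 f (Ioi 0))
    (hi : IntervalIntegrable (deriv f) volume 0 t) : ∫ s in (0 : ℝ)..t, deriv f s = f t - f 0 := by
  refine intervalIntegral.integral_eq_sub_of_hasDerivAt_of_le ht.le
    (hc.mono Icc_subset_Ici_self) (fun x hx => ?_) hi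
  exact ((hd.differentiableOn one_ne_zero).differentiableAt (Ioi_mem_nhds hx.1)).hasDerivAt

/-- Taylor's formula, with primitive `f'(s) (t - s) + f s`; the vanishing limit of `f'` at `0`
removes the linear term. -/
theorem integral_deriv_deriv_of_contDiffOn {f : ℝ → ℝ} {t : ℝ} (ht : 0 < t)
    (hc : ContinuousOn f (Ici 0)) (hd : ContDiffOn ℝ 2 f (Ioi 0))
    (hi : IntervalIntegrable (deriv (deriv f)) volume 0 t)
    (h0 : Tendsto (deriv f) (𝓝[>] 0) (𝓝 0)) :
    ∫ s in (0 : ℝ)..t, deriv (deriv f) s * (t - s) = f t - f 0 := by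
  have h2 : ∀ x, 0 < x → HasDerivAt (deriv f) (deriv (deriv f) x) x := fun x hx => by
    have := ((contDiffOn_succ_iff_deriv_of_isOpen (n := 1) isOpen_Ioi).1 hd).2.2
    exact ((this.differentiableOn one_ne_zero).differentiableAt (Ioi_mem_nhds hx)).hasDerivAt
  have h1 : ∀ x, 0 < x → HasDerivAt f (deriv f x) x := fun x hx =>
    ((hd.differentiableOn two_ne_zero).differentiableAt (Ioi_mem_nhds hx)).hasDerivAt
  have hG : ∀ x, 0 < x → HasDerivAt (fun s => deriv f s * (t - s) + f s)
      (deriv (deriv f) x * (t - x)) x := fun x hx => by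
    have := ((h2 x hx).mul ((hasDerivAt_id x).const_sub t)).add (h1 x hx)
    refine this.congr_deriv ?_
    simp
  refine intervalIntegral.integral_eq_sub_of_hasDerivAt_of_tendsto ht (fun x hx => hG x hx.1)
    (hi.mul_continuousOn (by fun_prop)) ?_ ?_
  · have e1 : Tendsto f (𝓝[>] 0) (𝓝 (f 0)) :=
      ((hc 0 self_mem_Ici).mono Ioi_subset_Ici_self).tendsto
    have e2 : Tendsto (fun s => t - s) (𝓝[>] 0) (𝓝 (t - 0)) :=
      (Continuous.tendsto (by fun_prop) 0).mono_left nhdsWithin_le_nhds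
    simpa using (h0.mul e2).add e1
  · have := (hG t ht).continuousAt.tendsto.mono_left (nhdsWithin_le_nhds (s := Iio t))
    simpa using this

/-- With `n = ⌈α⌉`, the fractional integral of order `α` of the Caputo derivative is `I^α I^{n-α}
f⁽ⁿ⁾ = I^n f⁽ⁿ⁾`, and Taylor's formula for `n = 1` or `n = 2` evaluates it. This turns both Cauchy
problems into Volterra equations. -/
theorem CaputoRegular.eq_add_integral {α : ℝ} (h0 : 0 < α) (h2 : α ≤ 2) {f : ℝ → ℝ}
    (hf : CaputoRegular α f) (hf' : 1 < α → Tendsto (deriv f) (𝓝[>] 0) (𝓝 0)) {t : ℝ} (ht : 0 < t) :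
    f t = f 0 + (Real.Gamma α)⁻¹ * ∫ s in (0 : ℝ)..t, caputoDeriv α f s * (t - s) ^ (α - 1) := by
  have hn : f t = f 0 + (Real.Gamma ⌈α⌉₊)⁻¹ *
      ∫ s in (0 : ℝ)..t, iteratedDeriv ⌈α⌉₊ f s * (t - s) ^ ((⌈α⌉₊ : ℝ) - 1) := by
    by_cases h1 : α ≤ 1
    · have hc : ⌈α⌉₊ = 1 := by
        rw [Nat.ceil_eq_iff one_ne_zero]; simpa using ⟨h0, h1⟩
      have hi := hf.integrable t ht
      have hd := hf.contDiffOn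
      rw [hc] at hi hd ⊢
      rw [iteratedDeriv_one] at hi ⊢
      simp [integral_deriv_of_contDiffOn ht hf.continuousOn hd hi]
    · have h1 := not_le.1 h1
      have hc : ⌈α⌉₊ = 2 := by
        rw [Nat.ceil_eq_iff two_ne_zero]; simpa using ⟨h1, h2⟩
      have hi := hf.integrable t ht
      have hd := hf.contDiffOn
      rw [hc] at hi hd ⊢
      have e : iteratedDeriv 2 f = deriv (deriv f) := by rw [iteratedDeriv_succ, iteratedDeriv_one]
      rw [e] at hi ⊢
      have := integral_deriv_deriv_of_contDiffOn ht hf.continuousOn hd hi (hf' h1)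
      norm_num
      rw [this]; ring
  rw [hn]
  by_cases hα : α = ⌈α⌉₊
  · congr 2
    · rw [← hα]
    · refine intervalIntegral.integral_congr fun s _ => ?_
      simp only [caputoDeriv, if_pos hα]
      rw [← hα]
  · have hb : 0 < (⌈α⌉₊ : ℝ) - α := sub_pos.2 (lt_of_le_of_ne (Nat.le_ceil α) hα)
    have hab : α + ((⌈α⌉₊ : ℝ) - α) = ⌈α⌉₊ := by ring
    have h1n : (1 : ℝ) ≤ ⌈α⌉₊ := by exact_mod_cast Nat.one_le_ceil_iff.2 h0
    have hs := integral_fracIntegral h0 hb (by linarith) ht (hf.integrable t ht)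
    rw [hab] at hs
    have e : ∫ s in (0 : ℝ)..t, caputoDeriv α f s * (t - s) ^ (α - 1) =
        (Real.Gamma ((⌈α⌉₊ : ℝ) - α))⁻¹ * ∫ τ in (0 : ℝ)..t, (∫ s in (0 : ℝ)..τ,
          iteratedDeriv ⌈α⌉₊ f s * (τ - s) ^ ((⌈α⌉₊ : ℝ) - α - 1)) * (t - τ) ^ (α - 1) := by
      rw [← intervalIntegral.integral_const_mul]
      refine intervalIntegral.integral_congr fun s _ => ?_
      simp only [caputoDeriv, if_neg hα]
      ring
    rw [e, hs]
    have := (Real.Gamma_pos_of_pos hb).ne'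
    have := (Real.Gamma_pos_of_pos h0).ne'
    have := (Real.Gamma_pos_of_pos (by linarith : (0 : ℝ) < ⌈α⌉₊)).ne'
    field_simp

/-! ### The Volterra equation of the Mittag-Leffler function -/

/-- The partial sums of the Mittag-Leffler series `E_α(x)`. -/
noncomputable def mittagLefflerSum (α x : ℝ) (M : ℕ) : ℝ :=
  ∑ m ∈ Finset.range M, x ^ m / Real.Gamma (1 + α * m)

theorem integral_rpow_nat_mul_sub_rpow {α : ℝ} (hα : 0 < α) {t : ℝ} (ht : 0 < t) (m : ℕ) :
    (Real.Gamma α)⁻¹ * ∫ s in (0 : ℝ)..t, (s ^ α) ^ m / Real.Gamma (1 + α * m) * (t - s) ^ (α - 1) =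
      (t ^ α) ^ (m + 1) / Real.Gamma (1 + α * (m + 1 : ℕ)) := by
  have hm : 0 < 1 + α * m := by positivity
  have h := integral_rpow_mul_rpow_sub hα hm ht
  have e : ∫ s in (0 : ℝ)..t, (s ^ α) ^ m / Real.Gamma (1 + α * m) * (t - s) ^ (α - 1) =
      (Real.Gamma (1 + α * m))⁻¹ * ∫ s in (0 : ℝ)..t, s ^ (1 + α * m - 1) * (t - s) ^ (α - 1) := by
    rw [← intervalIntegral.integral_const_mul]
    refine intervalIntegral.integral_congr fun s hs => ?_
    rw [uIcc_of_le ht.le] at hs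
    rw [← Real.rpow_natCast (s ^ α), ← Real.rpow_mul hs.1, add_sub_cancel_left]
    ring
  have h1 := (Real.Gamma_pos_of_pos hα).ne'
  have h2 := (Real.Gamma_pos_of_pos hm).ne'
  rw [e, h, ← Real.rpow_natCast (t ^ α), ← Real.rpow_mul ht.le]
  have e1 : α + (1 + α * m) - 1 = α * (m + 1 : ℕ) := by push_cast; ring
  have e2 : α + (1 + α * m) = 1 + α * (m + 1 : ℕ) := by push_cast; ring
  rw [e1, e2]
  field_simp

theorem intervalIntegrable_rpow_nat_mul_sub_rpow {α : ℝ} (hα : 0 < α) (t : ℝ) (m : ℕ) :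
    IntervalIntegrable (fun s => (s ^ α) ^ m / Real.Gamma (1 + α * m) * (t - s) ^ (α - 1))
      volume 0 t := by
  refine (intervalIntegrable_sub_rpow hα t).continuousOn_mul ?_
  have := Real.continuous_rpow_const hα.le
  fun_prop

/-- The partial sums are Picard iterates: `S_{M+1} = 1 - c I^α S_M`. Subtracting from the equation
gives `u - S_{M+1} = -c I^α (u - S_M)`, so the bound `B` is integrated fractionally `M` times. Once
the right side tends to zero, this gives uniqueness and the value of the solution together. -/
theorem abs_sub_mittagLefflerSum_le {α c T B : ℝ} (hα : 0 < α) (hc : 0 ≤ c) {u : ℝ → ℝ}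
    (hu : ∀ t ∈ Ioc 0 T, IntervalIntegrable (fun s => u s * (t - s) ^ (α - 1)) volume 0 t)
    (hB : ∀ t ∈ Ioc 0 T, |u t| ≤ B)
    (heq : ∀ t ∈ Ioc 0 T, u t = 1 - c * ((Real.Gamma α)⁻¹ *
      ∫ s in (0 : ℝ)..t, u s * (t - s) ^ (α - 1))) (M : ℕ) :
    ∀ t ∈ Ioc 0 T, |u t - mittagLefflerSum α (-c * t ^ α) M| ≤
      B * ((c * t ^ α) ^ M / Real.Gamma (1 + α * M)) := by
  induction M with
  | zero => intro t ht; simpa [mittagLefflerSum] using hB t ht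
  | succ M ih =>
    intro t ht
    have hΓ := Real.Gamma_pos_of_pos hα
    have hterm : ∀ m : ℕ, IntervalIntegrable (fun s => (-c * s ^ α) ^ m / Real.Gamma (1 + α * m) *
        (t - s) ^ (α - 1)) volume 0 t := fun m => by
      refine ((intervalIntegrable_rpow_nat_mul_sub_rpow hα t m).const_mul ((-c) ^ m)).congr ?_
      intro s _
      simp only [mul_pow]; ring
    have hS : mittagLefflerSum α (-c * t ^ α) (M + 1) = 1 - c * ((Real.Gamma α)⁻¹ *
        ∫ s in (0 : ℝ)..t, mittagLefflerSum α (-c * s ^ α) M * (t - s) ^ (α - 1)) := by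
      simp only [mittagLefflerSum, Finset.sum_mul]
      rw [intervalIntegral.integral_finsetSum fun m _ => hterm m, Finset.sum_range_succ',
        Finset.mul_sum, Finset.mul_sum]
      simp only [pow_zero, Nat.cast_zero, mul_zero, add_zero, Real.Gamma_one, div_one]
      rw [add_comm, sub_eq_add_neg, ← Finset.sum_neg_distrib]
      congr 1
      refine Finset.sum_congr rfl fun m _ => ?_
      have e : ∫ s in (0 : ℝ)..t, (-c * s ^ α) ^ m / Real.Gamma (1 + α * m) * (t - s) ^ (α - 1) =
          (-c) ^ m * ∫ s in (0 : ℝ)..t, (s ^ α) ^ m / Real.Gamma (1 + α * m) *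
            (t - s) ^ (α - 1) := by
        rw [← intervalIntegral.integral_const_mul]
        refine intervalIntegral.integral_congr fun s _ => ?_
        simp only [mul_pow]; ring
      rw [e, mul_left_comm _ ((-c) ^ m), integral_rpow_nat_mul_sub_rpow hα ht.1]
      rw [mul_pow]; ring
    have hiS : IntervalIntegrable (fun s => mittagLefflerSum α (-c * s ^ α) M * (t - s) ^ (α - 1))
        volume 0 t := by
      simp only [mittagLefflerSum, Finset.sum_mul]
      have h := IntervalIntegrable.sum (Finset.range M) fun m _ => hterm m
      rw [Finset.sum_fn] at h
      exact h
    have hd : u t - mittagLefflerSum α (-c * t ^ α) (M + 1) = -c * ((Real.Gamma α)⁻¹ *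
        ∫ s in (0 : ℝ)..t, (u s - mittagLefflerSum α (-c * s ^ α) M) * (t - s) ^ (α - 1)) := by
      simp only [sub_mul]
      rw [intervalIntegral.integral_sub (hu t ht) hiS, hS, heq t ht]
      ring
    rw [hd, abs_mul, abs_neg, abs_of_nonneg hc, abs_mul, abs_of_pos (inv_pos.2 hΓ)]
    have hbound : |∫ s in (0 : ℝ)..t, (u s - mittagLefflerSum α (-c * s ^ α) M) *
        (t - s) ^ (α - 1)| ≤ ∫ s in (0 : ℝ)..t, B * c ^ M * ((s ^ α) ^ M / Real.Gamma (1 + α * M) *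
          (t - s) ^ (α - 1)) := by
      rw [← Real.norm_eq_abs]
      refine intervalIntegral.norm_integral_le_of_norm_le ht.1.le (ae_of_all _ fun s hs => ?_)
        ((intervalIntegrable_rpow_nat_mul_sub_rpow hα t M).const_mul _)
      rw [norm_mul, Real.norm_of_nonneg (Real.rpow_nonneg (by linarith [hs.2]) _), Real.norm_eq_abs]
      calc _ ≤ B * ((c * s ^ α) ^ M / Real.Gamma (1 + α * M)) * (t - s) ^ (α - 1) :=
            mul_le_mul_of_nonneg_right (ih s ⟨hs.1, hs.2.trans ht.2⟩)
              (Real.rpow_nonneg (by linarith [hs.2]) _)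
        _ = _ := by rw [mul_pow]; ring
    calc _ ≤ c * ((Real.Gamma α)⁻¹ * ∫ s in (0 : ℝ)..t, B * c ^ M *
          ((s ^ α) ^ M / Real.Gamma (1 + α * M) * (t - s) ^ (α - 1))) := by gcongr
      _ = _ := by
        rw [intervalIntegral.integral_const_mul, mul_left_comm _ (B * c ^ M),
          integral_rpow_nat_mul_sub_rpow hα ht.1, mul_pow]
        ring

/-! ### The Wright distribution -/

/-- The negative part of the (signed) measure with density `W_{-ν, 1-ν}(-ξ)` on `(0, ∞)`;
`wrightLaw ν` is its positive part. -/
noncomputable def wrightNeg (ν : ℝ) : Measure ℝ :=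
  if ν = 1 then 0
  else (volume.restrict (Ioi 0)).withDensity fun ξ => ENNReal.ofReal (-wrightW ν (-ξ))

/-- The integral with respect to the signed measure `wrightLaw ν - wrightNeg ν`. -/
noncomputable def wrightMean {E : Type*} [NormedAddCommGroup E] [NormedSpace ℝ E] (ν : ℝ)
    (f : ℝ → E) : E :=
  (∫ ξ, f ξ ∂wrightLaw ν) - ∫ ξ, f ξ ∂wrightNeg ν

section
variable {ν : ℝ}

theorem integrableOn_wrightW (h0 : 0 < ν) (h1 : ν < 1) :
    IntegrableOn (fun ξ => wrightW ν (-ξ)) (Ioi 0) := by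
  simpa using integrableOn_exp_mul_wrightW h0 h1 0

theorem isFiniteMeasure_wrightLaw (h0 : 0 < ν) (h1 : ν ≤ 1) : IsFiniteMeasure (wrightLaw ν) := by
  by_cases h : ν = 1
  · rw [wrightLaw, if_pos h]; infer_instance
  · rw [wrightLaw, if_neg h]
    exact isFiniteMeasure_withDensity_ofReal
      (integrableOn_wrightW h0 (lt_of_le_of_ne h1 h)).2

theorem isFiniteMeasure_wrightNeg (h0 : 0 < ν) (h1 : ν ≤ 1) : IsFiniteMeasure (wrightNeg ν) := by
  by_cases h : ν = 1
  · rw [wrightNeg, if_pos h]; infer_instance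
  · rw [wrightNeg, if_neg h]
    exact isFiniteMeasure_withDensity_ofReal
      (integrableOn_wrightW h0 (lt_of_le_of_ne h1 h)).neg.2

theorem ae_wrightLaw_pos (ν : ℝ) : ∀ᵐ ξ ∂wrightLaw ν, 0 < ξ := by
  unfold wrightLaw
  split_ifs
  · simp [ae_dirac_eq]
  · exact (withDensity_absolutelyContinuous _ _).ae_le (ae_restrict_mem measurableSet_Ioi)

theorem ae_wrightNeg_pos (ν : ℝ) : ∀ᵐ ξ ∂wrightNeg ν, 0 < ξ := by
  unfold wrightNeg
  split_ifs
  · simp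
  · exact (withDensity_absolutelyContinuous _ _).ae_le (ae_restrict_mem measurableSet_Ioi)

/-- The difference of the integrals against the positive and negative parts of the density is the
integral against the density itself. -/
theorem wrightMean_eq_integral {E : Type*} [NormedAddCommGroup E] [NormedSpace ℝ E]
    [CompleteSpace E] (h0 : 0 < ν) (h1 : ν < 1) {f : ℝ → E}
    (hf : AEStronglyMeasurable f (volume.restrict (Ioi 0)))
    (hi : IntegrableOn (fun ξ => wrightW ν (-ξ) • f ξ) (Ioi 0)) :
    wrightMean ν f = ∫ ξ in Ioi (0 : ℝ), wrightW ν (-ξ) • f ξ := by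
  have hm := measurable_wrightW_neg h0 h1
  rw [wrightMean, wrightLaw, wrightNeg, if_neg h1.ne, if_neg h1.ne,
    integral_withDensity_eq_integral_toReal_smul (by fun_prop) (by simp),
    integral_withDensity_eq_integral_toReal_smul (by fun_prop) (by simp), ← integral_sub]
  · refine integral_congr_ae (ae_of_all _ fun ξ => ?_)
    simp only
    rw [← sub_smul, ENNReal.toReal_ofReal', ENNReal.toReal_ofReal', max_zero_sub_eq_self]
  · refine Integrable.mono hi ((by fun_prop : Measurable fun ξ => (ENNReal.ofReal
      (wrightW ν (-ξ))).toReal).aestronglyMeasurable.smul hf) (ae_of_all _ fun ξ => ?_)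
    rw [norm_smul, norm_smul, ENNReal.toReal_ofReal']
    refine mul_le_mul_of_nonneg_right ?_ (norm_nonneg _)
    rw [Real.norm_of_nonneg (le_max_right _ _)]
    exact max_le (le_abs_self _) (abs_nonneg _)
  · refine Integrable.mono hi ((by fun_prop : Measurable fun ξ => (ENNReal.ofReal
      (-wrightW ν (-ξ))).toReal).aestronglyMeasurable.smul hf) (ae_of_all _ fun ξ => ?_)
    rw [norm_smul, norm_smul, ENNReal.toReal_ofReal']
    refine mul_le_mul_of_nonneg_right ?_ (norm_nonneg _)
    rw [Real.norm_of_nonneg (le_max_right _ _)]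
    exact max_le (neg_le_abs _) (abs_nonneg _)

/-- The Laplace transform of the Wright distribution is the Mittag-Leffler function. -/
theorem hasSum_wrightMean_exp (h0 : 0 < ν) (h1 : ν ≤ 1) (z : ℂ) :
    HasSum (fun n : ℕ => z ^ n / (Real.Gamma (1 + ν * n) : ℂ))
      (wrightMean ν fun ξ => Complex.exp (z * ξ)) := by
  by_cases h : ν = 1
  · subst h
    rw [wrightMean, wrightLaw, wrightNeg, if_pos rfl, if_pos rfl, integral_dirac]
    have := NormedSpace.expSeries_div_hasSum_exp z
    rw [← Complex.exp_eq_exp_ℂ] at this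
    simpa [add_comm (1 : ℝ), Real.Gamma_nat_eq_factorial] using this
  · have h1 := lt_of_le_of_ne h1 h
    rw [wrightMean_eq_integral h0 h1 (Continuous.aestronglyMeasurable (by fun_prop))]
    · simpa [mul_comm] using hasSum_integral_exp_mul_wrightW h0 h1 z
    · refine Integrable.mono (integrableOn_exp_mul_wrightW h0 h1 ‖z‖)
        ((measurable_wrightW_neg h0 h1).aestronglyMeasurable.smul
          (Continuous.aestronglyMeasurable (by fun_prop)))
        ((ae_restrict_iff' measurableSet_Ioi).2 (ae_of_all _ fun ξ hξ => ?_))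
      rw [norm_smul, norm_mul, mul_comm]
      refine mul_le_mul_of_nonneg_right ?_ (norm_nonneg _)
      rw [Complex.norm_exp, Real.norm_of_nonneg (Real.exp_pos _).le, Complex.re_mul_ofReal]
      exact Real.exp_le_exp.2 (mul_le_mul_of_nonneg_right (Complex.re_le_norm z) (le_of_lt hξ))

theorem integrable_wrightLaw_of_bound {E : Type*} [NormedAddCommGroup E] (h0 : 0 < ν) (h1 : ν ≤ 1)
    {f : ℝ → E} (hf : StronglyMeasurable f) {C : ℝ} (hb : ∀ ξ, 0 < ξ → ‖f ξ‖ ≤ C) :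
    Integrable f (wrightLaw ν) := by
  have := isFiniteMeasure_wrightLaw h0 h1
  exact Integrable.of_bound hf.aestronglyMeasurable C ((ae_wrightLaw_pos ν).mono hb)

theorem integrable_wrightNeg_of_bound {E : Type*} [NormedAddCommGroup E] (h0 : 0 < ν) (h1 : ν ≤ 1)
    {f : ℝ → E} (hf : StronglyMeasurable f) {C : ℝ} (hb : ∀ ξ, 0 < ξ → ‖f ξ‖ ≤ C) :
    Integrable f (wrightNeg ν) := by
  have := isFiniteMeasure_wrightNeg h0 h1
  exact Integrable.of_bound hf.aestronglyMeasurable C ((ae_wrightNeg_pos ν).mono hb)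

theorem wrightMean_sum (h0 : 0 < ν) (h1 : ν ≤ 1) {ι : Type*} (s : Finset ι) (a : ι → ℝ)
    {f : ι → ℝ → ℝ} (hf : ∀ i ∈ s, StronglyMeasurable (f i)) {C : ℝ}
    (hb : ∀ i ∈ s, ∀ ξ, 0 < ξ → ‖f i ξ‖ ≤ C) :
    wrightMean ν (fun ξ => ∑ i ∈ s, a i * f i ξ) = ∑ i ∈ s, a i * wrightMean ν (f i) := by
  simp only [wrightMean]
  rw [integral_finsetSum _ fun i hi =>
      (integrable_wrightLaw_of_bound h0 h1 (hf i hi) (hb i hi)).const_mul (a i),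
    integral_finsetSum _ fun i hi =>
      (integrable_wrightNeg_of_bound h0 h1 (hf i hi) (hb i hi)).const_mul (a i),
    ← Finset.sum_sub_distrib]
  refine Finset.sum_congr rfl fun i _ => ?_
  rw [integral_const_mul, integral_const_mul, mul_sub]

theorem wrightMean_ofReal (f : ℝ → ℝ) :
    wrightMean ν (fun ξ => (f ξ : ℂ)) = ((wrightMean ν f : ℝ) : ℂ) := by
  simp only [wrightMean, integral_complex_ofReal, Complex.ofReal_sub]

theorem wrightMean_congr {E : Type*} [NormedAddCommGroup E] [NormedSpace ℝ E] {f g : ℝ → E}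
    (h : ∀ ξ, 0 < ξ → f ξ = g ξ) : wrightMean ν f = wrightMean ν g := by
  rw [wrightMean, wrightMean, integral_congr_ae ((ae_wrightLaw_pos ν).mono h),
    integral_congr_ae ((ae_wrightNeg_pos ν).mono h)]

theorem tendsto_mittagLefflerSum (h0 : 0 < ν) (h1 : ν ≤ 1) (x : ℝ) :
    Tendsto (mittagLefflerSum ν x) atTop (𝓝 (wrightMean ν fun ξ => Real.exp (x * ξ))) := by
  have h := hasSum_wrightMean_exp h0 h1 x
  have e : (fun ξ : ℝ => Complex.exp (x * ξ)) = fun ξ : ℝ => ((Real.exp (x * ξ) : ℝ) : ℂ) := by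
    ext ξ; push_cast; rfl
  rw [e, wrightMean_ofReal] at h
  have h2 : HasSum (fun n : ℕ => x ^ n / Real.Gamma (1 + ν * n))
      (wrightMean ν fun ξ => Real.exp (x * ξ)) := by
    exact_mod_cast h
  exact h2.tendsto_sum_nat

/-- Terms of a convergent series; this makes the Picard error vanish. -/
theorem tendsto_pow_div_Gamma (h0 : 0 < ν) (h1 : ν ≤ 1) (x : ℝ) :
    Tendsto (fun n : ℕ => x ^ n / Real.Gamma (1 + ν * n)) atTop (𝓝 0) := by
  have h := (hasSum_wrightMean_exp h0 h1 x).summable.tendsto_atTop_zero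
  refine (Complex.continuous_re.tendsto 0).comp h |>.congr fun n => ?_
  simp only [Function.comp_apply]
  rw [← Complex.ofReal_pow, ← Complex.ofReal_div, Complex.ofReal_re]

/-- Average the series `E_ν(± i y)`: odd terms cancel, even terms are those of `E_{2ν}(-y²)`, and
the exponentials average to the cosine. Hence `M` terms here correspond to `2M` terms there. -/
theorem tendsto_mittagLefflerSum_two_mul (h0 : 0 < ν) (h1 : ν ≤ 1) (y : ℝ) :
    Tendsto (mittagLefflerSum (2 * ν) (-y ^ 2)) atTop
      (𝓝 (wrightMean ν fun ξ => Real.cos (y * ξ))) := by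
  have hnorm : ∀ x ξ : ℝ, ‖Complex.exp (x * Complex.I * ξ)‖ ≤ 1 := fun x ξ => by
    rw [show (x : ℂ) * Complex.I * ξ = ((x * ξ : ℝ) : ℂ) * Complex.I by push_cast; ring,
      Complex.norm_exp_ofReal_mul_I]
  have hmeas : ∀ x : ℝ, StronglyMeasurable fun ξ : ℝ => Complex.exp (x * Complex.I * ξ) :=
    fun x => Continuous.stronglyMeasurable (by fun_prop)
  have e : ((wrightMean ν fun ξ => Real.cos (y * ξ) : ℝ) : ℂ) =
      ((wrightMean ν fun ξ => Complex.exp (y * Complex.I * ξ)) +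
        wrightMean ν fun ξ => Complex.exp ((-y : ℝ) * Complex.I * ξ)) / 2 := by
    have ec : ∀ ξ : ℝ, ((Real.cos (y * ξ) : ℝ) : ℂ) = (Complex.exp (y * Complex.I * ξ) +
        Complex.exp ((-y : ℝ) * Complex.I * ξ)) / 2 := fun ξ => by
      rw [Complex.ofReal_cos, Complex.cos]; push_cast; ring_nf
    rw [← wrightMean_ofReal]
    simp only [ec, wrightMean]
    rw [integral_div, integral_div,
      integral_add (integrable_wrightLaw_of_bound h0 h1 (hmeas y) fun ξ _ => hnorm y ξ)
        (integrable_wrightLaw_of_bound h0 h1 (hmeas (-y)) fun ξ _ => hnorm (-y) ξ),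
      integral_add (integrable_wrightNeg_of_bound h0 h1 (hmeas y) fun ξ _ => hnorm y ξ)
        (integrable_wrightNeg_of_bound h0 h1 (hmeas (-y)) fun ξ _ => hnorm (-y) ξ)]
    ring
  have h := ((hasSum_wrightMean_exp h0 h1 (y * Complex.I)).add
    (hasSum_wrightMean_exp h0 h1 ((-y : ℝ) * Complex.I))).div_const 2
  rw [← e] at h
  have h2 := h.tendsto_sum_nat.comp (tendsto_id.const_mul_atTop' (two_pos (α := ℕ)))
  have hsum : ∀ M : ℕ, ∑ n ∈ Finset.range (2 * M), ((y * Complex.I) ^ n /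
      (Real.Gamma (1 + ν * n) : ℂ) + ((-y : ℝ) * Complex.I) ^ n / (Real.Gamma (1 + ν * n) : ℂ)) / 2
      = ((mittagLefflerSum (2 * ν) (-y ^ 2) M : ℝ) : ℂ) := by
    intro M
    induction M with
    | zero => simp [mittagLefflerSum]
    | succ M ih =>
      rw [show 2 * (M + 1) = 2 * M + 1 + 1 by ring, Finset.sum_range_succ, Finset.sum_range_succ,
        ih, mittagLefflerSum, mittagLefflerSum, Finset.sum_range_succ]
      have e1 : ((y : ℂ) * Complex.I) ^ (2 * M) = ((-y ^ 2 : ℝ) : ℂ) ^ M := by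
        rw [pow_mul, mul_pow, Complex.I_sq]; push_cast; ring
      have e2 : (((-y : ℝ) : ℂ) * Complex.I) ^ (2 * M) = ((-y ^ 2 : ℝ) : ℂ) ^ M := by
        rw [pow_mul, mul_pow, Complex.I_sq]; push_cast; ring
      have e3 : 1 + ν * (2 * M : ℕ) = 1 + 2 * ν * M := by push_cast; ring
      rw [pow_succ ((y : ℂ) * Complex.I) (2 * M), pow_succ (((-y : ℝ) : ℂ) * Complex.I) (2 * M),
        e1, e2, e3]
      push_cast
      ring
  refine ((Complex.continuous_re.tendsto _).comp h2).congr fun M => ?_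
  simp only [Function.comp_apply, id]
  rw [hsum, Complex.ofReal_re]

end

/-! ### The fractional Yule process -/

/-- Here `a i` stands for `p (i + 1)` and `J i` for its fractional integral. By `(i + 1) C(j, i+1) =
(j - i) C(j, i)`, the coefficient of `J i` collects `(i + 1) + (j - i) = j + 1`: the alternating
binomial row is a left eigenvector of the Yule system. -/
theorem sum_choose_eq_of_recurrence {lam : ℝ} {a J : ℕ → ℝ} (h0 : a 0 = 1 - lam * J 0)
    (hs : ∀ i : ℕ, a (i + 1) = -lam * (i + 2) * J (i + 1) + lam * (i + 1) * J i) (j : ℕ) :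
    ∑ i ∈ Finset.range (j + 1), (-1) ^ i * (j.choose i : ℝ) * a i =
      1 - lam * (j + 1) * ∑ i ∈ Finset.range (j + 1), (-1) ^ i * (j.choose i : ℝ) * J i := by
  have hc : ∀ i ∈ Finset.range j, ((i : ℝ) + 1) * (j.choose (i + 1) : ℝ) =
      (j - i) * (j.choose i : ℝ) := fun i hi => by
    have := Nat.choose_succ_right_eq j i
    have h2 : ((j - i : ℕ) : ℝ) = j - i := Nat.cast_sub (Finset.mem_range.1 hi).le
    rw [← h2, mul_comm, mul_comm ((j - i : ℕ) : ℝ)]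
    exact_mod_cast this
  rw [Finset.sum_range_succ', h0]
  have e1 : ∑ i ∈ Finset.range j, (-1) ^ (i + 1) * (j.choose (i + 1) : ℝ) * a (i + 1) =
      (-lam) * ∑ i ∈ Finset.range j, (-1) ^ (i + 1) * (j.choose (i + 1) : ℝ) * (i + 2) * J (i + 1)
      + (-lam) * ∑ i ∈ Finset.range j, (-1) ^ i * (j.choose i : ℝ) * (j - i) * J i := by
    rw [Finset.mul_sum, Finset.mul_sum, ← Finset.sum_add_distrib]
    refine Finset.sum_congr rfl fun i hi => ?_
    rw [hs]
    linear_combination (-lam * (-1) ^ i * J i) * hc i hi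
  have e2 : (j + 1) * ∑ i ∈ Finset.range (j + 1), (-1) ^ i * (j.choose i : ℝ) * J i =
      (∑ i ∈ Finset.range (j + 1), (-1) ^ i * (j.choose i : ℝ) * (i + 1) * J i) +
      ∑ i ∈ Finset.range (j + 1), (-1) ^ i * (j.choose i : ℝ) * (j - i) * J i := by
    rw [Finset.mul_sum, ← Finset.sum_add_distrib]
    exact Finset.sum_congr rfl fun i _ => by ring
  rw [e1, mul_assoc lam, e2, Finset.sum_range_succ' _ j, Finset.sum_range_succ _ j]
  have e3 : ∑ i ∈ Finset.range j, (-1) ^ (i + 1) * (j.choose (i + 1) : ℝ) * (i + 2) * J (i + 1) =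
      ∑ i ∈ Finset.range j, (-1) ^ (i + 1) * (j.choose (i + 1) : ℝ) * ((i + 1 : ℕ) + 1) *
        J (i + 1) := Finset.sum_congr rfl fun i _ => by push_cast; ring
  rw [e3]
  simp
  ring

/-- The binomial sum is continuous, hence bounded on `[0, t]`, and solves the scalar Volterra
equation with constant `lam (j + 1)`; Picard iteration identifies it. -/
theorem IsFractionalYule.sum_choose {ν lam : ℝ} (hν0 : 0 < ν) (hν1 : ν ≤ 1) (hlam : 0 < lam)
    {p : ℕ → ℝ → ℝ} (hp : IsFractionalYule ν lam p) {t : ℝ} (ht : 0 < t) (j : ℕ) :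
    ∑ i ∈ Finset.range (j + 1), (-1) ^ i * (j.choose i : ℝ) * p (i + 1) t =
      wrightMean ν fun ξ => Real.exp (-(lam * (j + 1)) * t ^ ν * ξ) := by
  set v : ℝ → ℝ := fun s => ∑ i ∈ Finset.range (j + 1), (-1) ^ i * (j.choose i : ℝ) * p (i + 1) s
    with hv
  have hcont : ∀ i, ContinuousOn (p (i + 1)) (Ici 0) := fun i =>
    (hp.regular (i + 1) (by simp)).continuousOn
  have hvc : ContinuousOn v (Ici 0) :=
    continuousOn_finsetSum _ fun i _ => (hcont i).const_mul _
  obtain ⟨B, hB⟩ := isCompact_Icc.exists_bound_of_continuousOn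
    (hvc.mono fun x (hx : x ∈ Icc 0 t) => hx.1)
  have hii : ∀ {g : ℝ → ℝ}, ContinuousOn g (Ici 0) → ∀ s ∈ Ioc 0 t,
      IntervalIntegrable (fun τ => g τ * (s - τ) ^ (ν - 1)) volume 0 s := fun hg s hs => by
    refine (intervalIntegrable_sub_rpow hν0 s).continuousOn_mul (hg.mono fun x hx => ?_)
    rw [uIcc_of_le hs.1.le] at hx
    exact hx.1
  have hΓ := Real.Gamma_pos_of_pos hν0
  have heq : ∀ s ∈ Ioc 0 t, v s = 1 - lam * (j + 1) * ((Real.Gamma ν)⁻¹ *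
      ∫ τ in (0 : ℝ)..s, v τ * (s - τ) ^ (ν - 1)) := by
    intro s hs
    have hvolt : ∀ i : ℕ, p (i + 1) s = (if i = 0 then 1 else 0) + (Real.Gamma ν)⁻¹ *
        ∫ τ in (0 : ℝ)..s, (-lam * (i + 1) * p (i + 1) τ + lam * i * p i τ) *
          (s - τ) ^ (ν - 1) := by
      intro i
      rw [(hp.regular (i + 1) (by simp)).eq_add_integral hν0 (by linarith)
        (fun h => absurd h hν1.not_gt) hs.1, hp.initial (i + 1) (by simp)]
      simp only [Nat.add_eq_right]
      congr 2
      refine intervalIntegral.integral_congr_ae (ae_of_all _ fun τ hτ => ?_)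
      rw [uIoc_of_le hs.1.le] at hτ
      rw [hp.equation (i + 1) (by simp) τ hτ.1]
      simp
    have hrec := sum_choose_eq_of_recurrence (lam := lam) (a := fun i => p (i + 1) s)
      (J := fun i => (Real.Gamma ν)⁻¹ * ∫ τ in (0 : ℝ)..s, p (i + 1) τ * (s - τ) ^ (ν - 1)) ?_ ?_ j
    · rw [hv]
      simp only
      rw [hrec]
      congr 2
      simp only [Finset.sum_mul]
      rw [intervalIntegral.integral_finsetSum fun i _ => hii ((hcont i).const_mul _) s hs,
        Finset.mul_sum]
      refine Finset.sum_congr rfl fun i _ => ?_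
      simp only [mul_assoc]
      rw [intervalIntegral.integral_const_mul, intervalIntegral.integral_const_mul]
      ring
    -- The arbitrary function `p 0` enters only with coefficient zero.
    · rw [hvolt 0]
      simp only [Nat.cast_zero, mul_zero, zero_mul, add_zero, zero_add, if_true, mul_one, mul_assoc]
      rw [intervalIntegral.integral_const_mul]
      ring
    · intro i
      rw [hvolt (i + 1)]
      simp only [add_mul (_ * _ * _)]
      rw [intervalIntegral.integral_add (by
          simp only [mul_assoc]
          exact (((hii (hcont (i + 1)) s hs).const_mul _).const_mul _)) (by
          simp only [mul_assoc]
          exact (((hii (hcont i) s hs).const_mul _).const_mul _))]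
      simp only [mul_assoc]
      rw [intervalIntegral.integral_const_mul, intervalIntegral.integral_const_mul,
        intervalIntegral.integral_const_mul, intervalIntegral.integral_const_mul]
      push_cast
      simp
      ring
  have hbd := fun M => abs_sub_mittagLefflerSum_le (c := lam * (j + 1)) hν0 (by positivity) (hii hvc)
    (fun s hs => hB s ⟨hs.1.le, hs.2⟩) heq M t ⟨ht, le_rfl⟩
  have h1 : Tendsto (fun M => v t - mittagLefflerSum ν (-(lam * (j + 1)) * t ^ ν) M) atTop (𝓝 0) :=
    squeeze_zero_norm hbd (by simpa using (tendsto_pow_div_Gamma hν0 hν1 _).const_mul B)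
  have h2 := (tendsto_mittagLefflerSum hν0 hν1 (-(lam * (j + 1)) * t ^ ν)).const_sub (v t)
  exact sub_eq_zero.1 (tendsto_nhds_unique h2 h1)

theorem sum_choose_mul_exp (j : ℕ) (x : ℝ) :
    ∑ i ∈ Finset.range (j + 1), (-1) ^ i * (j.choose i : ℝ) *
      (Real.exp (-x) * (1 - Real.exp (-x)) ^ i) = Real.exp (-((j + 1) * x)) := by
  have h := add_pow (-(1 - Real.exp (-x))) 1 j
  have e : -(1 - Real.exp (-x)) + 1 = Real.exp (-x) := by ring
  rw [e, ← Real.exp_nat_mul] at h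
  rw [show -((j + 1) * x) = -x + j * -x by ring, Real.exp_add, h, Finset.mul_sum]
  refine Finset.sum_congr rfl fun i _ => ?_
  rw [one_pow, neg_pow (1 - Real.exp (-x))]
  ring

theorem abs_exp_mul_one_sub_exp_pow_le {x : ℝ} (hx : 0 ≤ x) (k : ℕ) :
    |Real.exp (-x) * (1 - Real.exp (-x)) ^ k| ≤ 1 := by
  have h1 : Real.exp (-x) ≤ 1 := Real.exp_le_one_iff.2 (by linarith)
  have h2 := Real.exp_pos (-x)
  rw [abs_mul, abs_pow, abs_of_pos h2, abs_of_nonneg (by linarith)]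
  exact mul_le_one₀ h1 (by positivity) (pow_le_one₀ (by linarith) (by linarith))

/-- Both sides have the same alternating binomial sums for every `j`; that system is triangular with
diagonal entries `±1`, so strong induction gives equality. -/
theorem IsFractionalYule.eq_wrightMean {ν lam : ℝ} (hν0 : 0 < ν) (hν1 : ν ≤ 1) (hlam : 0 < lam)
    {p : ℕ → ℝ → ℝ} (hp : IsFractionalYule ν lam p) {t : ℝ} (ht : 0 < t) (k : ℕ) :
    p (k + 1) t = wrightMean ν fun ξ =>
      Real.exp (-(lam * (t ^ ν * ξ))) * (1 - Real.exp (-(lam * (t ^ ν * ξ)))) ^ k := by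
  set q : ℕ → ℝ := fun k => wrightMean ν fun ξ =>
    Real.exp (-(lam * (t ^ ν * ξ))) * (1 - Real.exp (-(lam * (t ^ ν * ξ)))) ^ k with hq
  have hsum : ∀ j : ℕ, ∑ i ∈ Finset.range (j + 1), (-1) ^ i * (j.choose i : ℝ) *
      (p (i + 1) t - q i) = 0 := by
    intro j
    simp only [mul_sub]
    have h := wrightMean_sum hν0 hν1 (C := 1) (Finset.range (j + 1))
      (fun i => (-1) ^ i * (j.choose i : ℝ)) (f := fun i ξ => Real.exp (-(lam * (t ^ ν * ξ))) *
        (1 - Real.exp (-(lam * (t ^ ν * ξ)))) ^ i)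
      (fun i _ => Continuous.stronglyMeasurable (by fun_prop))
      (fun i _ ξ hξ => abs_exp_mul_one_sub_exp_pow_le (by positivity) i)
    rw [Finset.sum_sub_distrib, hp.sum_choose hν0 hν1 hlam ht, sub_eq_zero]
    refine Eq.trans (wrightMean_congr fun ξ _ => ?_) h
    rw [sum_choose_mul_exp]
    ring_nf
  suffices p (k + 1) t - q k = 0 from sub_eq_zero.1 this
  induction k using Nat.strong_induction_on with
  | _ k ih =>
    have h := hsum k
    rw [Finset.sum_range_succ, Finset.sum_eq_zero fun i hi => by
      rw [ih i (Finset.mem_range.1 hi), mul_zero]] at h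
    simpa using h

/-! ### The law of the random time -/

theorem deriv_zero_of_even {f : ℝ → ℝ} (hf : ∀ x, f (-x) = f x) : deriv f 0 = 0 := by
  have h := deriv_comp_neg f (0 : ℝ)
  simp only [hf, neg_zero] at h
  linarith

theorem IsNeumannTest.of_even {φ : ℝ → ℝ} (h1 : ContDiff ℝ (⊤ : ℕ∞) φ) (h2 : HasCompactSupport φ)
    (h3 : ∀ x, φ (-x) = φ x) : IsNeumannTest φ := ⟨h1, h2, deriv_zero_of_even h3⟩

/-- Evenness passes to the second derivative, whereas `φ'(0) = 0` alone does not. Pairings with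
`φ''` are then continuous in time. -/
theorem IsNeumannTest.iteratedDeriv_two_of_even {φ : ℝ → ℝ} (h1 : ContDiff ℝ (⊤ : ℕ∞) φ)
    (h2 : HasCompactSupport φ) (h3 : ∀ x, φ (-x) = φ x) : IsNeumannTest (iteratedDeriv 2 φ) := by
  refine .of_even ?_ ?_ fun x => ?_
  · rw [iteratedDeriv_eq_iterate]
    exact h1.iterate_deriv 2
  · rw [iteratedDeriv_succ, iteratedDeriv_one]
    exact h2.deriv.deriv
  · have h := iteratedDeriv_comp_neg 2 φ (-x)
    simp only [h3] at h
    simpa using h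

/-- A smooth even bump function, equal to `1` near `0`. -/
noncomputable def cutoff : ContDiffBump (0 : ℝ) := ⟨1, 2, one_pos, one_lt_two⟩

/-- The cosine of frequency `η`, cut off at distance of order `1 / ε`. -/
noncomputable def cutoffCos (η ε x : ℝ) : ℝ := Real.cos (η * x) * cutoff (ε * x)

theorem cutoffCos_neg (η ε x : ℝ) : cutoffCos η ε (-x) = cutoffCos η ε x := by
  rw [cutoffCos, cutoffCos, mul_neg, mul_neg, Real.cos_neg, cutoff.neg]

theorem contDiff_cutoffCos (η ε : ℝ) : ContDiff ℝ (⊤ : ℕ∞) (cutoffCos η ε) := by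
  have h : ContDiff ℝ (⊤ : ℕ∞) cutoff := cutoff.contDiff
  have h2 : ContDiff ℝ (⊤ : ℕ∞) fun x : ℝ => Real.cos (η * x) := 
    Real.contDiff_cos.comp (contDiff_const.mul contDiff_id)
  exact h2.mul (h.comp (contDiff_const.mul contDiff_id))

theorem hasCompactSupport_cutoffCos (η : ℝ) {ε : ℝ} (hε : ε ≠ 0) :
    HasCompactSupport (cutoffCos η ε) := by
  have h := cutoff.hasCompactSupport.comp_smul hε
  simp only [smul_eq_mul] at h
  exact h.mul_left

theorem iteratedDeriv_two_cutoffCos (η ε x : ℝ) : iteratedDeriv 2 (cutoffCos η ε) x =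
    -η ^ 2 * Real.cos (η * x) * cutoff (ε * x) - 2 * η * ε * Real.sin (η * x) * deriv cutoff (ε * x)
      + ε ^ 2 * Real.cos (η * x) * deriv (deriv cutoff) (ε * x) := by
  have hχ : ContDiff ℝ 2 cutoff := cutoff.contDiff
  have d0 : ∀ x, HasDerivAt cutoff (deriv cutoff x) x := fun x =>
    (hχ.differentiable two_ne_zero x).hasDerivAt
  have d1 : ∀ x, HasDerivAt (deriv cutoff) (deriv (deriv cutoff) x) x := fun x =>
    (((contDiff_succ_iff_deriv (n := 1)).1 hχ).2.2.differentiable one_ne_zero x).hasDerivAt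
  have l : ∀ c x : ℝ, HasDerivAt (fun x => c * x) c x := fun c x => by
    simpa using (hasDerivAt_id x).const_mul c
  have f0 : ∀ x, HasDerivAt (fun x => cutoff (ε * x)) (deriv cutoff (ε * x) * ε) x := fun x =>
    (d0 (ε * x)).comp x (l ε x)
  have f1 : ∀ x, HasDerivAt (fun x => deriv cutoff (ε * x)) (deriv (deriv cutoff) (ε * x) * ε) x :=
    fun x => (d1 (ε * x)).comp x (l ε x)
  have e1 : deriv (cutoffCos η ε) = fun x => -Real.sin (η * x) * η * cutoff (ε * x) +
      Real.cos (η * x) * (deriv cutoff (ε * x) * ε) := by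
    ext x
    exact ((l η x).cos.mul (f0 x)).deriv
  rw [iteratedDeriv_succ, iteratedDeriv_one, e1]
  have := ((((l η x).sin.neg.mul_const η).mul (f0 x)).add
    ((l η x).cos.mul ((f1 x).mul_const ε))).deriv
  refine this.trans ?_
  simp only [Pi.neg_apply]
  ring

/-- Each derivative falling on the cutoff brings a factor `ε ≤ 1`, so the bound is uniform in `ε`
and can serve for dominated convergence. -/
theorem exists_cutoffCos_bound (η : ℝ) : ∃ D, ∀ ε ∈ Icc (0 : ℝ) 1, ∀ x,
    |iteratedDeriv 2 (cutoffCos η ε) x| ≤ D := by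
  have hχ : ContDiff ℝ 2 cutoff := cutoff.contDiff
  have c1 := ((contDiff_succ_iff_deriv (n := 1)).1 hχ).2.2
  have c2 := ((contDiff_succ_iff_deriv (n := 0)).1 c1).2.2
  obtain ⟨C1, h1⟩ := c1.continuous.bounded_above_of_compact_support cutoff.hasCompactSupport.deriv
  obtain ⟨C2, h2⟩ := c2.continuous.bounded_above_of_compact_support
    cutoff.hasCompactSupport.deriv.deriv
  refine ⟨η ^ 2 * 1 * 1 + 2 * |η| * 1 * 1 * C1 + 1 * 1 * C2, fun ε hε x => ?_⟩
  rw [iteratedDeriv_two_cutoffCos]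
  have hc := Real.abs_cos_le_one (η * x)
  have hs := Real.abs_sin_le_one (η * x)
  have hχ1 : |cutoff (ε * x)| ≤ 1 := by rw [abs_of_nonneg cutoff.nonneg]; exact cutoff.le_one
  have g1 := h1 (ε * x)
  have g2 := h2 (ε * x)
  have hε1 : |ε| ≤ 1 := by rw [abs_of_nonneg hε.1]; exact hε.2
  have hε2 : |ε ^ 2| ≤ 1 := by rw [abs_pow]; exact pow_le_one₀ (abs_nonneg _) hε1
  refine (abs_add_le _ _).trans (add_le_add ((abs_sub _ _).trans (add_le_add ?_ ?_)) ?_)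
  · rw [abs_mul, abs_mul, abs_neg, abs_of_nonneg (sq_nonneg η)]
    gcongr
  · rw [abs_mul, abs_mul, abs_mul, abs_mul, abs_two]
    gcongr
    exact g1
  · rw [abs_mul, abs_mul]
    gcongr
    exact g2

theorem abs_cutoffCos_le (η ε x : ℝ) : |cutoffCos η ε x| ≤ 1 := by
  rw [cutoffCos, abs_mul, abs_of_nonneg (cutoff.nonneg)]
  exact mul_le_one₀ (Real.abs_cos_le_one _) cutoff.nonneg cutoff.le_one

theorem continuous_deriv_cutoff : Continuous (deriv cutoff) ∧ Continuous (deriv (deriv cutoff)) := by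
  have hχ : ContDiff ℝ 2 cutoff := cutoff.contDiff
  have c1 := ((contDiff_succ_iff_deriv (n := 1)).1 hχ).2.2
  exact ⟨c1.continuous, ((contDiff_succ_iff_deriv (n := 0)).1 c1).2.2.continuous⟩

theorem tendsto_cutoffCos (η x : ℝ) {ε : ℕ → ℝ} (hε : Tendsto ε atTop (𝓝 0)) :
    Tendsto (fun n => cutoffCos η (ε n) x) atTop (𝓝 (Real.cos (η * x))) ∧
    Tendsto (fun n => iteratedDeriv 2 (cutoffCos η (ε n)) x) atTop
      (𝓝 (-η ^ 2 * Real.cos (η * x))) := by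
  have h1 : cutoff 0 = 1 := cutoff.eventuallyEq_one.eq_of_nhds
  have c0 : Continuous cutoff := cutoff.continuous
  obtain ⟨c1, c2⟩ := continuous_deriv_cutoff
  constructor
  · have : Continuous fun e : ℝ => cutoffCos η e x := by unfold cutoffCos; fun_prop
    have := (this.tendsto 0).comp hε
    simpa [cutoffCos, h1, Function.comp_def] using this
  · have : Continuous fun e : ℝ => iteratedDeriv 2 (cutoffCos η e) x := by
      simp only [iteratedDeriv_two_cutoffCos]; fun_prop
    have := (this.tendsto 0).comp hε
    simpa [iteratedDeriv_two_cutoffCos, h1, Function.comp_def] using this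

section
variable {ν : ℝ} {μ : ℝ≥0 → Measure ℝ≥0}

theorem abs_pairing_le (hμ : ∀ t, IsProbabilityMeasure (μ t)) {φ : ℝ → ℝ} {C : ℝ}
    (hφ : ∀ x, |φ x| ≤ C) (s : ℝ) : |pairing μ φ s| ≤ C := by
  have := hμ s.toNNReal
  have h := norm_integral_le_of_norm_le_const (μ := μ s.toNNReal) (f := fun x : ℝ≥0 => φ x)
    (ae_of_all _ fun x => hφ x)
  simpa [pairing] using h

theorem tendsto_pairing (hμ : ∀ t, IsProbabilityMeasure (μ t)) {φ : ℕ → ℝ → ℝ} {ψ : ℝ → ℝ} {C : ℝ}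
    (hc : ∀ n, Continuous (φ n)) (hb : ∀ n x, |φ n x| ≤ C)
    (h : ∀ x, Tendsto (fun n => φ n x) atTop (𝓝 (ψ x))) (s : ℝ) :
    Tendsto (fun n => pairing μ (φ n) s) atTop (𝓝 (pairing μ ψ s)) := by
  have := hμ s.toNNReal
  refine tendsto_integral_of_dominated_convergence (fun _ => C) (fun n => ?_)
    (integrable_const C) (fun n => ae_of_all _ fun x => hb n x) (ae_of_all _ fun x => h x)
  have := hc n
  exact Continuous.aestronglyMeasurable (by fun_prop)

/-- The cosine is not compactly supported, so the Volterra equation is written for its cutoffs and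
passed to the limit; there the second derivative becomes multiplication by `-η²`. Picard iteration
of order `2ν` identifies the bounded solution. -/
theorem IsFractionalDiffusionLaw.pairing_cos (hν0 : 0 < ν) (hν1 : ν ≤ 1)
    (hμ : IsFractionalDiffusionLaw ν μ) (η : ℝ) {t : ℝ} (ht : 0 < t) :
    pairing μ (fun x => Real.cos (η * x)) t =
      wrightMean ν fun ξ => Real.cos (η * (t ^ ν * ξ)) := by
  set ε : ℕ → ℝ := fun n => 1 / ((n : ℝ) + 1) with hε
  have hε0 : Tendsto ε atTop (𝓝 0) := tendsto_one_div_add_atTop_nhds_zero_nat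
  have hεpos : ∀ n, 0 < ε n := fun n => Nat.one_div_pos_of_nat
  have hε1 : ∀ n, ε n ∈ Icc (0 : ℝ) 1 := fun n =>
    ⟨(hεpos n).le, by rw [hε]; exact div_le_one_of_le₀ (by simp) (by positivity)⟩
  have hα : 0 < 2 * ν := by linarith
  have hΓ := Real.Gamma_pos_of_pos hα
  set u := pairing μ (fun x => Real.cos (η * x)) with hu
  have hprob := hμ.isProbabilityMeasure
  have htest : ∀ n, IsNeumannTest (cutoffCos η (ε n)) := fun n => .of_even
    (contDiff_cutoffCos _ _) (hasCompactSupport_cutoffCos _ (hεpos n).ne') (cutoffCos_neg _ _)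
  have htest2 : ∀ n, IsNeumannTest (iteratedDeriv 2 (cutoffCos η (ε n))) := fun n =>
    .iteratedDeriv_two_of_even
    (contDiff_cutoffCos _ _) (hasCompactSupport_cutoffCos _ (hεpos n).ne') (cutoffCos_neg _ _)
  obtain ⟨D, hD⟩ := exists_cutoffCos_bound η
  have hub : ∀ s, |u s| ≤ 1 := abs_pairing_le hprob fun x => Real.abs_cos_le_one _
  have t1 : ∀ s, Tendsto (fun n => pairing μ (cutoffCos η (ε n)) s) atTop (𝓝 (u s)) :=
    tendsto_pairing hprob (fun n => (htest n).contDiff.continuous)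
      (fun n x => abs_cutoffCos_le η (ε n) x) fun x => (tendsto_cutoffCos η x hε0).1
  have t2 : ∀ s, Tendsto (fun n => pairing μ (iteratedDeriv 2 (cutoffCos η (ε n))) s) atTop
      (𝓝 (-η ^ 2 * u s)) := fun s => by
    have := tendsto_pairing hprob (fun n => (htest2 n).contDiff.continuous)
      (fun n x => hD (ε n) (hε1 n) x) (fun x => (tendsto_cutoffCos η x hε0).2) s
    have e : pairing μ (fun x => -η ^ 2 * Real.cos (η * x)) s = -η ^ 2 * u s := by
      simp only [pairing, hu]; rw [integral_const_mul]
    rwa [e] at this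
  have hmeas : ∀ φ, IsNeumannTest φ → ∀ s : ℝ, 0 < s →
      AEStronglyMeasurable (pairing μ φ) (volume.restrict (Ioc 0 s)) := fun φ hφ s hs =>
    ((hμ.regular φ hφ).continuousOn.mono fun x hx => hx.1.le).aestronglyMeasurable measurableSet_Ioc
  have hum : ∀ s : ℝ, 0 < s → AEStronglyMeasurable u (volume.restrict (Ioc 0 s)) := fun s hs =>
    aestronglyMeasurable_of_tendsto_ae atTop (fun n => hmeas _ (htest n) s hs)
      (ae_of_all _ fun x => t1 x)
  have hui : ∀ s ∈ Ioc 0 t, IntervalIntegrable (fun τ => u τ * (s - τ) ^ (2 * ν - 1)) volume 0 s := by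
    intro s hs
    have h := intervalIntegrable_sub_rpow hα s
    rw [intervalIntegrable_iff_integrableOn_Ioc_of_le hs.1.le] at h ⊢
    exact h.bdd_mul (c := 1) (hum s hs.1) (ae_of_all _ fun x => hub x)
  have heq : ∀ s ∈ Ioc 0 t, u s = 1 - η ^ 2 * ((Real.Gamma (2 * ν))⁻¹ *
      ∫ τ in (0 : ℝ)..s, u τ * (s - τ) ^ (2 * ν - 1)) := by
    intro s hs
    have hn : ∀ n, pairing μ (cutoffCos η (ε n)) s = 1 + (Real.Gamma (2 * ν))⁻¹ *
        ∫ τ in (0 : ℝ)..s, pairing μ (iteratedDeriv 2 (cutoffCos η (ε n))) τ *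
          (s - τ) ^ (2 * ν - 1) := by
      intro n
      rw [(hμ.regular _ (htest n)).eq_add_integral hα (by linarith)
        (fun h => hμ.initial_deriv (by linarith) _ (htest n)) hs.1]
      congr 2
      · have h1 : cutoff 0 = 1 := cutoff.eventuallyEq_one.eq_of_nhds
        simp [pairing, hμ.initial, cutoffCos, h1]
      · refine intervalIntegral.integral_congr_ae (ae_of_all _ fun τ hτ => ?_)
        rw [uIoc_of_le hs.1.le] at hτ
        rw [hμ.equation _ (htest n) τ hτ.1]
    have hlim : Tendsto (fun n => ∫ τ in (0 : ℝ)..s, pairing μ (iteratedDeriv 2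
        (cutoffCos η (ε n))) τ * (s - τ) ^ (2 * ν - 1)) atTop
        (𝓝 (∫ τ in (0 : ℝ)..s, -η ^ 2 * u τ * (s - τ) ^ (2 * ν - 1))) := by
      refine intervalIntegral.tendsto_integral_filter_of_dominated_convergence
        (fun τ => D * (s - τ) ^ (2 * ν - 1)) (Eventually.of_forall fun n => ?_)
        (Eventually.of_forall fun n => ae_of_all _ fun τ hτ => ?_)
        ((intervalIntegrable_sub_rpow hα s).const_mul D) (ae_of_all _ fun τ _ => (t2 τ).mul_const _)
      · rw [uIoc_of_le hs.1.le]
        exact (hmeas _ (htest2 n) s hs.1).mul (Measurable.aestronglyMeasurable (by fun_prop))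
      · rw [uIoc_of_le hs.1.le] at hτ
        have h0 : 0 ≤ (s - τ) ^ (2 * ν - 1) := Real.rpow_nonneg (by linarith [hτ.2]) _
        rw [norm_mul, Real.norm_of_nonneg h0]
        exact mul_le_mul_of_nonneg_right (abs_pairing_le hprob (hD _ (hε1 n)) τ) h0
    have h := tendsto_nhds_unique (t1 s) (((hlim.const_mul (Real.Gamma (2 * ν))⁻¹).const_add 1).congr
      fun n => (hn n).symm)
    rw [h]
    simp only [mul_assoc]
    rw [intervalIntegral.integral_const_mul]
    ring
  have hbd := fun M => abs_sub_mittagLefflerSum_le hα (sq_nonneg η) hui (fun s _ => hub s) heq M t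
    ⟨ht, le_rfl⟩
  have hpow : t ^ (2 * ν) = (t ^ ν) ^ 2 := by
    rw [mul_comm, Real.rpow_mul ht.le, Real.rpow_two]
  have h1 : Tendsto (fun M => u t - mittagLefflerSum (2 * ν) (-η ^ 2 * t ^ (2 * ν)) M) atTop
      (𝓝 0) := by
    refine squeeze_zero_norm hbd ?_
    -- The error terms of order `2ν` are the even-indexed terms of the null sequence of order `ν`.
    have := ((tendsto_pow_div_Gamma hν0 hν1 (η * t ^ ν)).comp
      (tendsto_id.const_mul_atTop' (two_pos (α := ℕ)))).const_mul 1
    rw [mul_zero] at this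
    refine this.congr fun M => ?_
    simp only [Function.comp_apply, id]
    rw [pow_mul, hpow, mul_pow η]
    push_cast
    ring_nf
  have h2 := (tendsto_mittagLefflerSum_two_mul hν0 hν1 (η * t ^ ν)).const_sub (u t)
  rw [show -(η * t ^ ν) ^ 2 = -η ^ 2 * t ^ (2 * ν) by rw [hpow]; ring] at h2
  rw [sub_eq_zero.1 (tendsto_nhds_unique h2 h1)]
  simp only [mul_assoc]

end

/-! ### Measures on the half-line are determined by their cosine transform -/

/-- Symmetrising `m` gives a measure with characteristic function `2 ∫ cos (ηx) dm`, hence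
determined by the data. Pushing it forward under `|·|` returns `2m`, because `m` lives on the
half-line. -/
theorem measure_ext_of_integral_cos {m₁ m₂ : Measure ℝ} [IsFiniteMeasure m₁] [IsFiniteMeasure m₂]
    (h₁ : ∀ᵐ x ∂m₁, 0 ≤ x) (h₂ : ∀ᵐ x ∂m₂, 0 ≤ x)
    (h : ∀ η : ℝ, ∫ x, Real.cos (η * x) ∂m₁ = ∫ x, Real.cos (η * x) ∂m₂) : m₁ = m₂ := by
  have hchar : ∀ (m : Measure ℝ) [IsFiniteMeasure m] (η : ℝ), charFun (m + m.map (- ·)) η =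
      ((2 * ∫ x, Real.cos (η * x) ∂m : ℝ) : ℂ) := by
    intro m _ η
    have hi : ∀ η : ℝ, Integrable (fun x : ℝ => Complex.exp (η * x * Complex.I)) m := fun η => by
      refine Integrable.of_bound (Continuous.aestronglyMeasurable (by fun_prop)) 1
        (ae_of_all _ fun x => ?_)
      rw [← Complex.ofReal_mul, Complex.norm_exp_ofReal_mul_I]
    have hi2 : Integrable (fun x : ℝ => Complex.exp (η * (-x : ℝ) * Complex.I)) m := by
      refine (hi (-η)).congr (ae_of_all _ fun x => ?_)
      simp
    rw [charFun_apply_real, integral_add_measure (hi η), integral_map (by fun_prop) 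
      (Continuous.aestronglyMeasurable (by fun_prop)), ← integral_add (hi η) hi2,
      ← integral_const_mul, ← integral_complex_ofReal]
    · refine integral_congr_ae (ae_of_all _ fun x => ?_)
      simp only
      push_cast
      rw [Complex.cos]
      ring_nf
    · rw [integrable_map_measure (Continuous.aestronglyMeasurable (by fun_prop)) (by fun_prop)]
      exact hi2
  have hsym : m₁ + m₁.map (- ·) = m₂ + m₂.map (- ·) :=
    Measure.ext_of_charFun (by ext η; rw [hchar, hchar, h])
  have habs : ∀ (m : Measure ℝ), (∀ᵐ x ∂m, 0 ≤ x) → (m + m.map (- ·)).map (|·|) = m + m := by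
    intro m hm
    have e : m.map (|·|) = m := by
      rw [Measure.map_congr (hm.mono fun x hx => abs_of_nonneg hx)]
      exact Measure.map_id
    rw [Measure.map_add _ _ (by fun_prop), Measure.map_map (by fun_prop) (by fun_prop)]
    have e2 : (fun x : ℝ => |x|) ∘ (fun x => -x) = fun x => |x| := by ext x; simp
    rw [e2, e]
  have h2 : m₁ + m₁ = m₂ + m₂ := by rw [← habs m₁ h₁, ← habs m₂ h₂, hsym]
  ext s hs
  have h3 : m₁ s + m₁ s = m₂ s + m₂ s := by rw [← Measure.add_apply, h2, Measure.add_apply]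
  rw [← two_mul, ← two_mul] at h3
  exact (ENNReal.mul_right_inj (by simp) (by simp)).1 h3

theorem IsFractionalDiffusionLaw.integral_eq_wrightMean {ν : ℝ} {μ : ℝ≥0 → Measure ℝ≥0}
    (hν0 : 0 < ν) (hν1 : ν ≤ 1) (hμ : IsFractionalDiffusionLaw ν μ) {t : ℝ≥0} (ht : 0 < t)
    {f : ℝ → ℝ} (hf : Continuous f) {C : ℝ} (hb : ∀ x, 0 ≤ x → |f x| ≤ C) :
    ∫ x : ℝ≥0, f x ∂μ t = wrightMean ν fun ξ => f ((t : ℝ) ^ ν * ξ) := by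
  have := isFiniteMeasure_wrightLaw hν0 hν1
  have := isFiniteMeasure_wrightNeg hν0 hν1
  have := hμ.isProbabilityMeasure t
  set c := (t : ℝ) ^ ν with hc
  have hc0 : 0 ≤ c := Real.rpow_nonneg t.2 _
  -- The negative part is moved to the other side, so that uniqueness is applied to nonnegative
  -- measures only.
  have key : (μ t).map ((↑) : ℝ≥0 → ℝ) + (wrightNeg ν).map (c * ·) = (wrightLaw ν).map (c * ·) := by
    have hcoe : ∀ᵐ x ∂(μ t).map ((↑) : ℝ≥0 → ℝ), 0 ≤ x := by
      rw [ae_map_iff (by fun_prop) measurableSet_Ici]; simp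
    have hpos : ∀ m : Measure ℝ, (∀ᵐ x ∂m, 0 < x) → ∀ᵐ x ∂m.map (c * ·), 0 ≤ x := fun m hm => by
      rw [ae_map_iff (by fun_prop) measurableSet_Ici]
      exact hm.mono fun x hx => mul_nonneg hc0 hx.le
    refine measure_ext_of_integral_cos ?_ (hpos _ (ae_wrightLaw_pos ν)) fun η => ?_
    · rw [ae_add_measure_iff]
      exact ⟨hcoe, hpos _ (ae_wrightNeg_pos ν)⟩
    · have hi : ∀ m : Measure ℝ, [IsFiniteMeasure m] → Integrable (fun x => Real.cos (η * x)) m :=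
        fun m _ => Integrable.of_bound (Continuous.aestronglyMeasurable (by fun_prop)) 1
          (ae_of_all _ fun x => Real.abs_cos_le_one _)
      have h := hμ.pairing_cos hν0 hν1 η (t := t) (by exact_mod_cast ht)
      rw [pairing, Real.toNNReal_coe, wrightMean] at h
      have hm : Measurable fun x : ℝ => Real.cos (η * x) := by fun_prop
      rw [integral_add_measure (hi _) (hi _), integral_map (by fun_prop) hm.aestronglyMeasurable,
        integral_map (by fun_prop) hm.aestronglyMeasurable,
        integral_map (by fun_prop) hm.aestronglyMeasurable, h]
      ring
  have hi1 : Integrable f ((μ t).map ((↑) : ℝ≥0 → ℝ)) := by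
    rw [integrable_map_measure hf.aestronglyMeasurable (by fun_prop)]
    exact Integrable.of_bound (Continuous.aestronglyMeasurable (by fun_prop)) C
      (ae_of_all _ fun x => hb x x.2)
  have hi2 : Integrable f ((wrightNeg ν).map (c * ·)) := by
    rw [integrable_map_measure hf.aestronglyMeasurable (by fun_prop)]
    exact integrable_wrightNeg_of_bound hν0 hν1 (Continuous.stronglyMeasurable (by fun_prop))
      (fun ξ hξ => hb _ (mul_nonneg hc0 hξ.le))
  have h := integral_add_measure hi1 hi2
  rw [key, integral_map (by fun_prop) hf.aestronglyMeasurable,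
    integral_map (by fun_prop) hf.aestronglyMeasurable,
    integral_map (by fun_prop) hf.aestronglyMeasurable] at h
  rw [wrightMean, h]
  ring

/-! ### Poisson and geometric weights -/

/-- The probability that a Poisson variable with mean `x` equals `k`. -/
noncomputable def poissonWeight (k : ℕ) (x : ℝ) : ℝ := Real.exp (-x) * x ^ k / k.factorial

/-- The probability that a classical Yule process with rate `1` is at `k + 1` at time `x`. -/
noncomputable def yuleWeight (k : ℕ) (x : ℝ) : ℝ := Real.exp (-x) * (1 - Real.exp (-x)) ^ k

theorem continuous_poissonWeight (k : ℕ) : Continuous (poissonWeight k) := by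
  unfold poissonWeight; fun_prop

theorem continuous_yuleWeight (k : ℕ) : Continuous (yuleWeight k) := by
  unfold yuleWeight; fun_prop

theorem poissonWeight_nonneg {x : ℝ} (hx : 0 ≤ x) (k : ℕ) : 0 ≤ poissonWeight k x := by
  unfold poissonWeight; positivity

theorem poissonWeight_le_one {x : ℝ} (hx : 0 ≤ x) (k : ℕ) : poissonWeight k x ≤ 1 := by
  have h := Real.pow_div_factorial_le_exp x hx k
  calc poissonWeight k x = Real.exp (-x) * (x ^ k / k.factorial) := by rw [poissonWeight]; ring
    _ ≤ Real.exp (-x) * Real.exp x := by gcongr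
    _ = 1 := by rw [← Real.exp_add]; simp

theorem abs_yuleWeight_le {x : ℝ} (hx : 0 ≤ x) (k : ℕ) : |yuleWeight k x| ≤ 1 :=
  abs_exp_mul_one_sub_exp_pow_le hx k

/-- The exponents combine to `-ω e^x`, leaving a Gamma integral: an exponential mixture of Poisson
laws is geometric with parameter `e^{-x}`. -/
theorem integral_exp_mul_poissonWeight (k : ℕ) (x : ℝ) :
    ∫ ω in Ioi (0 : ℝ), Real.exp (-ω) * poissonWeight k (ω * (Real.exp x - 1)) =
      yuleWeight k x := by
  have h := Real.integral_rpow_mul_exp_neg_mul_Ioi (a := k + 1) (by positivity) (Real.exp_pos x)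
  have e : ∫ ω in Ioi (0 : ℝ), Real.exp (-ω) * poissonWeight k (ω * (Real.exp x - 1)) =
      ∫ ω in Ioi (0 : ℝ), (Real.exp x - 1) ^ k / k.factorial *
        (ω ^ ((k : ℝ) + 1 - 1) * Real.exp (-(Real.exp x * ω))) := by
    refine setIntegral_congr_fun measurableSet_Ioi fun ω _ => ?_
    rw [add_sub_cancel_right, Real.rpow_natCast, poissonWeight,
      show -(Real.exp x * ω) = -ω + -(ω * (Real.exp x - 1)) by ring, Real.exp_add, mul_pow]
    ring
  rw [e, integral_const_mul, h, Real.Gamma_nat_eq_factorial, yuleWeight, Real.exp_neg,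
    show (k : ℝ) + 1 = (k + 1 : ℕ) by push_cast; rfl, Real.rpow_natCast, one_div, pow_succ]
  have h1 := (Real.exp_pos x).ne'
  have e2 : 1 - (Real.exp x)⁻¹ = (Real.exp x - 1) * (Real.exp x)⁻¹ := by field_simp
  rw [e2, mul_pow]
  have := k.factorial_ne_zero
  field_simp

theorem integral_intensity (ω lam ξ a b : ℝ) :
    ∫ u in a..b, ω * lam * ξ * Real.exp (lam * ξ * u) =
      ω * (Real.exp (lam * ξ * b) - Real.exp (lam * ξ * a)) := by
  have hd : ∀ u ∈ uIcc a b, HasDerivAt (fun u => ω * Real.exp (lam * ξ * u))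
      (ω * lam * ξ * Real.exp (lam * ξ * u)) u := fun u _ => by
    have := ((hasDerivAt_id u).const_mul (lam * ξ)).exp.const_mul ω
    refine this.congr_deriv ?_
    simp only [id]; ring
  rw [intervalIntegral.integral_eq_sub_of_hasDerivAt hd
    (Continuous.intervalIntegrable (by fun_prop) _ _)]
  ring

theorem integral_expMeasure_one {f : ℝ → ℝ} :
    ∫ ω, f ω ∂expMeasure 1 = ∫ ω in Ioi (0 : ℝ), Real.exp (-ω) * f ω := by
  have h : expMeasure 1 = (volume.restrict (Ioi 0)).withDensity
      fun ω => ENNReal.ofReal (Real.exp (-ω)) := by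
    have h1 : expMeasure 1 = volume.withDensity (exponentialPDF 1) := rfl
    rw [h1, ← withDensity_indicator measurableSet_Ioi]
    refine withDensity_congr_ae ?_
    -- The two densities differ at `0`, where the exponential density is `1`; that point is null.
    have h0 : ∀ᵐ x : ℝ, x ≠ 0 := by simp [ae_iff, measure_singleton]
    filter_upwards [h0] with x hx
    rcases lt_or_gt_of_ne hx with h | h
    · rw [exponentialPDF_of_neg h, indicator_of_notMem (by simpa using h.le)]
    · rw [exponentialPDF_of_nonneg h.le, indicator_of_mem (by simpa using h)]
      simp
  rw [h, integral_withDensity_eq_integral_toReal_smul (by fun_prop) (by simp)]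
  refine integral_congr_ae (ae_of_all _ fun ω => ?_)
  simp only [smul_eq_mul]
  rw [ENNReal.toReal_ofReal (Real.exp_pos _).le]

theorem ae_expMeasure_pos : ∀ᵐ ω ∂expMeasure 1, 0 < ω := by
  have h1 : expMeasure 1 = volume.withDensity (exponentialPDF 1) := rfl
  have hm : Measurable (exponentialPDF 1) := (measurable_exponentialPDFReal 1).ennreal_ofReal
  rw [h1, ae_withDensity_iff hm]
  have h0 : ∀ᵐ x : ℝ, x ≠ 0 := by simp [ae_iff, measure_singleton]
  filter_upwards [h0] with x hx hne
  by_contra h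
  exact hne (exponentialPDF_of_neg (lt_of_le_of_ne (not_lt.1 h) hx))

/-! ### One-dimensional distributions of mixed Poisson processes -/

section
variable {S : Type*} [MeasurableSpace S] {P : Measure S}

/-- Use the single increment over `[0, s]` and `N 0 = 0` almost surely; the `max` comes from
`toNNReal` in the Poisson mean. -/
theorem IsMixedPoissonProcess.measure_eq {E : Type*} [MeasurableSpace E] {Θ : S → E}
    {r : E → ℝ → ℝ} {N : ℝ≥0 → S → ℕ} (h : IsMixedPoissonProcess P Θ r N) (s : ℝ≥0) (k : ℕ) :
    P {w | N s w = k} = ∫⁻ θ, ENNReal.ofReal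
      (poissonWeight k (max (∫ u in (0 : ℝ)..s, r θ u) 0)) ∂(P.map Θ) := by
  have h1 := h.increments 1 ![0, s] (by
    intro i j hij
    fin_cases i <;> fin_cases j <;> simp at hij ⊢) (fun _ => k) univ MeasurableSet.univ
  have h2 : P {w | N s w = k} = P (Θ ⁻¹' univ ∩ {w | ∀ i : Fin 1,
      N ((![0, s] : Fin 2 → ℝ≥0) i.succ) w = N ((![0, s] : Fin 2 → ℝ≥0) i.castSucc) w + k}) := by
    refine measure_congr ?_
    filter_upwards [h.start] with w hw
    change (N s w = k) = (True ∧ ∀ i : Fin 1,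
      N ((![0, s] : Fin 2 → ℝ≥0) i.succ) w = N ((![0, s] : Fin 2 → ℝ≥0) i.castSucc) w + k)
    simp [hw]
  rw [h2, h1, Measure.restrict_univ]
  refine lintegral_congr fun θ => ?_
  simp [poissonMeasure_singleton, poissonWeight, Real.coe_toNNReal']

theorem IsMixedPoissonProcess.measureReal_eq [IsProbabilityMeasure P] {E : Type*}
    [MeasurableSpace E] {Θ : S → E} {r : E → ℝ → ℝ} {N : ℝ≥0 → S → ℕ}
    (h : IsMixedPoissonProcess P Θ r N) (s : ℝ≥0) (k : ℕ) {m : E → ℝ} (hm : Measurable m)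
    (hr : ∀ᵐ θ ∂P.map Θ, 0 ≤ m θ ∧ ∫ u in (0 : ℝ)..s, r θ u = m θ) :
    P.real {w | N s w = k} = ∫ θ, poissonWeight k (m θ) ∂(P.map Θ) := by
  rw [measureReal_def, h.measure_eq, integral_eq_lintegral_of_nonneg_ae
    (hr.mono fun θ hθ => poissonWeight_nonneg hθ.1 k)
    ((continuous_poissonWeight k).measurable.comp hm).aestronglyMeasurable]
  congr 1
  refine lintegral_congr_ae (hr.mono fun θ hθ => ?_)
  simp only
  rw [hθ.2, max_eq_left hθ.1]

theorem IsPoissonProcess.measureReal_eq [IsProbabilityMeasure P] {r : ℝ → ℝ} {N : ℝ≥0 → S → ℕ}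
    (h : IsPoissonProcess P r N) (s : ℝ≥0) (k : ℕ) {m : ℝ} (hm : 0 ≤ m)
    (hr : ∫ u in (0 : ℝ)..s, r u = m) : P.real {w | N s w = k} = poissonWeight k m := by
  rw [IsMixedPoissonProcess.measureReal_eq h s k (m := fun _ => m) measurable_const
    (ae_of_all _ fun _ => ⟨hm, hr⟩), integral_const]
  have : IsProbabilityMeasure (P.map fun _ : S => ()) :=
    Measure.isProbabilityMeasure_map measurable_const.aemeasurable
  simp

theorem exp_sub_one_nonneg {x : ℝ} (hx : 0 ≤ x) : 0 ≤ Real.exp x - 1 :=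
  sub_nonneg.2 (Real.one_le_exp hx)

theorem IsMixedPoissonProcess.measureReal_eq_yuleWeight [IsProbabilityMeasure P] {lam : ℝ}
    (hlam : 0 < lam) {Om : S → ℝ} {N : ℝ≥0 → S → ℕ} (hOm : P.map Om = expMeasure 1)
    (h : IsMixedPoissonProcess P Om (fun ω u => ω * lam * Real.exp (lam * u)) N) (s : ℝ≥0) (k : ℕ) :
    P.real {w | N s w = k} = yuleWeight k (lam * s) := by
  have hs : 0 ≤ lam * s := by positivity
  rw [h.measureReal_eq s k (m := fun ω => ω * (Real.exp (lam * s) - 1)) (by fun_prop), hOm,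
    integral_expMeasure_one, integral_exp_mul_poissonWeight]
  rw [hOm]
  filter_upwards [ae_expMeasure_pos] with ω hω
  refine ⟨mul_nonneg hω.le (exp_sub_one_nonneg hs), ?_⟩
  simpa using integral_intensity ω lam 1 0 s

/-! ### The mixed Poisson process with a Wright-distributed rate -/

theorem wrightMean_one {ν : ℝ} (h0 : 0 < ν) (h1 : ν ≤ 1) : wrightMean ν (fun _ => (1 : ℝ)) = 1 := by
  have h := tendsto_mittagLefflerSum h0 h1 0
  simp only [zero_mul, Real.exp_zero] at h
  refine tendsto_nhds_unique h (tendsto_const_nhds.congr' ?_)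
  filter_upwards [eventually_ge_atTop 1] with M hM
  obtain ⟨m, rfl⟩ := Nat.exists_eq_add_of_le' hM
  rw [mittagLefflerSum, Finset.sum_range_succ']
  simp

/-- The signed measure has total mass `1`, so if its positive part already has mass `1`, nothing is
left for the negative part. -/
theorem wrightNeg_eq_zero {ν : ℝ} (h0 : 0 < ν) (h1 : ν ≤ 1) [IsProbabilityMeasure (wrightLaw ν)] :
    wrightNeg ν = 0 := by
  have := isFiniteMeasure_wrightNeg h0 h1
  have h := wrightMean_one h0 h1
  rw [wrightMean, integral_const, integral_const] at h
  simp only [smul_eq_mul, mul_one, probReal_univ, sub_eq_self] at h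
  rwa [measureReal_eq_zero_iff, Measure.measure_univ_eq_zero] at h

/-- The existence of `Xi` with law `wrightLaw ν` makes that measure a probability, so the signed
mean is a true expectation; integrating out `Om` first gives the geometric weight. -/
theorem IsMixedPoissonProcess.measureReal_eq_wrightMean [IsProbabilityMeasure P] {ν lam : ℝ}
    (h0 : 0 < ν) (h1 : ν ≤ 1) (hlam : 0 < lam) {Om Xi : S → ℝ} {N : ℝ≥0 → S → ℕ}
    (hOm : P.map Om = expMeasure 1) (hXi : P.map Xi = wrightLaw ν) (hind : IndepFun Om Xi P)
    (h : IsMixedPoissonProcess P (fun w => (Om w, Xi w))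
      (fun θ u => θ.1 * lam * θ.2 * Real.exp (lam * θ.2 * u)) N) (s : ℝ≥0) (k : ℕ) :
    P.real {w | N s w = k} = wrightMean ν fun ξ => yuleWeight k (lam * (s * ξ)) := by
  have hmO : Measurable Om := measurable_fst.comp h.measurable_param
  have hmX : Measurable Xi := measurable_snd.comp h.measurable_param
  have hpL : IsProbabilityMeasure (wrightLaw ν) := by
    rw [← hXi]; exact Measure.isProbabilityMeasure_map hmX.aemeasurable
  have hpE : IsProbabilityMeasure (expMeasure 1) := isProbabilityMeasure_expMeasure one_pos
  have hprod : P.map (fun w => (Om w, Xi w)) = (expMeasure 1).prod (wrightLaw ν) := by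
    rw [(indepFun_iff_map_prod_eq_prod_map_map hmO.aemeasurable hmX.aemeasurable).1 hind, hOm, hXi]
  have hae : ∀ᵐ θ ∂(expMeasure 1).prod (wrightLaw ν), 0 < θ.1 ∧ 0 < θ.2 :=
    (Measure.quasiMeasurePreserving_fst.ae ae_expMeasure_pos).and
      (Measure.quasiMeasurePreserving_snd.ae (ae_wrightLaw_pos ν))
  have hm : Measurable fun θ : ℝ × ℝ => θ.1 * (Real.exp (lam * (s * θ.2)) - 1) := by fun_prop
  have hnn : ∀ᵐ θ ∂(expMeasure 1).prod (wrightLaw ν),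
      0 ≤ θ.1 * (Real.exp (lam * (s * θ.2)) - 1) := hae.mono fun θ hθ =>
    mul_nonneg hθ.1.le (exp_sub_one_nonneg (mul_nonneg hlam.le (mul_nonneg s.2 hθ.2.le)))
  rw [h.measureReal_eq s k hm, hprod, integral_prod_symm]
  · rw [wrightMean, wrightNeg_eq_zero h0 h1, integral_zero_measure, sub_zero]
    refine integral_congr_ae (ae_of_all _ fun ξ => ?_)
    simp only
    rw [integral_expMeasure_one, integral_exp_mul_poissonWeight]
  · refine Integrable.of_bound ((continuous_poissonWeight k).measurable.comp hm).aestronglyMeasurable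
      1 (hnn.mono fun θ hθ => ?_)
    rw [Real.norm_of_nonneg (poissonWeight_nonneg hθ k)]
    exact poissonWeight_le_one hθ k
  · rw [hprod]
    filter_upwards [hnn] with θ hθ
    refine ⟨hθ, ?_⟩
    rw [integral_intensity, mul_zero, Real.exp_zero]
    ring_nf

/-! ### Random time change -/

/-- The smallest multiple of `1 / (n + 1)` that is larger than `x`. -/
noncomputable def gridAbove (n : ℕ) (x : ℝ≥0) : ℝ≥0 := (⌊x * (n + 1)⌋₊ + 1) / (n + 1)

theorem lt_gridAbove (n : ℕ) (x : ℝ≥0) : x < gridAbove n x := by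
  rw [gridAbove, lt_div_iff₀ (by positivity)]
  exact Nat.lt_floor_add_one _

theorem gridAbove_le (n : ℕ) (x : ℝ≥0) : gridAbove n x ≤ x + 1 / (n + 1) := by
  rw [gridAbove, div_le_iff₀ (by positivity), add_mul, one_div_mul_cancel (by positivity)]
  gcongr
  exact Nat.floor_le (by positivity)

theorem tendsto_gridAbove (x : ℝ≥0) : Tendsto (fun n => gridAbove n x) atTop (𝓝[≥] x) := by
  refine tendsto_nhdsWithin_iff.2 ⟨?_, Eventually.of_forall fun n => (lt_gridAbove n x).le⟩
  refine tendsto_of_tendsto_of_tendsto_of_le_of_le tendsto_const_nhds ?_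
    (fun n => (lt_gridAbove n x).le) fun n => gridAbove_le n x
  have : Tendsto (fun n : ℕ => 1 / ((n : ℝ≥0) + 1)) atTop (𝓝 0) :=
    tendsto_one_div_add_atTop_nhds_zero_nat
  simpa using this.const_add x

/-- Independence is available only at fixed times, so `T` is replaced by grid times strictly above
it. Conditioning on countably many values gives the formula there, and right-continuity of `N`
together with continuity of `g` passes to the limit. -/
theorem measureReal_time_change [IsProbabilityMeasure P] {N : ℝ≥0 → S → ℕ} {T : S → ℝ≥0}
    (hN : ∀ s, Measurable (N s)) (hT : Measurable T) (hind : ∀ s, IndepFun T (N s) P)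
    (hpath : ∀ᵐ w ∂P, ∀ t, ContinuousWithinAt (fun s => N s w) (Ici t) t) (k : ℕ) {g : ℝ≥0 → ℝ}
    (hg : Continuous g) (hg1 : ∀ s, |g s| ≤ 1) (hNg : ∀ s, P.real {w | N s w = k} = g s) :
    P.real {w | N (T w) w = k} = ∫ x, g x ∂(P.map T) := by
  set A : ℕ → Set S := fun n => {w | N (gridAbove n (T w)) w = k} with hA
  set F : ℕ → S → ℕ := fun n w => ⌊T w * (n + 1)⌋₊ with hF
  have hFm : ∀ n, Measurable (F n) := fun n => Nat.measurable_floor.comp (by fun_prop)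
  set G : ℕ → ℕ → ℝ≥0 := fun n m => ((m : ℝ≥0) + 1) / (n + 1) with hG
  have hAU : ∀ n, A n = ⋃ m, F n ⁻¹' {m} ∩ {w | N (G n m) w = k} := by
    intro n; ext w
    simp [hA, hF, hG, gridAbove]
  have hcm : ∀ s, MeasurableSet {w | N s w = k} := fun s => hN s (measurableSet_singleton k)
  have hAm : ∀ n, MeasurableSet (A n) := fun n => by
    rw [hAU]
    exact .iUnion fun m => (hFm n (measurableSet_singleton m)).inter (hcm _)
  have hPA : ∀ n, P.real (A n) = ∫ x, g (gridAbove n x) ∂(P.map T) := by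
    intro n
    have hdisj : Pairwise (Function.onFun Disjoint fun m => F n ⁻¹' {m} ∩ {w | N (G n m) w = k}) := by
      intro i j hij
      refine Set.disjoint_left.2 fun w h1 h2 => hij ?_
      exact (show F n w = i from h1.1).symm.trans h2.1
    have hgm : Measurable fun x => g (gridAbove n x) := by
      refine hg.measurable.comp ?_
      unfold gridAbove
      have : Measurable fun x : ℝ≥0 => ⌊x * (n + 1)⌋₊ := Nat.measurable_floor.comp (by fun_prop)
      have h2 : Measurable fun m : ℕ => ((m : ℝ≥0) + 1) / (n + 1) := measurable_from_top
      exact h2.comp this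
    have hmul : ∀ m, P.real (F n ⁻¹' {m} ∩ {w | N (G n m) w = k}) =
        ∫ w in F n ⁻¹' {m}, g (gridAbove n (T w)) ∂P := by
      intro m
      have h1 : IndepFun (F n) (N (G n m)) P :=
        (hind (G n m)).comp (φ := fun x : ℝ≥0 => ⌊x * (n + 1)⌋₊)
          (Nat.measurable_floor.comp (by fun_prop)) measurable_id
      have h2 := h1.measure_inter_preimage_eq_mul {m} {k} (measurableSet_singleton m)
        (measurableSet_singleton k)
      have h3 : P.real (F n ⁻¹' {m} ∩ {w | N (G n m) w = k}) =
          P.real (F n ⁻¹' {m}) * P.real {w | N (G n m) w = k} := by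
        simp only [measureReal_def]
        rw [← ENNReal.toReal_mul]
        exact congrArg ENNReal.toReal h2
      rw [h3, hNg, ← smul_eq_mul, ← setIntegral_const]
      refine setIntegral_congr_fun (hFm n (measurableSet_singleton m)) fun w hw => ?_
      have hw : ⌊T w * (n + 1)⌋₊ = m := hw
      simp only [hG, gridAbove, hw]
    have hint : Integrable (fun w => g (gridAbove n (T w))) P :=
      Integrable.of_bound (hgm.comp hT).aestronglyMeasurable 1 (ae_of_all _ fun w => hg1 _)
    have hU : ⋃ m, F n ⁻¹' {m} = univ := by ext w; simp
    rw [integral_map hT.aemeasurable hgm.aestronglyMeasurable, ← setIntegral_univ, ← hU,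
      integral_iUnion (fun m => hFm n (measurableSet_singleton m)) (fun i j hij => by
        refine Set.disjoint_left.2 fun w h1 h2 => hij ?_
        exact (show F n w = i from h1).symm.trans h2) hint.integrableOn, measureReal_def, hAU,
      measure_iUnion hdisj fun m => (hFm n (measurableSet_singleton m)).inter (hcm _),
      ENNReal.tsum_toReal_eq fun m => measure_ne_top _ _]
    exact tsum_congr hmul
  have hev : ∀ᵐ w ∂P, ∀ᶠ n in atTop, (w ∈ A n ↔ N (T w) w = k) := by
    filter_upwards [hpath] with w hw
    have h1 := (hw (T w)).tendsto.comp (tendsto_gridAbove (T w))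
    -- In the discrete space `ℕ`, right-continuity means eventual equality along the grid.
    rw [nhds_discrete, tendsto_pure] at h1
    filter_upwards [h1] with n hn
    rw [hA, mem_ofPred_eq, ← hn]; rfl
  -- The event `N (T w) w = k` is not known to be measurable; this limit inferior is, and agrees
  -- with it almost surely.
  set A' : Set S := {w | ∀ᶠ n in atTop, w ∈ A n} with hA'
  have hA'm : MeasurableSet A' := by
    have : A' = ⋃ n, ⋂ i, ⋂ (_ : n ≤ i), A i := by
      ext w; simp [hA', eventually_atTop]
    rw [this]
    exact .iUnion fun n => .iInter fun i => .iInter fun _ => hAm i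
  have hAA' : ∀ᵐ w ∂P, (w ∈ A' ↔ N (T w) w = k) := by
    filter_upwards [hev] with w hw
    constructor
    · intro h
      obtain ⟨n, h1, h2⟩ := (hw.and h).exists
      exact h1.1 h2
    · intro h
      exact hw.mono fun n hn => hn.2 h
  have t1 : Tendsto (fun n => P.real (A n)) atTop (𝓝 (P.real A')) := by
    refine (ENNReal.tendsto_toReal (measure_ne_top _ _)).comp
      (tendsto_measure_of_ae_tendsto_indicator_of_isFiniteMeasure atTop hA'm hAm ?_)
    filter_upwards [hev, hAA'] with w h1 h2
    exact h1.mono fun n hn => hn.trans h2.symm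
  have t2 : Tendsto (fun n => ∫ x, g (gridAbove n x) ∂(P.map T)) atTop
      (𝓝 (∫ x, g x ∂(P.map T))) := by
    have : IsProbabilityMeasure (P.map T) := Measure.isProbabilityMeasure_map hT.aemeasurable
    refine tendsto_integral_of_dominated_convergence (fun _ => 1) (fun n => ?_)
      (integrable_const 1) (fun n => ae_of_all _ fun x => hg1 _) (ae_of_all _ fun x => ?_)
    · refine (hg.measurable.comp ?_).aestronglyMeasurable
      have : Measurable fun x : ℝ≥0 => ⌊x * (n + 1)⌋₊ := Nat.measurable_floor.comp (by fun_prop)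
      have h2 : Measurable fun m : ℕ => ((m : ℝ≥0) + 1) / (n + 1) := measurable_from_top
      exact h2.comp this
    · exact (hg.tendsto x).comp ((tendsto_gridAbove x).mono_right nhdsWithin_le_nhds)
  have h3 : P.real {w | N (T w) w = k} = P.real A' :=
    measureReal_congr (hAA'.mono fun w hw => propext hw.symm)
  rw [h3]
  exact tendsto_nhds_unique t1 (t2.congr fun n => (hPA n).symm)

end

/-! ### Representations of the state probabilities -/

/-- The Poisson weight is at most `1`, so `|W(-ξ)| e^{-ω}` is an integrable majorant. -/
theorem integrable_poissonWeight_mul_wrightW {ν : ℝ} (h0 : 0 < ν) (h1 : ν < 1) {c : ℝ} (hc : 0 ≤ c)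
    (k : ℕ) : Integrable (fun z : ℝ × ℝ =>
      Real.exp (-z.2) * poissonWeight k (z.2 * (Real.exp (c * z.1) - 1)) * wrightW ν (-z.1))
      ((volume.restrict (Ioi 0)).prod (volume.restrict (Ioi 0))) := by
  have he : IntegrableOn (fun ω : ℝ => Real.exp (-ω)) (Ioi 0) := by
    simpa using integrableOn_exp_neg_Ioi 0
  have hd := (integrableOn_wrightW h0 h1).mul_prod he
  refine hd.mono ?_ ?_
  · have h2 : Measurable fun z : ℝ × ℝ => wrightW ν (-z.1) :=
      (measurable_wrightW_neg h0 h1).comp measurable_fst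
    have h3 : Measurable fun z : ℝ × ℝ => poissonWeight k (z.2 * (Real.exp (c * z.1) - 1)) :=
      (continuous_poissonWeight k).measurable.comp (by fun_prop)
    exact ((Measurable.mul (by fun_prop) h3).mul h2).aestronglyMeasurable
  · have hp : ∀ᵐ x ∂(volume.restrict (Ioi (0 : ℝ))), 0 < x := ae_restrict_mem measurableSet_Ioi
    filter_upwards [Measure.quasiMeasurePreserving_fst.ae hp,
      Measure.quasiMeasurePreserving_snd.ae hp] with z hz1 hz2
    have hx : 0 ≤ z.2 * (Real.exp (c * z.1) - 1) :=
      mul_nonneg hz2.le (exp_sub_one_nonneg (mul_nonneg hc hz1.le))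
    rw [norm_mul, norm_mul, norm_mul, mul_comm ‖wrightW ν (-z.1)‖]
    refine mul_le_mul_of_nonneg_right ?_ (norm_nonneg _)
    refine mul_le_of_le_one_right (norm_nonneg _) ?_
    rw [Real.norm_of_nonneg (poissonWeight_nonneg hx k)]
    exact poissonWeight_le_one hx k

theorem wrightMean_yuleWeight {ν : ℝ} (h0 : 0 < ν) (h1 : ν < 1) {c : ℝ} (hc : 0 ≤ c) (k : ℕ) :
    wrightMean ν (fun ξ => yuleWeight k (c * ξ)) = ∫ ξ in Ioi (0 : ℝ), ∫ ω in Ioi (0 : ℝ),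
      Real.exp (-ω) * poissonWeight k (ω * (Real.exp (c * ξ) - 1)) * wrightW ν (-ξ) := by
  have hm : Measurable fun ξ => yuleWeight k (c * ξ) :=
    (continuous_yuleWeight k).measurable.comp (by fun_prop)
  rw [wrightMean_eq_integral h0 h1 hm.aestronglyMeasurable]
  · refine integral_congr_ae (ae_of_all _ fun ξ => ?_)
    simp only [smul_eq_mul]
    rw [integral_mul_const, integral_exp_mul_poissonWeight, mul_comm]
  · refine Integrable.mono (integrableOn_wrightW h0 h1)
      ((measurable_wrightW_neg h0 h1).mul hm).aestronglyMeasurable ?_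
    filter_upwards [ae_restrict_mem measurableSet_Ioi] with ξ hξ
    rw [norm_smul]
    exact mul_le_of_le_one_right (norm_nonneg _) (abs_yuleWeight_le (mul_nonneg hc (le_of_lt hξ)) k)

/-- Fubini, then the substitution `s = τ ξ`, which creates the factor `1 / τ`. -/
theorem wrightMean_yuleWeight_swap {ν : ℝ} (h0 : 0 < ν) (h1 : ν < 1) {lam τ : ℝ} (hlam : 0 < lam)
    (hτ : 0 < τ) (k : ℕ) :
    wrightMean ν (fun ξ => yuleWeight k (lam * τ * ξ)) = ∫ ω in Ioi (0 : ℝ), ∫ s in Ioi (0 : ℝ),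
      Real.exp (-ω) * poissonWeight k (ω * (Real.exp (lam * s) - 1)) *
        (1 / τ * wrightW ν (-(s / τ))) := by
  have hc : 0 ≤ lam * τ := by positivity
  rw [wrightMean_yuleWeight h0 h1 hc,
    integral_integral_swap (integrable_poissonWeight_mul_wrightW h0 h1 hc k)]
  refine integral_congr_ae (ae_of_all _ fun ω => ?_)
  have h := integral_comp_mul_left_Ioi (fun s => Real.exp (-ω) *
    poissonWeight k (ω * (Real.exp (lam * s) - 1)) * (1 / τ * wrightW ν (-(s / τ)))) 0 hτ
  rw [mul_zero, smul_eq_mul, eq_inv_mul_iff_mul_eq₀ hτ.ne', ← integral_const_mul] at h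
  refine Eq.trans ?_ h
  refine integral_congr_ae (ae_of_all _ fun ξ => ?_)
  simp only
  rw [mul_div_cancel_left₀ _ hτ.ne', ← mul_assoc lam]
  field_simp

theorem IsFractionalDiffusionLaw.integral_yuleWeight {ν lam : ℝ} (h0 : 0 < ν) (h1 : ν ≤ 1)
    (hlam : 0 < lam) {μ : ℝ≥0 → Measure ℝ≥0} (hμ : IsFractionalDiffusionLaw ν μ) {t : ℝ≥0}
    (ht : 0 < t) (k : ℕ) :
    ∫ s : ℝ≥0, yuleWeight k (lam * s) ∂μ t =
      wrightMean ν fun ξ => yuleWeight k (lam * ((t : ℝ) ^ ν * ξ)) :=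
  hμ.integral_eq_wrightMean h0 h1 ht (f := fun x => yuleWeight k (lam * x))
    ((continuous_yuleWeight k).comp (by fun_prop)) (C := 1)
    fun x hx => abs_yuleWeight_le (by positivity) k

theorem integral_exp_mul_integral_poissonWeight {lam : ℝ} (hlam : 0 < lam) (μ : Measure ℝ≥0)
    [IsFiniteMeasure μ] (k : ℕ) :
    ∫ ω in Ioi (0 : ℝ), Real.exp (-ω) *
        ∫ s : ℝ≥0, poissonWeight k (ω * (Real.exp (lam * s) - 1)) ∂μ =
      ∫ s : ℝ≥0, yuleWeight k (lam * s) ∂μ := by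
  simp_rw [← integral_const_mul]
  rw [integral_integral_swap]
  · simp_rw [integral_exp_mul_poissonWeight]
  · have he : IntegrableOn (fun ω : ℝ => Real.exp (-ω)) (Ioi 0) := by
      simpa using integrableOn_exp_neg_Ioi 0
    have hd := he.mul_prod (integrable_const (μ := μ) (1 : ℝ))
    refine hd.mono ?_ ?_
    · have h3 : Measurable fun z : ℝ × ℝ≥0 =>
          poissonWeight k (z.1 * (Real.exp (lam * z.2) - 1)) :=
        (continuous_poissonWeight k).measurable.comp (by fun_prop)
      exact (Measurable.mul (by fun_prop) h3).aestronglyMeasurable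
    · have hp : ∀ᵐ x ∂(volume.restrict (Ioi (0 : ℝ))), 0 < x := ae_restrict_mem measurableSet_Ioi
      filter_upwards [Measure.quasiMeasurePreserving_fst.ae hp] with z hz
      have hx : 0 ≤ z.1 * (Real.exp (lam * z.2) - 1) :=
        mul_nonneg hz.le (exp_sub_one_nonneg (by positivity))
      simp only [Function.uncurry, mul_one, norm_mul]
      refine mul_le_of_le_one_right (norm_nonneg _) ?_
      rw [Real.norm_of_nonneg (poissonWeight_nonneg hx k)]
      exact poissonWeight_le_one hx k

theorem mainTheorem6 (ν lam : ℝ) (hν0 : 0 < ν) (hν1 : ν ≤ 1) (hlam : 0 < lam)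
    (p : ℕ → ℝ → ℝ) (hp : IsFractionalYule ν lam p)
    (t : ℝ≥0) (ht : 0 < t) (k : ℕ) (hk : 1 ≤ k) :
    -- the integral representations through the Wright density
    (ν < 1 →
      (p k t = ∫ ξ in Ioi (0 : ℝ), ∫ ω in Ioi (0 : ℝ),
          Real.exp (-(ω * Real.exp (lam * ξ * (t : ℝ) ^ ν))) * ω ^ (k - 1) *
            ((Real.exp (lam * ξ * (t : ℝ) ^ ν) - 1) ^ (k - 1) / ((k - 1).factorial : ℝ)) *
            wrightW ν (-ξ)) ∧
      (p k t = ∫ ξ in Ioi (0 : ℝ), ∫ ω in Ioi (0 : ℝ),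
          Real.exp (-(ω * (Real.exp (lam * ξ * (t : ℝ) ^ ν) - 1))) * ω ^ (k - 1) *
            (Real.exp (lam * ξ * (t : ℝ) ^ ν) - 1) ^ (k - 1) / ((k - 1).factorial : ℝ) *
            Real.exp (-ω) * wrightW ν (-ξ)) ∧
      (p k t = ∫ ξ in Ioi (0 : ℝ), ∫ ω in Ioi (0 : ℝ),
          Real.exp (-∫ s in (0 : ℝ)..(t : ℝ) ^ ν, ω * lam * ξ * Real.exp (lam * ξ * s)) *
            (∫ s in (0 : ℝ)..(t : ℝ) ^ ν, ω * lam * ξ * Real.exp (lam * ξ * s)) ^ (k - 1) /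
            ((k - 1).factorial : ℝ) * Real.exp (-ω) * wrightW ν (-ξ)) ∧
      (Integrable (fun z : ℝ × ℝ =>
          Real.exp (-∫ s in (0 : ℝ)..(t : ℝ) ^ ν, z.2 * lam * z.1 * Real.exp (lam * z.1 * s)) *
            (∫ s in (0 : ℝ)..(t : ℝ) ^ ν, z.2 * lam * z.1 * Real.exp (lam * z.1 * s)) ^ (k - 1) /
            ((k - 1).factorial : ℝ) * Real.exp (-z.2) * wrightW ν (-z.1))
          ((volume.restrict (Ioi 0)).prod (volume.restrict (Ioi 0)))) ∧
      (p k t = ∫ ω in Ioi (0 : ℝ), ∫ s in Ioi (0 : ℝ),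
          Real.exp (-(ω * (Real.exp (lam * s) - 1))) * ω ^ (k - 1) *
            (Real.exp (lam * s) - 1) ^ (k - 1) / ((k - 1).factorial : ℝ) *
            Real.exp (-ω) * (1 / (t : ℝ) ^ ν * wrightW ν (-(s / (t : ℝ) ^ ν))))) ∧
    -- the mixed Poisson process with intensity `Ω λ Ξ e^{λ Ξ u}` at time `t ^ ν`
    (∀ {S : Type*} [MeasurableSpace S] (P : Measure S) [IsProbabilityMeasure P]
        (Om Xi : S → ℝ) (N : ℝ≥0 → S → ℕ),
      P.map Om = expMeasure 1 → P.map Xi = wrightLaw ν → IndepFun Om Xi P →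
      IsMixedPoissonProcess P (fun w => (Om w, Xi w))
        (fun θ u => θ.1 * lam * θ.2 * Real.exp (lam * θ.2 * u)) N →
      P.real {w | N (t ^ ν) w = k - 1} = p k t) ∧
    -- Poisson processes with intensity `ω λ e^{λ u}` at the random time, averaged over `ω`
    (∀ {S : Type*} [MeasurableSpace S] (P : Measure S) [IsProbabilityMeasure P]
        (N : ℝ → ℝ≥0 → S → ℕ) (μ : ℝ≥0 → Measure ℝ≥0),
      (∀ ω : ℝ, 0 < ω → IsPoissonProcess P (fun u => ω * lam * Real.exp (lam * u)) (N ω)) →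
      IsFractionalDiffusionLaw ν μ →
      p k t = ∫ ω in Ioi (0 : ℝ), Real.exp (-ω) * ∫ s, P.real {w | N ω s w = k - 1} ∂(μ t)) ∧
    -- the mixed Poisson process with intensity `Ω λ e^{λ u}` at the random time `T`
    (∀ {S : Type*} [MeasurableSpace S] (P : Measure S) [IsProbabilityMeasure P]
        (Om : S → ℝ) (N : ℝ≥0 → S → ℕ) (T : S → ℝ≥0) (μ : ℝ≥0 → Measure ℝ≥0),
      P.map Om = expMeasure 1 →
      IsMixedPoissonProcess P Om (fun ω u => ω * lam * Real.exp (lam * u)) N →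
      IsFractionalDiffusionLaw ν μ → Measurable T → P.map T = μ t →
      IndepFun T (fun w => (Om w, fun s => N s w)) P →
      P.real {w | N (T w) w = k - 1} = p k t) := by
  obtain ⟨k, rfl⟩ := Nat.exists_eq_add_of_le' hk
  have hτ : (0 : ℝ) < (t : ℝ) ^ ν := Real.rpow_pos_of_pos ht ν
  have hY : p (k + 1) t = wrightMean ν fun ξ => yuleWeight k (lam * ((t : ℝ) ^ ν * ξ)) :=
    hp.eq_wrightMean hν0 hν1 hlam ht k
  have hY' : p (k + 1) t = wrightMean ν fun ξ => yuleWeight k (lam * (t : ℝ) ^ ν * ξ) := by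
    simp_rw [hY, mul_assoc]
  have hc : 0 ≤ lam * (t : ℝ) ^ ν := by positivity
  -- The cumulative intensity `Λ` is the Poisson mean used in every representation.
  have hI (ω ξ : ℝ) : ∫ s in (0 : ℝ)..(t : ℝ) ^ ν, ω * lam * ξ * Real.exp (lam * ξ * s) =
      ω * (Real.exp (lam * (t : ℝ) ^ ν * ξ) - 1) := by
    rw [integral_intensity, mul_zero, Real.exp_zero, mul_right_comm]
  simp only [Nat.add_sub_cancel]
  refine ⟨fun h1 => ?_, ?_, ?_, ?_⟩
  · refine ⟨?_, ?_, ?_, ?_, ?_⟩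
    · rw [hY', wrightMean_yuleWeight hν0 h1 hc]
      refine integral_congr_ae (ae_of_all _ fun ξ => integral_congr_ae (ae_of_all _ fun ω => ?_))
      simp only [poissonWeight]
      rw [mul_right_comm lam ξ, show -(ω * Real.exp (lam * (t : ℝ) ^ ν * ξ)) =
        -ω + -(ω * (Real.exp (lam * (t : ℝ) ^ ν * ξ) - 1)) by ring, Real.exp_add, mul_pow]
      ring
    · rw [hY', wrightMean_yuleWeight hν0 h1 hc]
      refine integral_congr_ae (ae_of_all _ fun ξ => integral_congr_ae (ae_of_all _ fun ω => ?_))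
      simp only [poissonWeight]
      rw [mul_right_comm lam ξ, mul_pow]
      ring
    · rw [hY', wrightMean_yuleWeight hν0 h1 hc]
      refine integral_congr_ae (ae_of_all _ fun ξ => integral_congr_ae (ae_of_all _ fun ω => ?_))
      simp only [poissonWeight]
      rw [hI]
      ring
    · refine (integrable_poissonWeight_mul_wrightW hν0 h1 hc k).congr (ae_of_all _ fun z => ?_)
      simp only [poissonWeight]
      rw [hI]
      ring
    · rw [hY', wrightMean_yuleWeight_swap hν0 h1 hlam hτ]
      refine integral_congr_ae (ae_of_all _ fun ω => integral_congr_ae (ae_of_all _ fun s => ?_))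
      simp only [poissonWeight]
      rw [mul_pow]
      ring
  · intro S _ P _ Om Xi N hOm hXi hind h
    rw [h.measureReal_eq_wrightMean hν0 hν1 hlam hOm hXi hind, hY, NNReal.coe_rpow]
  · intro S _ P _ N μ hN hμ
    have := hμ.isProbabilityMeasure t
    rw [hY, ← hμ.integral_yuleWeight hν0 hν1 hlam ht k,
      ← integral_exp_mul_integral_poissonWeight hlam]
    refine setIntegral_congr_fun measurableSet_Ioi fun ω hω => ?_
    have hω : 0 < ω := hω
    refine congrArg (Real.exp (-ω) * ·) ?_
    refine integral_congr_ae (ae_of_all _ fun s => ?_)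
    have hs : 0 ≤ lam * s := by positivity
    refine ((hN ω hω).measureReal_eq s k (mul_nonneg hω.le (exp_sub_one_nonneg hs)) ?_).symm
    simpa using integral_intensity ω lam 1 0 s
  · intro S _ P _ Om N T μ hOm h hμ hT hTμ hind
    rw [hY, ← hμ.integral_yuleWeight hν0 hν1 hlam ht k, ← hTμ]
    exact measureReal_time_change h.measurable hT
      -- Independence of `T` from the whole pair is needed only through each single coordinate `N
      -- s`.
      (fun s => hind.comp measurable_id ((measurable_pi_apply s).comp measurable_snd))
      (h.path.mono fun w hw => hw.2) k
      ((continuous_yuleWeight k).comp (by fun_prop))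
      (fun s => abs_yuleWeight_le (by positivity) k)
      fun s => h.measureReal_eq_yuleWeight hlam hOm s k
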